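/- Let $K$ be a field of characteristic $0$, let $d\ge 1$ and $1\le i\le d$, let $r,s\in\mathbb Z$ and $\lambda=(r,s,\dots,s)\in\mathbb Z^{d+1}$. Let $\mathbf G=\mathrm{GL}_{d+1}$ act on $\mathbb P^d_K$ by $g\cdot[q_0:\dots:q_d]=[q_0:\dots:q_d]\,g^{-1}$, let $\mathfrak g=\mathfrak{gl}_{d+1}(K)$, and let $\mathcal L_\lambda=\mathcal O(r-s)\otimes\det^s$ be the homogeneous line bundle on $\mathbb P^d_K$ attached to $\lambda$. Put $\mathbb P^{d-i}_K=V(X_0,\dots,X_{i-1})\subset\mathbb P^d_K$, whose stabilizer in $\mathbf G$ is the upper block triangular parabolic subgroup $\mathbf P^+=\mathbf P^+_{(i,d-i+1)}$ with blocks of sizes $i$ and $d+1-i$, and let $$\tilde H^i_{\mathbb P^{d-i}_K}(\mathbb P^d_K,\mathcal L_\lambda)=\ker\bigl(H^i_{\mathbb P^{d-i}_K}(\mathbb P^d_K,\mathcal L_\lambda)\to H^i(\mathbb P^d_K,\mathcal L_\lambda)\bigr),$$ on which $\mathbf P^+$ acts by functoriality and $U(\mathfrak g)$ acts through the homogeneous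 structure of $\mathcal L_\lambda$. Let $w_j=s_j\cdots s_1$ be products of simple reflections in the Weyl group $S_{d+1}$ (with $s_k$ the transposition of $k-1$ and $k$ in $\{0,\dots,d\}$), and let $\cdot$ be the dot action, so that $w_j\cdot\lambda=(s-1,\dots,s-1,r+j,s,\dots,s)$ with $j$ entries $s-1$, for $0\le j\le d$. Let $i_0$ be the unique integer $0\le i_0\le d$ such that $w_{i_0}\cdot\lambda$ is dominant for the upper triangular Borel subgroup if such an integer exists, and otherwise the unique integer $0\le i_0<d$ with $w_{i_0}\cdot\lambda=w_{i_0+1}\cdot\lambda$. Put $\mu_{i,\lambda}=w_{i-1}\cdot\lambda$ if $i\le i_0$ and $\mu_{i,\lambda}=w_i\cdot\lambda$ if $i>i_0$. Let $L(\mu_{i,\lambda})$ be the simple quotient of the Verma module $U(\mathfrak g)\otimes_{U(\mathfrak b)}K_{\mu_{i,\lambda}}$, where $\mathfrak b$ is the Lie algebra of upper triangular matrices. Then the action of $\mathrm{Lie}(\mathbf P^+)$ on $L(\mu_{i,\lambda})$ integrates to an algebraic representation of $\mathbf P^+$ that is compatible with the adjoint action on $U(\mathfrak g)$, so that $L(\mu_{i,\lambda})$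 is a $\mathbf P^+\ltimes U(\mathfrak g)$-module, and there is an isomorphism of $\mathbf P^+\ltimes U(\mathfrak g)$-modules $$\tilde H^i_{\mathbb P^{d-i}_K}(\mathbb P^d_K,\mathcal L_\lambda)\;\cong\;L(\mu_{i,\lambda}).$$ -/

import Mathlib

attribute [local instance 100] LieRing.ofAssociativeRing

noncomputable section

namespace ProjLine

variable (K : Type*) [Field K] (d : ℕ)

/-! ### Groups, Lie algebras, homogeneous coordinates -/

/-- The Lie algebra `𝔤 = 𝔤𝔩_{d+1}` over `K`, with the commutator bracket. -/
abbrev Gl : Type _ := Matrix (Fin (d + 1)) (Fin (d + 1)) K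

/-- The enveloping algebra `U(𝔤)`. -/
abbrev Ug : Type _ := UniversalEnvelopingAlgebra K (Gl K d)

/-- The group of `K`-points of the standard upper block triangular parabolic subgroup of `GL_{d+1}`
attached to the decomposition `(i, d + 1 - i)`. -/
def parabolic (i : ℕ) : Subgroup (GL (Fin (d + 1)) K) where
  carrier := {g | ∀ a b : Fin (d + 1), (b : ℕ) < i → i ≤ (a : ℕ) → g.1 a b = 0}
  one_mem' := by
    intro a b hb ha
    have : a ≠ b := by rintro rfl; omega
    simp [this]
  mul_mem' := by
    intro g h hg hh a b hb ha
    simp only [Units.val_mul, Matrix.mul_apply]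
    refine Finset.sum_eq_zero fun c _ => ?_
    by_cases hc : (c : ℕ) < i
    · rw [hg a c hc ha, zero_mul]
    · rw [hh c b hb (not_lt.mp hc), mul_zero]
  inv_mem' := by
    intro g hg a b hb ha
    have hT : Matrix.BlockTriangular g.1 (fun a : Fin (d + 1) => decide (i ≤ (a : ℕ))) := by
      intro a b hab
      obtain ⟨h1, h2⟩ := Bool.lt_iff.mp hab
      exact hg a b (by simpa using h1) (by simpa using h2)
    have : Invertible g.1 := g.isUnit.invertible
    have := Matrix.blockTriangular_inv_of_blockTriangular hT
    rw [Matrix.coe_units_inv]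
    apply this
    rw [Bool.lt_iff]
    exact ⟨by simpa using hb, by simpa using ha⟩

/-- The Lie algebra of the parabolic subgroup: block upper triangular matrices. -/
def parabolicLie (i : ℕ) : Set (Gl K d) :=
  {x | ∀ a b : Fin (d + 1), (b : ℕ) < i → i ≤ (a : ℕ) → x a b = 0}

/-- The homogeneous coordinate ring `K[X_0, …, X_d]`. -/
abbrev Coord : Type _ := MvPolynomial (Fin (d + 1)) K

/-- The field `K(X_0, …, X_d)`. -/
abbrev Rat : Type _ := FractionRing (Coord K d)

/-- The nonzero linear forms `v_0 X_0 + ⋯ + v_d X_d`, given by their coefficients. -/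
abbrev LinForm : Type _ := {v : Fin (d + 1) → K // v ≠ 0}

variable {K d}

/-- The linear form with coefficient vector `v`. -/
def lin (v : Fin (d + 1) → K) : Coord K d := ∑ a, MvPolynomial.C (v a) * MvPolynomial.X a

/-! ### Cohomology of `𝒪(n)` on projective space, with supports

`D(ℓ)` is the affine open subset of `ℙ^d` where the linear form `ℓ` does not vanish. The sections of
`𝒪(n)` over finite intersections of such sets are realised inside `K(X_0, …, X_d)`. Cohomology is
Čech cohomology for the covering of `ℙ^d` by all `D(ℓ)`; this covering by affine open subsets
is stable under `GL_{d+1}(K)`. -/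

/-- The sections of `𝒪(n)` over `D(ℓ_0) ∩ ⋯ ∩ D(ℓ_p)`: the fractions `h / (ℓ_0 ⋯ ℓ_p)^N` with
`h` homogeneous of degree `n + N (p + 1)`. -/
def sections (n : ℤ) {p : ℕ} (t : Fin (p + 1) → LinForm K d) : Submodule K (Rat K d) where
  carrier := {q | ∃ (N m : ℕ) (h : Coord K d), h.IsHomogeneous m ∧ (m : ℤ) = n + N * (p + 1) ∧
    q * algebraMap (Coord K d) (Rat K d) (∏ j, lin (t j).1) ^ N = algebraMap _ _ h}
  zero_mem' := by
    refine ⟨n.natAbs, (n + n.natAbs * (p + 1)).toNat, 0, MvPolynomial.isHomogeneous_zero _ _ _,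
      ?_, by simp⟩
    rw [Int.toNat_of_nonneg]
    have h1 : (0 : ℤ) ≤ (n.natAbs : ℤ) * p := by positivity
    have h2 : 0 ≤ n + (n.natAbs : ℤ) := by omega
    linarith
  add_mem' := by
    rintro q q' ⟨N, m, h, hh, hm, hq⟩ ⟨N', m', h', hh', hm', hq'⟩
    have hL : (∏ j, lin (t j).1 : Coord K d).IsHomogeneous (p + 1) := by
      have := MvPolynomial.IsHomogeneous.prod (Finset.univ : Finset (Fin (p + 1)))
        (fun j => (lin (t j).1 : Coord K d)) (fun _ => 1) (fun j _ =>
          MvPolynomial.IsHomogeneous.sum _ _ _ fun a _ => by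
            simpa using (MvPolynomial.isHomogeneous_C (Fin (d + 1)) ((t j).1 a)).mul
              (MvPolynomial.isHomogeneous_X K a))
      simpa using this
    refine ⟨N + N', m + (p + 1) * N', h * (∏ j, lin (t j).1) ^ N' + h' * (∏ j, lin (t j).1) ^ N,
      (hh.mul (hL.pow N')).add ?_, by push_cast; rw [hm]; ring, ?_⟩
    · have e : m + (p + 1) * N' = m' + (p + 1) * N := by
        zify; rw [hm, hm']; ring
      rw [e]
      exact hh'.mul (hL.pow N)
    · simp only [map_add, map_mul, map_pow, ← hq, ← hq']
      ring
  smul_mem' := by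
    rintro c q ⟨N, m, h, hh, hm, hq⟩
    refine ⟨N, m, c • h, ?_, hm, ?_⟩
    · rw [MvPolynomial.smul_eq_C_mul]
      simpa using (MvPolynomial.isHomogeneous_C (Fin (d + 1)) c).mul hh
    · rw [smul_mul_assoc, hq, ← IsScalarTower.coe_toAlgHom' K, map_smul]

theorem lin_isHomogeneous (v : Fin (d + 1) → K) : (lin v : Coord K d).IsHomogeneous 1 :=
  MvPolynomial.IsHomogeneous.sum _ _ _ fun a _ => by
    simpa using (MvPolynomial.isHomogeneous_C (Fin (d + 1)) (v a)).mul
      (MvPolynomial.isHomogeneous_X K a)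

theorem prod_lin_isHomogeneous {p : ℕ} (t : Fin (p + 1) → LinForm K d) :
    (∏ j, lin (t j).1 : Coord K d).IsHomogeneous (p + 1) := by
  have := MvPolynomial.IsHomogeneous.prod (Finset.univ : Finset (Fin (p + 1)))
    (fun j => (lin (t j).1 : Coord K d)) (fun _ => 1) (fun j _ => lin_isHomogeneous _)
  simpa using this

variable (K d) in
/-- Families of rational functions indexed by `(p + 1)`-tuples of linear forms. -/
abbrev Family (p : ℕ) : Type _ := (Fin (p + 1) → LinForm K d) → Rat K d

variable (K d) in
/-- The Čech differential. -/
def differential (p : ℕ) : Family K d p →ₗ[K] Family K d (p + 1) where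
  toFun c t := ∑ j : Fin (p + 2), (-1 : ℤ) ^ (j : ℕ) • c (t ∘ j.succAbove)
  map_add' c c' := by
    funext t
    simp [Finset.sum_add_distrib]
  map_smul' k c := by
    funext t
    simp only [Pi.smul_apply, RingHom.id_apply, Finset.smul_sum]
    exact Finset.sum_congr rfl fun j _ => smul_comm _ _ _

/-- The Čech `p`-cochains of `𝒪(n)` for the covering of `ℙ^d` by all `D(ℓ)` which restrict to zero
on `⋃_{ℓ ∈ W} D(ℓ)`. The Čech complex of `ℙ^d` maps termwise surjectively to the one of
`⋃_{ℓ ∈ W} D(ℓ)`, and these cochains form the kernel; so this complex computes the cohomology with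
supports in the common zero set of the forms in `W`. For `W = ∅` it is the Čech complex of `ℙ^d`. -/
def cochains (n : ℤ) (W : Set (LinForm K d)) (p : ℕ) : Submodule K (Family K d p) where
  carrier := {c | (∀ t, c t ∈ sections n t) ∧ ∀ t, (∀ j, t j ∈ W) → c t = 0}
  zero_mem' := ⟨fun _ => Submodule.zero_mem _, fun _ _ => rfl⟩
  add_mem' := fun h h' => ⟨fun t => Submodule.add_mem _ (h.1 t) (h'.1 t), fun t ht => by
    simp [h.2 t ht, h'.2 t ht]⟩
  smul_mem' := fun k _ h => ⟨fun t => Submodule.smul_mem _ k (h.1 t), fun t ht => by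
    simp [h.2 t ht]⟩

/-- Cocycles. -/
def cocycles (n : ℤ) (W : Set (LinForm K d)) (p : ℕ) : Submodule K (Family K d p) :=
  cochains n W p ⊓ LinearMap.ker (differential K d p)

/-- Coboundaries. -/
def coboundaries (n : ℤ) (W : Set (LinForm K d)) : (p : ℕ) → Submodule K (Family K d p)
  | 0 => ⊥
  | p + 1 => (cochains n W p).map (differential K d p)

/-- `H^p_Z(ℙ^d, 𝒪(n))`, where `Z` is the common zero set of the forms in `W`
(all of `ℙ^d` for `W = ∅`). -/
abbrev Cohomology (n : ℤ) (W : Set (LinForm K d)) (p : ℕ) : Type _ :=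
  cocycles n W p ⧸ (coboundaries n W p).submoduleOf (cocycles n W p)

theorem cochains_le (n : ℤ) (W : Set (LinForm K d)) (p : ℕ) :
    cochains n W p ≤ cochains n ∅ p :=
  fun _ h => ⟨h.1, fun _ ht => (ht 0).elim⟩

theorem cocycles_le (n : ℤ) (W : Set (LinForm K d)) (p : ℕ) :
    cocycles n W p ≤ cocycles n ∅ p :=
  inf_le_inf_right _ (cochains_le n W p)

theorem coboundaries_le (n : ℤ) (W : Set (LinForm K d)) (p : ℕ) :
    coboundaries n W p ≤ coboundaries n ∅ p := by
  cases p with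
  | zero => exact le_rfl
  | succ p => exact Submodule.map_mono (cochains_le n W p)

/-- The natural map `H^p_Z(ℙ^d, 𝒪(n)) → H^p(ℙ^d, 𝒪(n))`. -/
def forgetSupport (n : ℤ) (W : Set (LinForm K d)) (p : ℕ) :
    Cohomology n W p →ₗ[K] Cohomology n (∅ : Set (LinForm K d)) p :=
  Submodule.mapQ _ _ (Submodule.inclusion (cocycles_le n W p))
    fun c (hc : c.1 ∈ coboundaries n W p) => coboundaries_le n W p hc

variable (K d) in
/-- The nonzero linear forms in `X_0, …, X_{i-1}`; their common zero set is
`ℙ^{d-i} = V(X_0, …, X_{i-1})`. -/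
def firstForms (i : ℕ) : Set (LinForm K d) :=
  {v | ∀ a : Fin (d + 1), i ≤ (a : ℕ) → v.1 a = 0}

variable (K d) in
/-- The kernel `H̃^i_{ℙ^{d-i}}(ℙ^d, 𝒪(n))` of `H^i_{ℙ^{d-i}}(ℙ^d, 𝒪(n)) → H^i(ℙ^d, 𝒪(n))`, where
`ℙ^{d-i} = V(X_0, …, X_{i-1})`. -/
abbrev HTilde (n : ℤ) (i : ℕ) : Type _ :=
  LinearMap.ker (forgetSupport n (firstForms K d i) i)

/-! ### Functoriality -/

/-- The operator on families given by an endomorphism `A` of the field of rational functions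
and a self map `σ` of the covering. -/
def familyMap (A : Module.End K (Rat K d)) (σ : LinForm K d → LinForm K d) (p : ℕ) :
    Module.End K (Family K d p) where
  toFun c t := A (c (σ ∘ t))
  map_add' c c' := by funext t; simp
  map_smul' k c := by funext t; simp

/-- `A` maps sections over `⋂ D(σ ℓ_j)` to sections over `⋂ D(ℓ_j)`, and `σ` preserves `W`. -/
structure Admissible (n : ℤ) (W : Set (LinForm K d)) (A : Module.End K (Rat K d))
    (σ : LinForm K d → LinForm K d) : Prop where
  sections_mem : ∀ (p : ℕ) (t : Fin (p + 1) → LinForm K d), ∀ q ∈ sections n (σ ∘ t),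
    A q ∈ sections n t
  mapsTo : ∀ v ∈ W, σ v ∈ W

section

variable {n : ℤ} {W : Set (LinForm K d)} {A B : Module.End K (Rat K d)}
  {σ τ : LinForm K d → LinForm K d}

theorem Admissible.empty (h : Admissible n W A σ) : Admissible n ∅ A σ :=
  ⟨h.sections_mem, fun _ hv => hv.elim⟩

theorem differential_familyMap (A : Module.End K (Rat K d)) (σ : LinForm K d → LinForm K d)
    (p : ℕ) (c : Family K d p) :
    differential K d p (familyMap A σ p c) = familyMap A σ (p + 1) (differential K d p c) := by
  funext t
  simp only [differential, familyMap, LinearMap.coe_mk, AddHom.coe_mk, map_sum, map_zsmul]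
  rfl

theorem Admissible.cochains_mem (h : Admissible n W A σ) {p : ℕ} {c : Family K d p}
    (hc : c ∈ cochains n W p) : familyMap A σ p c ∈ cochains n W p :=
  ⟨fun t => h.sections_mem p t _ (hc.1 _), fun t ht => by
    have : c (σ ∘ t) = 0 := hc.2 _ fun j => h.mapsTo _ (ht j)
    simp [familyMap, this]⟩

theorem Admissible.cocycles_mem (h : Admissible n W A σ) {p : ℕ} {c : Family K d p}
    (hc : c ∈ cocycles n W p) : familyMap A σ p c ∈ cocycles n W p := by
  refine ⟨h.cochains_mem hc.1, ?_⟩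
  have h2 : differential K d p c = 0 := hc.2
  change differential K d p _ = 0
  rw [differential_familyMap, h2, map_zero]

theorem Admissible.coboundaries_mem (h : Admissible n W A σ) {p : ℕ} {c : Family K d p}
    (hc : c ∈ coboundaries n W p) : familyMap A σ p c ∈ coboundaries n W p := by
  cases p with
  | zero =>
    have : c = 0 := hc
    rw [this, map_zero]
    exact Submodule.zero_mem _
  | succ p =>
    obtain ⟨b, hb, rfl⟩ := hc
    exact ⟨familyMap A σ p b, h.cochains_mem hb, differential_familyMap A σ p b⟩

/-- The endomorphism of cohomology induced by an admissible pair. -/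
def Admissible.cohomologyMap (h : Admissible n W A σ) (p : ℕ) : Module.End K (Cohomology n W p) :=
  Submodule.mapQ _ _ ((familyMap A σ p).restrict fun _ hc => h.cocycles_mem hc)
    fun c (hc : c.1 ∈ coboundaries n W p) => h.coboundaries_mem hc

theorem Admissible.cohomologyMap_mk (h : Admissible n W A σ) (p : ℕ) (c : cocycles n W p) :
    h.cohomologyMap p (Submodule.Quotient.mk c) =
      Submodule.Quotient.mk ⟨familyMap A σ p c, h.cocycles_mem c.2⟩ := rfl

theorem Admissible.forget_comm (h : Admissible n W A σ) (p : ℕ) (x : Cohomology n W p) :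
    forgetSupport n W p (h.cohomologyMap p x) =
      h.empty.cohomologyMap p (forgetSupport n W p x) := by
  obtain ⟨c, rfl⟩ := Submodule.Quotient.mk_surjective _ x
  rfl

end

/-- The endomorphism of `H̃` induced by an admissible pair. -/
def Admissible.tildeMap {n : ℤ} {i : ℕ} {A : Module.End K (Rat K d)}
    {σ : LinForm K d → LinForm K d} (h : Admissible n (firstForms K d i) A σ) :
    Module.End K (HTilde K d n i) :=
  (h.cohomologyMap i).restrict fun x (hx : forgetSupport n _ i x = 0) => by
    change forgetSupport n _ i _ = 0
    rw [h.forget_comm, hx, map_zero]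

/-! ### The action of the group -/

/-- The substitution `X_b ↦ ∑_a g_{ab} X_a` on `K[X_0, …, X_d]`. -/
def substHom (g : Gl K d) : Coord K d →ₐ[K] Coord K d :=
  MvPolynomial.aeval fun b => lin fun a => g a b

theorem substHom_lin (g : Gl K d) (v : Fin (d + 1) → K) :
    substHom g (lin v) = lin (g.mulVec v) := by
  simp only [lin, substHom, map_sum, map_mul, MvPolynomial.algHom_C, MvPolynomial.aeval_X,
    MvPolynomial.algebraMap_eq, Matrix.mulVec, dotProduct, Finset.mul_sum, Finset.sum_mul]
  rw [Finset.sum_comm]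
  refine Finset.sum_congr rfl fun a _ => Finset.sum_congr rfl fun b _ => ?_
  ring

theorem substHom_mul (g h : Gl K d) : substHom (g * h) = (substHom g).comp (substHom h) := by
  refine MvPolynomial.algHom_ext fun b => ?_
  have e : ∀ k : Gl K d, substHom k (MvPolynomial.X b) = lin (fun a => k a b) := fun k => by
    simp [substHom]
  rw [AlgHom.comp_apply, e, e, substHom_lin]
  rfl

theorem substHom_one : substHom (1 : Gl K d) = AlgHom.id K (Coord K d) := by
  refine MvPolynomial.algHom_ext fun b => ?_
  simp [substHom, lin, Matrix.one_apply]

/-- The action of `GL_{d+1}(K)` on `K[X_0, …, X_d]`: `(g h)(q) = h(q g)` for row vectors `q`, as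
induced by the action `g · [q] = [q g⁻¹]` on `ℙ^d`. -/
def substEquiv : GL (Fin (d + 1)) K →* (Coord K d ≃ₐ[K] Coord K d) where
  toFun g := AlgEquiv.ofAlgHom (substHom g.1) (substHom g⁻¹.1)
    (by rw [← substHom_mul, Units.mul_inv, substHom_one])
    (by rw [← substHom_mul, Units.inv_mul, substHom_one])
  map_one' := by
    ext1 x
    exact DFunLike.congr_fun substHom_one x
  map_mul' g h := by
    ext1 x
    exact DFunLike.congr_fun (substHom_mul g.1 h.1) x

/-- The induced action on `K(X_0, …, X_d)`. -/
def ratAction : GL (Fin (d + 1)) K →* (Rat K d ≃ₐ[K] Rat K d) :=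
  (IsFractionRing.fieldEquivOfAlgEquivHom K (Rat K d)).comp substEquiv

theorem ratAction_algebraMap (g : GL (Fin (d + 1)) K) (h : Coord K d) :
    ratAction g (algebraMap _ (Rat K d) h) = algebraMap _ _ (substHom g.1 h) :=
  IsFractionRing.fieldEquivOfAlgEquiv_algebraMap _ _ _ _ _

/-- The action twisted by the character `det^s`. -/
def twistedAction (s : ℤ) : GL (Fin (d + 1)) K →* Module.End K (Rat K d) where
  toFun g := ((Matrix.GeneralLinearGroup.det g ^ s : Kˣ) : K) • (ratAction g).toLinearMap
  map_one' := by
    ext x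
    simp
  map_mul' g h := by
    apply LinearMap.ext
    intro x
    simp [mul_zpow, mul_smul, smul_comm ((g.1.det) ^ s)]

/-- The action of `GL_{d+1}(K)` on nonzero linear forms. -/
def formAction (g : GL (Fin (d + 1)) K) (v : LinForm K d) : LinForm K d :=
  ⟨g.1.mulVec v.1, fun h => v.2 (by
    have := congrArg (g⁻¹.1.mulVec) h
    rwa [Matrix.mulVec_mulVec, Units.inv_mul, Matrix.one_mulVec, Matrix.mulVec_zero] at this)⟩

theorem formAction_one : formAction (1 : GL (Fin (d + 1)) K) = id := by
  funext v
  apply Subtype.ext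
  simp [formAction]

theorem formAction_mul (g h : GL (Fin (d + 1)) K) :
    formAction (g * h) = formAction g ∘ formAction h := by
  funext v
  apply Subtype.ext
  simp [formAction, Matrix.mulVec_mulVec]

theorem substHom_isHomogeneous (g : Gl K d) {h : Coord K d} {m : ℕ} (hh : h.IsHomogeneous m) :
    (substHom g h).IsHomogeneous m := by
  have := hh.aeval (fun b => lin fun a => g a b) (fun b => lin_isHomogeneous _)
  rwa [one_mul] at this

theorem group_admissible (n s : ℤ) (i : ℕ) (g : parabolic K d i) :
    Admissible n (firstForms K d i) (twistedAction s g.1) (formAction g.1⁻¹) where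
  sections_mem := by
    rintro p t q ⟨N, m, h, hh, hm, hq⟩
    apply Submodule.smul_mem
    refine ⟨N, m, substHom g.1.1 h, substHom_isHomogeneous _ hh, hm, ?_⟩
    have := congrArg (ratAction g.1) hq
    rw [map_mul, map_pow, ratAction_algebraMap, ratAction_algebraMap, map_prod] at this
    rw [← this]
    have e : ∀ j, substHom g.1.1 (lin ((formAction g.1⁻¹ ∘ t) j).1) = lin (t j).1 := by
      intro j
      rw [substHom_lin]
      congr 1
      simp [formAction, Matrix.mulVec_mulVec]
    simp only [e]
    rfl
  mapsTo := by
    intro v hv a ha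
    change (g.1⁻¹.1.mulVec v.1) a = 0
    simp only [Matrix.mulVec, dotProduct]
    refine Finset.sum_eq_zero fun b _ => ?_
    by_cases hb : (b : ℕ) < i
    · have h0 : g.1⁻¹.1 a b = 0 := (g⁻¹).2 a b hb ha
      rw [h0, zero_mul]
    · rw [hv b (not_lt.mp hb), mul_zero]

/-- The action by functoriality of the stabilizer of `ℙ^{d-i}` on
`H̃^i_{ℙ^{d-i}}(ℙ^d, 𝒪(n) ⊗ det^s)`. On cochains it is `(g c)(ℓ_0, …) = g (c(g⁻¹ ℓ_0, …))`. -/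
def groupAction (n s : ℤ) (i : ℕ) : Representation K (parabolic K d i) (HTilde K d n i) where
  toFun g := (group_admissible n s i g).tildeMap
  map_one' := by
    apply LinearMap.ext
    rintro ⟨x, hx⟩
    obtain ⟨c, rfl⟩ := Submodule.Quotient.mk_surjective _ x
    apply Subtype.ext
    change Submodule.Quotient.mk _ = Submodule.Quotient.mk _
    congr 1
    apply Subtype.ext
    funext t
    change twistedAction s 1 (c.1 (formAction 1⁻¹ ∘ t)) = c.1 t
    rw [inv_one, formAction_one, map_one]
    rfl
  map_mul' g h := by
    apply LinearMap.ext
    rintro ⟨x, hx⟩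
    obtain ⟨c, rfl⟩ := Submodule.Quotient.mk_surjective _ x
    apply Subtype.ext
    change Submodule.Quotient.mk _ = Submodule.Quotient.mk _
    congr 1
    apply Subtype.ext
    funext t
    change twistedAction s (g.1 * h.1) (c.1 (formAction (g.1 * h.1)⁻¹ ∘ t)) =
      twistedAction s g.1 (twistedAction s h.1 (c.1 (formAction h.1⁻¹ ∘ (formAction g.1⁻¹ ∘ t))))
    rw [mul_inv_rev, formAction_mul, map_mul]
    rfl

/-! ### The action of the Lie algebra -/

/-- For a derivation `D` of `K[X_0, …, X_d]`, the homomorphism `h ↦ h + ε D(h)`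
to the dual numbers over `K(X_0, …, X_d)`. -/
def dualHom (D : Derivation K (Coord K d) (Coord K d)) : Coord K d →+* DualNumber (Rat K d) where
  toFun h := TrivSqZeroExt.inl (algebraMap (Coord K d) (Rat K d) h) +
    TrivSqZeroExt.inr (algebraMap (Coord K d) (Rat K d) (D h))
  map_one' := by
    rw [D.map_one_eq_zero, map_zero, map_one, TrivSqZeroExt.inr_zero, TrivSqZeroExt.inl_one,
      add_zero]
  map_mul' h h' := by
    rw [D.leibniz]
    apply TrivSqZeroExt.ext
    · simp only [TrivSqZeroExt.fst_add, TrivSqZeroExt.fst_inl, TrivSqZeroExt.fst_inr,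
        TrivSqZeroExt.fst_mul, add_zero, map_mul]
    · simp only [TrivSqZeroExt.snd_add, TrivSqZeroExt.snd_inl, TrivSqZeroExt.snd_inr,
        TrivSqZeroExt.snd_mul, TrivSqZeroExt.fst_add, TrivSqZeroExt.fst_inl,
        TrivSqZeroExt.fst_inr, add_zero, zero_add, map_mul, map_add, smul_eq_mul,
        op_smul_eq_smul]
  map_zero' := by
    rw [map_zero, map_zero, map_zero, TrivSqZeroExt.inr_zero, TrivSqZeroExt.inl_zero, add_zero]
  map_add' h h' := by
    rw [map_add, map_add, map_add, TrivSqZeroExt.inl_add, TrivSqZeroExt.inr_add]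
    abel

theorem dualHom_fst (D : Derivation K (Coord K d) (Coord K d)) (h : Coord K d) :
    (dualHom D h).fst = algebraMap _ _ h :=
  add_zero _

theorem dualHom_snd (D : Derivation K (Coord K d) (Coord K d)) (h : Coord K d) :
    (dualHom D h).snd = algebraMap _ _ (D h) :=
  zero_add _

/-- Its extension to `K(X_0, …, X_d)`. -/
def dualLift (D : Derivation K (Coord K d) (Coord K d)) : Rat K d →+* DualNumber (Rat K d) :=
  IsLocalization.lift (M := nonZeroDivisors (Coord K d)) (g := dualHom D) fun y => by
    rw [TrivSqZeroExt.isUnit_iff_isUnit_fst]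
    have : algebraMap (Coord K d) (Rat K d) y ≠ 0 :=
      IsFractionRing.to_map_ne_zero_of_mem_nonZeroDivisors y.2
    rw [dualHom_fst]
    exact isUnit_iff_ne_zero.mpr this

theorem dualLift_algebraMap (D : Derivation K (Coord K d) (Coord K d)) (h : Coord K d) :
    dualLift D (algebraMap _ _ h) = dualHom D h :=
  IsLocalization.lift_eq _ _

theorem dualLift_fst (D : Derivation K (Coord K d) (Coord K d)) (q : Rat K d) :
    (dualLift D q).fst = q := by
  have : ((TrivSqZeroExt.fstHom (Rat K d) (Rat K d) (Rat K d)).toRingHom.comp (dualLift D)) =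
      RingHom.id _ := by
    apply IsLocalization.ringHom_ext (nonZeroDivisors (Coord K d))
    apply RingHom.ext
    intro h
    simp [dualLift_algebraMap, dualHom_fst]
  exact DFunLike.congr_fun this q

/-- The extension of a derivation of `K[X_0, …, X_d]` to `K(X_0, …, X_d)`. -/
def extendDerivation (D : Derivation K (Coord K d) (Coord K d)) :
    Derivation K (Rat K d) (Rat K d) where
  toFun q := (dualLift D q).snd
  map_add' := by simp
  map_smul' k q := by
    have : algebraMap K (Rat K d) k = algebraMap (Coord K d) (Rat K d) (algebraMap K _ k) :=
      IsScalarTower.algebraMap_apply _ _ _ _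
    rw [Algebra.smul_def, map_mul, this, dualLift_algebraMap]
    rw [TrivSqZeroExt.snd_mul, dualHom_snd, dualHom_fst, dualLift_fst, Derivation.map_algebraMap,
      map_zero, smul_zero, add_zero, ← this, smul_eq_mul, RingHom.id_apply, Algebra.smul_def]
  map_one_eq_zero' := by simp
  leibniz' q q' := by
    simp [dualLift_fst, mul_comm]

theorem extendDerivation_algebraMap (D : Derivation K (Coord K d) (Coord K d)) (h : Coord K d) :
    extendDerivation D (algebraMap _ _ h) = algebraMap _ _ (D h) := by
  change (dualLift D _).snd = _
  rw [dualLift_algebraMap, dualHom_snd]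

theorem ratDerivation_ext {D D' : Derivation K (Rat K d) (Rat K d)}
    (h : ∀ b, D (algebraMap (Coord K d) _ (MvPolynomial.X b)) =
      D' (algebraMap (Coord K d) _ (MvPolynomial.X b))) :
    D = D' := by
  have key : ∀ f : Coord K d, D (algebraMap _ _ f) = D' (algebraMap _ _ f) := by
    intro f
    induction f using MvPolynomial.induction_on with
    | C a =>
      have : algebraMap (Coord K d) (Rat K d) (MvPolynomial.C a) = algebraMap K _ a :=
        (IsScalarTower.algebraMap_apply K (Coord K d) (Rat K d) a).symm
      rw [this, D.map_algebraMap, D'.map_algebraMap]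
    | add p q hp hq => rw [map_add, map_add, map_add, hp, hq]
    | mul_X p b hp => rw [map_mul, D.leibniz, D'.leibniz, hp, h b]
  ext q
  obtain ⟨f, g, hg, rfl⟩ := IsFractionRing.div_surjective (A := Coord K d) q
  have hg0 : algebraMap (Coord K d) (Rat K d) g ≠ 0 :=
    IsFractionRing.to_map_ne_zero_of_mem_nonZeroDivisors hg
  rw [D.leibniz_div, D'.leibniz_div, key, key]

/-- The derivation `∑ x_{ab} X_a ∂/∂X_b` of `K[X_0, …, X_d]`. -/
def coordDerivation (x : Gl K d) : Derivation K (Coord K d) (Coord K d) :=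
  MvPolynomial.mkDerivation K fun b => lin fun a => x a b

/-- The derivation `∑ x_{ab} X_a ∂/∂X_b` of `K(X_0, …, X_d)`. -/
def vectorField (x : Gl K d) : Derivation K (Rat K d) (Rat K d) :=
  extendDerivation (coordDerivation x)

theorem coordDerivation_lin (x : Gl K d) (v : Fin (d + 1) → K) :
    coordDerivation x (lin v) = lin (x.mulVec v) := by
  simp only [lin, coordDerivation, map_sum, Derivation.leibniz, MvPolynomial.mkDerivation_X,
    MvPolynomial.derivation_C, smul_eq_mul, Matrix.mulVec, dotProduct,
    Finset.mul_sum, Finset.sum_mul, map_mul]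
  simp only [mul_zero, add_zero]
  rw [Finset.sum_comm]
  refine Finset.sum_congr rfl fun a _ => Finset.sum_congr rfl fun b _ => ?_
  ring

theorem vectorField_X (x : Gl K d) (b : Fin (d + 1)) :
    vectorField x (algebraMap (Coord K d) _ (MvPolynomial.X b)) =
      algebraMap _ _ (lin fun a => x a b) := by
  rw [vectorField, extendDerivation_algebraMap]
  simp [coordDerivation]

theorem vectorField_lin (x : Gl K d) (v : Fin (d + 1) → K) :
    vectorField x (algebraMap (Coord K d) _ (lin v)) = algebraMap _ _ (lin (x.mulVec v)) := by
  rw [vectorField, extendDerivation_algebraMap, coordDerivation_lin]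

theorem lin_add (v w : Fin (d + 1) → K) : (lin (v + w) : Coord K d) = lin v + lin w := by
  simp [lin, add_mul, Finset.sum_add_distrib]

theorem lin_sub (v w : Fin (d + 1) → K) : (lin (v - w) : Coord K d) = lin v - lin w := by
  simp [lin, sub_mul, Finset.sum_sub_distrib]

theorem lin_smul (k : K) (v : Fin (d + 1) → K) : (lin (k • v) : Coord K d) = k • lin v := by
  simp [lin, Finset.smul_sum, MvPolynomial.smul_eq_C_mul, mul_assoc]

/-- The action of `𝔤` on rational sections of `𝒪(n) ⊗ det^s`, the differential of the action of
the group. -/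
def twistedLie (s : ℤ) (x : Gl K d) : Module.End K (Rat K d) :=
  (vectorField x : Rat K d →ₗ[K] Rat K d) + ((s : K) * x.trace) • 1

theorem twistedLie_add (s : ℤ) (x y : Gl K d) :
    twistedLie s (x + y) = twistedLie s x + twistedLie s y := by
  have h : vectorField (x + y) = vectorField x + vectorField y := by
    apply ratDerivation_ext
    intro b
    rw [Derivation.add_apply, vectorField_X, vectorField_X, vectorField_X, ← map_add, ← lin_add]
    rfl
  ext q
  simp [twistedLie, h, mul_add, add_smul]
  abel

theorem twistedLie_smul (s : ℤ) (k : K) (x : Gl K d) :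
    twistedLie s (k • x) = k • twistedLie s x := by
  have h : vectorField (k • x) = k • vectorField x := by
    apply ratDerivation_ext
    intro b
    rw [Derivation.smul_apply, vectorField_X, vectorField_X,
      ← IsScalarTower.coe_toAlgHom' K, ← map_smul, ← lin_smul]
    rfl
  ext q
  simp [twistedLie, h, smul_smul, mul_left_comm]

theorem twistedLie_lie (s : ℤ) (x y : Gl K d) :
    twistedLie s ⁅x, y⁆ = ⁅twistedLie s x, twistedLie s y⁆ := by
  have h : vectorField ⁅x, y⁆ = ⁅vectorField x, vectorField y⁆ := by
    apply ratDerivation_ext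
    intro b
    rw [Derivation.commutator_apply, vectorField_X, vectorField_X, vectorField_X,
      vectorField_lin, vectorField_lin, ← map_sub, ← lin_sub]
    rfl
  have ht : (⁅x, y⁆ : Gl K d).trace = 0 := by
    rw [Ring.lie_def, Matrix.trace_sub, Matrix.trace_mul_comm, sub_self]
  apply LinearMap.ext
  intro q
  have h1 := DFunLike.congr_fun h q
  rw [Derivation.commutator_apply] at h1
  have e : ∀ (z : Gl K d) (w : Rat K d),
      twistedLie s z w = vectorField z w + ((s : K) * z.trace) • w := fun _ _ => rfl
  have e2 : ∀ A B : Module.End K (Rat K d), ⁅A, B⁆ q = A (B q) - B (A q) := fun _ _ => rfl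
  rw [e2, e, e, e, e, e, h1, ht, mul_zero, zero_smul, add_zero]
  simp only [map_add, Derivation.map_smul, smul_add]
  rw [smul_comm ((s : K) * x.trace) ((s : K) * y.trace)]
  abel

theorem coordDerivation_eq (x : Gl K d) (h : Coord K d) :
    coordDerivation x h = ∑ b, lin (fun a => x a b) * MvPolynomial.pderiv b h := by
  have e : ∀ (D : Fin (d + 1) → Derivation K (Coord K d) (Coord K d)) (f : Coord K d),
      (∑ b, D b) f = ∑ b, D b f := fun D f => by
    have := congrFun (map_sum (Derivation.coeFnAddMonoidHom (R := K) (A := Coord K d)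
      (M := Coord K d)) D Finset.univ) f
    rw [Finset.sum_apply] at this
    exact this
  have : coordDerivation x = ∑ b, (lin (fun a => x a b) : Coord K d) • MvPolynomial.pderiv b := by
    apply MvPolynomial.derivation_ext
    intro c
    rw [e]
    simp [coordDerivation, Pi.single_apply]
  rw [this, e]
  rfl

theorem coordDerivation_isHomogeneous (x : Gl K d) {h : Coord K d} {m : ℕ}
    (hh : h.IsHomogeneous m) : (coordDerivation x h).IsHomogeneous m := by
  rw [coordDerivation_eq]
  refine MvPolynomial.IsHomogeneous.sum _ _ _ fun b _ => ?_
  cases m with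
  | zero =>
    rw [← MvPolynomial.totalDegree_zero_iff_isHomogeneous,
      MvPolynomial.totalDegree_eq_zero_iff_eq_C] at hh
    rw [hh, MvPolynomial.pderiv_C, mul_zero]
    exact MvPolynomial.isHomogeneous_zero _ _ _
  | succ m =>
    have := (lin_isHomogeneous (fun a => x a b)).mul (hh.pderiv (i := b))
    rwa [Nat.add_sub_cancel, Nat.add_comm 1 m] at this

theorem lie_admissible (n s : ℤ) (W : Set (LinForm K d)) (x : Gl K d) :
    Admissible n W (twistedLie s x) id where
  sections_mem := by
    rintro p t q hq
    have hq' := hq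
    obtain ⟨N, m, h, hh, hm, hq⟩ := hq
    refine Submodule.add_mem _ ?_ (Submodule.smul_mem _ _ hq')
    set f : Coord K d := ∏ j, lin (t j).1 with hf
    have hfh : f.IsHomogeneous (p + 1) := prod_lin_isHomogeneous t
    change q * algebraMap (Coord K d) (Rat K d) f ^ N = algebraMap _ _ h at hq
    have h1 := congrArg (vectorField x) hq
    rw [Derivation.leibniz, Derivation.leibniz_pow, vectorField, extendDerivation_algebraMap,
      extendDerivation_algebraMap] at h1
    refine ⟨N + 1, m + (p + 1), f * coordDerivation x h - N * (h * coordDerivation x f), ?_, ?_, ?_⟩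
    · refine MvPolynomial.IsHomogeneous.sub ?_ ?_
      · rw [add_comm m]
        exact hfh.mul (coordDerivation_isHomogeneous x hh)
      · have := (MvPolynomial.isHomogeneous_C (Fin (d + 1)) (N : K)).mul
          (hh.mul (coordDerivation_isHomogeneous x hfh))
        simpa using this
    · push_cast
      rw [hm]
      ring
    · change extendDerivation (coordDerivation x) q * algebraMap (Coord K d) (Rat K d) f ^ (N + 1) = _
      simp only [map_sub, map_mul, map_natCast, ← h1, ← hq]
      cases N with
      | zero => simp; ring
      | succ N => simp; ring
  mapsTo := fun _ hv => hv

/-- The representation of `𝔤` on `H̃^i_{ℙ^{d-i}}(ℙ^d, 𝒪(n) ⊗ det^s)`. -/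
def lieAction (n s : ℤ) (i : ℕ) : Gl K d →ₗ⁅K⁆ Module.End K (HTilde K d n i) where
  toFun x := (lie_admissible n s (firstForms K d i) x).tildeMap
  map_add' x y := by
    apply LinearMap.ext
    rintro ⟨z, hz⟩
    obtain ⟨c, rfl⟩ := Submodule.Quotient.mk_surjective _ z
    apply Subtype.ext
    change Submodule.Quotient.mk _ = Submodule.Quotient.mk _
    congr 1
    apply Subtype.ext
    funext t
    exact DFunLike.congr_fun (twistedLie_add s x y) (c.1 t)
  map_smul' k x := by
    apply LinearMap.ext
    rintro ⟨z, hz⟩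
    obtain ⟨c, rfl⟩ := Submodule.Quotient.mk_surjective _ z
    apply Subtype.ext
    change Submodule.Quotient.mk _ = Submodule.Quotient.mk _
    congr 1
    apply Subtype.ext
    funext t
    exact DFunLike.congr_fun (twistedLie_smul s k x) (c.1 t)
  map_lie' {x y} := by
    apply LinearMap.ext
    rintro ⟨z, hz⟩
    obtain ⟨c, rfl⟩ := Submodule.Quotient.mk_surjective _ z
    apply Subtype.ext
    change Submodule.Quotient.mk _ = Submodule.Quotient.mk _
    congr 1
    apply Subtype.ext
    funext t
    exact DFunLike.congr_fun (twistedLie_lie s x y) (c.1 t)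

/-- The action of `U(𝔤)` on `H̃^i_{ℙ^{d-i}}(ℙ^d, 𝒪(n) ⊗ det^s)`. -/
def envelopingAction (n s : ℤ) (i : ℕ) : Ug K d →ₐ[K] Module.End K (HTilde K d n i) :=
  UniversalEnvelopingAlgebra.lift K (lieAction n s i)

/-! ### Highest weight modules -/

/-- The left ideal of `U(𝔤)` generated by the `E_{ab}`, `a < b`, and the `E_{aa} - μ_a`. -/
def vermaIdeal (μ : Fin (d + 1) → ℤ) : Submodule (Ug K d) (Ug K d) :=
  Submodule.span (Ug K d)
    ({u | ∃ a b : Fin (d + 1), a < b ∧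
        u = UniversalEnvelopingAlgebra.ι K (Matrix.single a b (1 : K) : Gl K d)} ∪
      {u | ∃ a : Fin (d + 1), u = UniversalEnvelopingAlgebra.ι K (Matrix.single a a (1 : K) : Gl K d) -
        algebraMap K (Ug K d) (μ a : K)})

variable (K) in
/-- The Verma module `M(μ) = U(𝔤) ⊗_{U(𝔟)} K_μ`, for the Borel subalgebra `𝔟` of upper triangular
matrices, as the quotient of `U(𝔤)` by the left ideal generated by the kernel of `U(𝔟) → K_μ`. -/
abbrev Verma (μ : Fin (d + 1) → ℤ) : Type _ := Ug K d ⧸ vermaIdeal (K := K) μ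

variable (K) in
/-- The sum of all proper submodules of `M(μ)`. -/
def vermaRadical (μ : Fin (d + 1) → ℤ) : Submodule (Ug K d) (Verma K μ) :=
  sSup {N | N ≠ ⊤}

variable (K) in
/-- `L(μ)`, the simple quotient of `M(μ)`. -/
abbrev SimpleModule (μ : Fin (d + 1) → ℤ) : Type _ := Verma K μ ⧸ vermaRadical K μ

/-! ### Integration of the action of the parabolic subalgebra -/

variable (K d) in
/-- Polynomials in the entries of an invertible matrix (`Sum.inl`) and of its inverse (`Sum.inr`);
they represent the regular functions on `GL_{d+1}` and on its closed subgroups. -/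
abbrev RegularFunction : Type _ :=
  MvPolynomial ((Fin (d + 1) × Fin (d + 1)) ⊕ (Fin (d + 1) × Fin (d + 1))) K

/-- The value at `g`. -/
def RegularFunction.value (F : RegularFunction K d) (g : GL (Fin (d + 1)) K) : K :=
  MvPolynomial.eval (Sum.elim (fun e => g.1 e.1 e.2) (fun e => g⁻¹.1 e.1 e.2)) F

/-- The derivative at the identity in the direction `x`: the coefficient of `ε` in the value at
`1 + ε x`, whose inverse is `1 - ε x`. -/
def RegularFunction.derivAtOne (F : RegularFunction K d) (x : Gl K d) : K :=
  (MvPolynomial.aeval (R := K) (S₁ := DualNumber K)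
    (Sum.elim
      (fun e => TrivSqZeroExt.inl ((1 : Gl K d) e.1 e.2) + TrivSqZeroExt.inr (x e.1 e.2))
      (fun e => TrivSqZeroExt.inl ((1 : Gl K d) e.1 e.2) - TrivSqZeroExt.inr (x e.1 e.2))) F).snd

/-- `ρ` is an algebraic representation of the parabolic subgroup on the `U(𝔤)`-module `M` which
integrates the action of its Lie algebra and makes `M` a module over the semidirect product of
the parabolic subgroup with `U(𝔤)` (for the adjoint action). As the parabolic subgroup is connected
and `K` has characteristic zero, there is at most one such `ρ`. -/
structure IsIntegration {i : ℕ} {M : Type*} [AddCommGroup M] [Module K M] [Module (Ug K d) M]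
    (ρ : Representation K (parabolic K d i) M) : Prop where
  adjoint : ∀ (p : parabolic K d i) (x : Gl K d) (m : M),
    ρ p (UniversalEnvelopingAlgebra.ι K x • m) =
      UniversalEnvelopingAlgebra.ι K (p.1.1 * x * p.1⁻¹.1 : Gl K d) • ρ p m
  algebraic : ∀ m : M, ∃ (k : ℕ) (w : Fin k → M) (F : Fin k → RegularFunction K d),
    (∀ p : parabolic K d i, ρ p m = ∑ j, (F j).value p.1 • w j) ∧
    ∀ x ∈ parabolicLie K d i,
      UniversalEnvelopingAlgebra.ι K x • m = ∑ j, (F j).derivAtOne x • w j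

/-! ### Weights -/

/-- The simple reflection `s_j`, `1 ≤ j ≤ d`, in the Weyl group `S_{d+1}`: the transposition of
`j - 1` and `j`. -/
def simpleReflection (d j : ℕ) : Equiv.Perm (Fin (d + 1)) :=
  if h : j ≤ d then Equiv.swap ⟨j - 1, by omega⟩ ⟨j, by omega⟩ else 1

/-- `w_j = s_j ⋯ s_1`. -/
def weyl (d : ℕ) : ℕ → Equiv.Perm (Fin (d + 1))
  | 0 => 1
  | j + 1 => simpleReflection d (j + 1) * weyl d j

/-- The dot action `w · χ = w(χ + δ) - δ` of the Weyl group on weights. Here `δ = (0, -1, …, -d)`,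
which differs from the half sum of the positive roots by a vector fixed by the Weyl group. -/
def dot {d : ℕ} (w : Equiv.Perm (Fin (d + 1))) (χ : Fin (d + 1) → ℤ) : Fin (d + 1) → ℤ :=
  fun a => (χ (w⁻¹ a) - (w⁻¹ a : ℕ)) + (a : ℕ)

/-- The weight `λ = (r, s, …, s)`. -/
def lineWeight (d : ℕ) (r s : ℤ) : Fin (d + 1) → ℤ := fun a => if a = 0 then r else s

/-- Dominance with respect to the upper triangular Borel subgroup. -/
def IsDominant {d : ℕ} (χ : Fin (d + 1) → ℤ) : Prop := ∀ a b, a ≤ b → χ b ≤ χ a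

open Classical in
/-- The integer `i_0`: the unique `0 ≤ j ≤ d` with `w_j · λ` dominant if there is one, and otherwise
the unique `0 ≤ j < d` with `w_j · λ = w_{j+1} · λ`. -/
def iZero (d : ℕ) (r s : ℤ) : ℕ :=
  if ∃ j ≤ d, IsDominant (dot (weyl d j) (lineWeight d r s)) then
    sInf {j | j ≤ d ∧ IsDominant (dot (weyl d j) (lineWeight d r s))}
  else sInf {j | j < d ∧
    dot (weyl d j) (lineWeight d r s) = dot (weyl d (j + 1)) (lineWeight d r s)}

/-- The weight `μ_{i,λ}`, equal to `w_{i-1} · λ` for `i ≤ i_0` and to `w_i · λ` for `i > i_0`. -/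
def muWeight (d : ℕ) (r s : ℤ) (i : ℕ) : Fin (d + 1) → ℤ :=
  if i ≤ iZero d r s then dot (weyl d (i - 1)) (lineWeight d r s)
  else dot (weyl d i) (lineWeight d r s)

end ProjLine

end

/-! Put `n = r - s` and `p = i - 1`, and let `Z = V(X_0, …, X_p)`. By the long exact sequence of the
support, `H̃` is the cokernel of `H^p(ℙ^d) → H^p(ℙ^d ∖ Z)`: its classes are coboundaries of cochains
on `ℙ^d` that restrict to cocycles off `Z` (`openCocycles`, `theta`). The value of such a cocycle at
`(X_0, …, X_p)` is a Laurent polynomial of degree `n` with poles only along these coordinates. The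
class vanishes exactly when every monomial of this value has a nonnegative exponent at one of `X_0,
…, X_p` (`theta_eq_zero_iff`). The difficulty is that the covering consists of all linear forms. A
cocycle with such a value is first made zero on tuples of coordinates
(`exists_vanishing_coordTuple`), and then partitions of unity extend the vanishing to all tuples of
forms in `X_0, …, X_p` (`exists_vanishesAt`).

Hence `H̃` is the span of the monomials of degree `n` whose exponents are negative exactly at `0, …,
p` (`exists_leading`). They all occur: the cocycle `eta` has value `(X_0 ⋯ X_p)⁻¹`, and
multiplications by `X_a` with `a > p` together with `∂/∂X_a` with `a ≤ p` produce the others,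
dividing by nonzero exponents in characteristic zero. The same construction proves algebraicity of
the group action. On tuples of forms in `X_0, …, X_p` the parabolic acts on `eta` by a character,
while `X_a` and `∂/∂X_a` transform by the entries of `g` and `g⁻¹`.

On these monomials `E_{ab}` acts as `X_a ∂/∂X_b`, plus `s` if `a = b`, discarding what leaves the
cone of exponents. The weights are distinct, so a nonzero submodule contains a monomial; any two
monomials are joined by operators `E_{ab}` with nonzero coefficients, so the module is simple
(`eq_bot_or_eq_cone`). The vector killed by all `E_{ab}` with `a < b` is `(X_0 ⋯ X_p)⁻¹
X_{p+1}^{n+p+1}` if `n + p + 1 ≥ 0`, and `(X_0 ⋯ X_{p-1})⁻¹ X_p^{n+p}` otherwise. Its weight is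
`μ_{i,λ}`, because `i ≤ i_0` means `n + i < 0` (`le_iZero`).

A simple module with a highest weight vector of weight `μ` is `L(μ)`, because all proper submodules
of a Verma module lie in any maximal one (`le_of_isCoatom`, `exists_equiv_simpleModule`). The group
action is finally transported along the isomorphism. -/

noncomputable section

namespace ProjLine

/-! ### Laurent monomials -/

section Laurent

variable {K : Type*} [Field K] {d : ℕ}

variable (K) in
/-- The coordinate `X_a` as a rational function. -/
def ratX (a : Fin (d + 1)) : Rat K d := algebraMap (Coord K d) (Rat K d) (MvPolynomial.X a)

theorem algebraMap_coord_injective :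
    Function.Injective (algebraMap (Coord K d) (Rat K d)) :=
  IsFractionRing.injective _ _

theorem ratX_ne_zero (a : Fin (d + 1)) : ratX K a ≠ 0 := by
  rw [ratX, Ne, map_eq_zero_iff _ algebraMap_coord_injective]
  exact MvPolynomial.X_ne_zero a

variable (K) in
/-- The Laurent monomial with exponent vector `m`. -/
def mon (m : Fin (d + 1) → ℤ) : Rat K d := ∏ a, ratX K a ^ m a

theorem mon_add (m m' : Fin (d + 1) → ℤ) : mon K (m + m') = mon K m * mon K m' := by
  simp only [mon, Pi.add_apply, ← Finset.prod_mul_distrib]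
  exact Finset.prod_congr rfl fun a _ => zpow_add₀ (ratX_ne_zero a) _ _

theorem mon_zero : mon K (0 : Fin (d + 1) → ℤ) = 1 := by simp [mon]

theorem mon_ne_zero (m : Fin (d + 1) → ℤ) : mon K m ≠ 0 :=
  Finset.prod_ne_zero_iff.mpr fun a _ => zpow_ne_zero _ (ratX_ne_zero a)

theorem mon_single (a : Fin (d + 1)) : mon K (Pi.single a 1) = ratX K a := by
  rw [mon, Finset.prod_eq_single a]
  · simp
  · intro b _ h; simp [Pi.single_eq_of_ne h]
  · simp

theorem mon_add_single (m : Fin (d + 1) → ℤ) (a : Fin (d + 1)) :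
    ratX K a * mon K m = mon K (m + Pi.single a 1) := by
  rw [mon_add, mon_single, mul_comm]

theorem algebraMap_monomial (e : Fin (d + 1) →₀ ℕ) (c : K) :
    algebraMap (Coord K d) (Rat K d) (MvPolynomial.monomial e c) =
      c • mon K (fun a => (e a : ℤ)) := by
  rw [MvPolynomial.monomial_eq, Finsupp.prod_fintype _ _ (by simp), ← MvPolynomial.smul_eq_C_mul,
    ← IsScalarTower.coe_toAlgHom' K, map_smul, IsScalarTower.coe_toAlgHom', map_prod]
  simp [mon, ratX]

/-- Multiplying a relation by a large power of `X_0 ⋯ X_d` turns it into a relation between distinct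
monomials of the polynomial ring. -/
theorem mon_linearIndependent : LinearIndependent K (mon K : (Fin (d + 1) → ℤ) → Rat K d) := by
  rw [linearIndependent_iff']
  intro s g hg m₀ hm₀
  obtain ⟨N, hN⟩ : ∃ N : ℕ, ∀ m ∈ s, ∀ a, 0 ≤ m a + N := by
    refine ⟨∑ m ∈ s, ∑ a, (m a).natAbs, fun m hm a => ?_⟩
    have h1 : (m a).natAbs ≤ ∑ a, (m a).natAbs :=
      Finset.single_le_sum (f := fun a => (m a).natAbs) (fun _ _ => Nat.zero_le _)
        (Finset.mem_univ a)
    have h2 : ∑ a, (m a).natAbs ≤ ∑ m ∈ s, ∑ a, (m a).natAbs :=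
      Finset.single_le_sum (f := fun m : Fin (d + 1) → ℤ => ∑ a, (m a).natAbs)
        (fun _ _ => Nat.zero_le _) hm
    omega
  let ex : (Fin (d + 1) → ℤ) → (Fin (d + 1) →₀ ℕ) := fun m =>
    Finsupp.equivFunOnFinite.symm fun a => (m a + N).toNat
  have hex : ∀ m ∈ s, mon K m * mon K (fun _ => (N : ℤ)) = mon K (fun a => (ex m a : ℤ)) := by
    intro m hm
    rw [← mon_add]
    congr 1
    funext a
    simp [ex, Int.toNat_of_nonneg (hN m hm a)]
  have h1 : algebraMap (Coord K d) (Rat K d) (∑ m ∈ s, MvPolynomial.monomial (ex m) (g m)) = 0 := by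
    rw [map_sum]
    simp only [algebraMap_monomial]
    rw [Finset.sum_congr rfl fun m hm => by rw [← hex m hm, ← smul_mul_assoc],
      ← Finset.sum_mul, hg, zero_mul]
  rw [map_eq_zero_iff _ algebraMap_coord_injective] at h1
  have h2 := congrArg (MvPolynomial.coeff (ex m₀)) h1
  rw [MvPolynomial.coeff_sum, Finset.sum_eq_single m₀] at h2
  · simpa using h2
  · intro m hm hne
    rw [MvPolynomial.coeff_monomial, if_neg]
    intro h
    apply hne
    funext a
    have := DFunLike.congr_fun h a
    simp only [ex, Finsupp.equivFunOnFinite_symm_apply_apply] at this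
    have e1 := hN m hm a
    have e2 := hN m₀ hm₀ a
    omega
  · exact fun h => absurd hm₀ h

-- Any linear left inverse of the monomial expansion will do. Its values away from Laurent
-- polynomials are arbitrary and play no role.
variable (K) in
theorem exists_coeffs : ∃ f : Rat K d →ₗ[K] ((Fin (d + 1) → ℤ) →₀ K),
    ∀ m, f (mon K m) = Finsupp.single m 1 := by
  obtain ⟨f, hf⟩ := LinearMap.exists_leftInverse_of_injective
    (Finsupp.linearCombination K (mon K : (Fin (d + 1) → ℤ) → Rat K d))
    (LinearMap.ker_eq_bot.mpr mon_linearIndependent)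
  refine ⟨f, fun m => ?_⟩
  have := LinearMap.congr_fun hf (Finsupp.single m 1)
  simpa using this

variable (K d) in
/-- A linear extension to `K(X_0, …, X_d)` of the coefficients of Laurent polynomials. -/
def coeffs : Rat K d →ₗ[K] ((Fin (d + 1) → ℤ) →₀ K) := (exists_coeffs K).choose

theorem coeffs_mon (m : Fin (d + 1) → ℤ) : coeffs K d (mon K m) = Finsupp.single m 1 :=
  (exists_coeffs K).choose_spec m

open Classical in
variable (K) in
/-- The projection of Laurent polynomials to those with exponents in `S`. -/
def proj (S : Set (Fin (d + 1) → ℤ)) : Module.End K (Rat K d) :=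
  (Finsupp.linearCombination K fun m => if m ∈ S then mon K m else 0) ∘ₗ coeffs K d

open Classical in
theorem proj_mon (S : Set (Fin (d + 1) → ℤ)) (m : Fin (d + 1) → ℤ) :
    proj K S (mon K m) = if m ∈ S then mon K m else 0 := by
  simp [proj, coeffs_mon]

variable (K) in
/-- The Laurent polynomials with exponents in `S`. -/
def monSpan (S : Set (Fin (d + 1) → ℤ)) : Submodule K (Rat K d) := Submodule.span K (mon K '' S)

theorem mon_mem {S : Set (Fin (d + 1) → ℤ)} {m : Fin (d + 1) → ℤ} (h : m ∈ S) :
    mon K m ∈ monSpan K S := Submodule.subset_span ⟨m, h, rfl⟩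

theorem monSpan_mono {S T : Set (Fin (d + 1) → ℤ)} (h : S ⊆ T) : monSpan K S ≤ monSpan K T :=
  Submodule.span_mono (Set.image_mono h)

/-- A linear map is determined on `monSpan` by monomials. -/
theorem map_mem_of_mon {M : Type*} [AddCommGroup M] [Module K M] (f : Rat K d →ₗ[K] M)
    (T : Submodule K M) {S : Set (Fin (d + 1) → ℤ)} (h : ∀ m ∈ S, f (mon K m) ∈ T) {q : Rat K d}
    (hq : q ∈ monSpan K S) : f q ∈ T := by
  have : monSpan K S ≤ T.comap f := Submodule.span_le.mpr (by
    rintro _ ⟨m, hm, rfl⟩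
    exact h m hm)
  exact this hq

theorem proj_mem {A S T : Set (Fin (d + 1) → ℤ)} (h : A ∩ S ⊆ T) {q : Rat K d}
    (hq : q ∈ monSpan K A) : proj K S q ∈ monSpan K T := by
  classical
  refine map_mem_of_mon _ _ (fun m hm => ?_) hq
  rw [proj_mon]
  split_ifs with hS
  · exact mon_mem (h ⟨hm, hS⟩)
  · exact Submodule.zero_mem _

theorem sub_proj_mem {A S T : Set (Fin (d + 1) → ℤ)} (h : A \ S ⊆ T) {q : Rat K d}
    (hq : q ∈ monSpan K A) : q - proj K S q ∈ monSpan K T := by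
  classical
  refine map_mem_of_mon (LinearMap.id - proj K S) _ (fun m hm => ?_) hq
  rw [LinearMap.sub_apply, LinearMap.id_apply, proj_mon]
  split_ifs with hS
  · rw [sub_self]; exact Submodule.zero_mem _
  · rw [sub_zero]; exact mon_mem (h ⟨hm, hS⟩)

theorem proj_eq_self {S : Set (Fin (d + 1) → ℤ)} {q : Rat K d} (hq : q ∈ monSpan K S) :
    proj K S q = q := by
  have h := sub_proj_mem (T := ∅) (S := S) (by simp) hq
  rw [monSpan, Set.image_empty, Submodule.span_empty, Submodule.mem_bot, sub_eq_zero] at h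
  exact h.symm

theorem mem_monSpan_inter {S T : Set (Fin (d + 1) → ℤ)} {q : Rat K d} (hS : q ∈ monSpan K S)
    (hT : q ∈ monSpan K T) : q ∈ monSpan K (S ∩ T) := by
  rw [← proj_eq_self hT]
  exact proj_mem subset_rfl hS

theorem eq_zero_of_mem_monSpan {S T : Set (Fin (d + 1) → ℤ)} (h : ∀ m ∈ S, m ∉ T) {q : Rat K d}
    (hS : q ∈ monSpan K S) (hT : q ∈ monSpan K T) : q = 0 := by
  have := mem_monSpan_inter hS hT
  rwa [show S ∩ T = ∅ from Set.eq_empty_iff_forall_notMem.mpr fun m hm => h m hm.1 hm.2, monSpan,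
    Set.image_empty, Submodule.span_empty, Submodule.mem_bot] at this

/-! ### Sections over intersections of coordinate open sets -/

variable (K) in
/-- The coordinate `X_a` as a linear form. -/
def coordForm (a : Fin (d + 1)) : LinForm K d :=
  ⟨Pi.single a 1, fun h => one_ne_zero (α := K) (by simpa using congrFun h a)⟩

theorem lin_coordForm (a : Fin (d + 1)) : lin (coordForm K a).1 = MvPolynomial.X a := by
  rw [lin, Finset.sum_eq_single a]
  · simp [coordForm]
  · intro b _ h; simp [coordForm, Pi.single_eq_of_ne h]
  · simp

theorem algebraMap_prod_coordForm {p : ℕ} (J : Fin (p + 1) → Fin (d + 1)) (N : ℕ) :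
    algebraMap (Coord K d) (Rat K d) (∏ j, lin (coordForm K (J j)).1) ^ N =
      mon K (∑ j, (N : ℤ) • Pi.single (J j) 1) := by
  have : ∀ s : Finset (Fin (p + 1)), algebraMap (Coord K d) (Rat K d)
      (∏ j ∈ s, lin (coordForm K (J j)).1) ^ N = mon K (∑ j ∈ s, (N : ℤ) • Pi.single (J j) 1) := by
    classical
    intro s
    induction s using Finset.induction_on with
    | empty => simp [mon_zero]
    | insert j s hj ih =>
      rw [Finset.prod_insert hj, Finset.sum_insert hj, mon_add, map_mul, mul_pow, ih]
      congr 1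
      clear ih hj
      rw [lin_coordForm]
      change ratX K (J j) ^ N = _
      induction N with
      | zero => simp [mon_zero]
      | succ N ih => rw [pow_succ, ih, ← mon_single, ← mon_add]; congr 1; push_cast; module
  exact this _

theorem sum_exponent_apply {p : ℕ} (J : Fin (p + 1) → Fin (d + 1)) (N : ℕ) (a : Fin (d + 1)) :
    (a ∉ Set.range J → (∑ j, (N : ℤ) • (Pi.single (J j) 1 : Fin (d + 1) → ℤ)) a = 0) ∧
    (a ∈ Set.range J → (N : ℤ) ≤ (∑ j, (N : ℤ) • (Pi.single (J j) 1 : Fin (d + 1) → ℤ)) a) ∧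
    0 ≤ (∑ j, (N : ℤ) • (Pi.single (J j) 1 : Fin (d + 1) → ℤ)) a := by
  have nn : ∀ j ∈ (Finset.univ : Finset (Fin (p + 1))),
      0 ≤ ((N : ℤ) • (Pi.single (J j) 1 : Fin (d + 1) → ℤ)) a := by
    intro j _
    simp only [Pi.smul_apply, Pi.single_apply, smul_eq_mul]
    split_ifs <;> simp
  rw [Finset.sum_apply]
  refine ⟨fun h => ?_, ?_, Finset.sum_nonneg nn⟩
  · refine Finset.sum_eq_zero fun j _ => ?_
    have : a ≠ J j := fun e => h ⟨j, e.symm⟩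
    simp [this]
  · rintro ⟨j, rfl⟩
    refine le_trans ?_ (Finset.single_le_sum nn (Finset.mem_univ j))
    simp

theorem sum_exponent {p : ℕ} (J : Fin (p + 1) → Fin (d + 1)) (N : ℕ) :
    ∑ a, (∑ j, (N : ℤ) • (Pi.single (J j) 1 : Fin (d + 1) → ℤ)) a = N * (p + 1) := by
  simp only [Finset.sum_apply, Pi.smul_apply, smul_eq_mul]
  rw [Finset.sum_comm]
  simp [← Finset.mul_sum, mul_comm]

variable (d) in
/-- The exponents of degree `n` which are nonnegative outside of the set `J`. -/
def poleSet (n : ℤ) (J : Set (Fin (d + 1))) : Set (Fin (d + 1) → ℤ) :=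
  {m | ∑ a, m a = n ∧ ∀ a ∉ J, 0 ≤ m a}

/-- The denominator is itself a monomial in the `X_a` with `a` in the range of `J`, so dividing by
it only shifts the exponents at those indices. -/
theorem mem_sections_coord {n : ℤ} {p : ℕ} (J : Fin (p + 1) → Fin (d + 1)) {q : Rat K d} :
    q ∈ sections n (fun j => coordForm K (J j)) ↔ q ∈ monSpan K (poleSet d n (Set.range J)) := by
  constructor
  · rintro ⟨N, m, h, hh, hm, hq⟩
    rw [algebraMap_prod_coordForm] at hq
    set e := ∑ j, (N : ℤ) • (Pi.single (J j) 1 : Fin (d + 1) → ℤ) with he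
    have hq' : q = algebraMap _ _ h * mon K (-e) := by
      rw [← hq, mul_assoc, ← mon_add, add_neg_cancel, mon_zero, mul_one]
    rw [hq', h.as_sum, map_sum, Finset.sum_mul]
    refine Submodule.sum_mem _ fun c hc => ?_
    rw [algebraMap_monomial, smul_mul_assoc, ← mon_add]
    refine Submodule.smul_mem _ _ (mon_mem ⟨?_, fun a ha => ?_⟩)
    · have h1 := hh (MvPolynomial.mem_support_iff.mp hc)
      rw [Finsupp.weight_apply, Finsupp.sum_fintype _ _ (by simp)] at h1
      simp only [Pi.one_apply, smul_eq_mul, mul_one] at h1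
      simp only [Pi.add_apply, Pi.neg_apply, Finset.sum_add_distrib, Finset.sum_neg_distrib]
      rw [he, sum_exponent, ← Nat.cast_sum, h1, hm]
      ring
    · have h0 := (sum_exponent_apply J N a).1 ha
      rw [Pi.add_apply, Pi.neg_apply, he, h0, neg_zero, add_zero]
      exact Int.natCast_nonneg _
  · intro hq
    refine Submodule.span_le.mpr ?_ hq
    rintro _ ⟨m, ⟨hm, hJ⟩, rfl⟩
    -- Any bound for all `|m a|` would do: it makes every exponent of `m + e` nonnegative.
    set N := ∑ a, (m a).natAbs with hN
    set e := ∑ j, (N : ℤ) • (Pi.single (J j) 1 : Fin (d + 1) → ℤ) with he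
    have nn : ∀ a, 0 ≤ (m + e) a := by
      intro a
      by_cases ha : a ∈ Set.range J
      · have h1 := (sum_exponent_apply J N a).2.1 ha
        have h2 : (m a).natAbs ≤ ∑ a, (m a).natAbs :=
          Finset.single_le_sum (f := fun a => (m a).natAbs) (fun _ _ => Nat.zero_le _)
            (Finset.mem_univ a)
        rw [← he] at h1
        rw [Pi.add_apply]
        omega
      · exact add_nonneg (hJ a ha) (sum_exponent_apply J N a).2.2
    refine ⟨N, ∑ a, ((m + e) a).toNat, MvPolynomial.monomial
      (Finsupp.equivFunOnFinite.symm fun a => ((m + e) a).toNat) 1, ?_, ?_, ?_⟩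
    · apply MvPolynomial.isHomogeneous_monomial
      rw [Finsupp.degree_eq_sum]
      simp
    · push_cast
      rw [Finset.sum_congr rfl fun a _ => Int.toNat_of_nonneg (nn a)]
      simp only [Pi.add_apply, Finset.sum_add_distrib]
      rw [hm, he, sum_exponent]
    · rw [algebraMap_prod_coordForm, ← mon_add, algebraMap_monomial, one_smul]
      congr 1
      funext a
      simp only [Finsupp.equivFunOnFinite_symm_apply_apply]
      exact (Int.toNat_of_nonneg (nn a)).symm

/-! ### Differential operators -/

/-- A derivation applied to a Laurent monomial. -/
theorem derivation_mon (D : Derivation K (Rat K d) (Rat K d)) (m : Fin (d + 1) → ℤ) :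
    D (mon K m) = mon K m * ∑ a, (m a : Rat K d) * ((ratX K a)⁻¹ * D (ratX K a)) := by
  classical
  have : ∀ s : Finset (Fin (d + 1)), D (∏ a ∈ s, ratX K a ^ m a) =
      (∏ a ∈ s, ratX K a ^ m a) * ∑ a ∈ s, (m a : Rat K d) * ((ratX K a)⁻¹ * D (ratX K a)) := by
    intro s
    induction s using Finset.induction_on with
    | empty => simp
    | insert a s ha ih =>
      rw [Finset.prod_insert ha, Finset.sum_insert ha, D.leibniz, ih, D.leibniz_zpow,
        zpow_sub_one₀ (ratX_ne_zero a), zsmul_eq_mul]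
      simp only [smul_eq_mul]
      ring
  exact this _

variable (K) in
/-- The partial derivative `∂/∂X_a` on rational functions. -/
def ratPderiv (a : Fin (d + 1)) : Derivation K (Rat K d) (Rat K d) :=
  extendDerivation (MvPolynomial.pderiv a)

theorem ratPderiv_algebraMap (a : Fin (d + 1)) (h : Coord K d) :
    ratPderiv K a (algebraMap _ _ h) = algebraMap _ _ (MvPolynomial.pderiv a h) :=
  extendDerivation_algebraMap _ _

theorem ratPderiv_ratX (a b : Fin (d + 1)) : ratPderiv K a (ratX K b) = if b = a then 1 else 0 := by
  rw [ratX, ratPderiv_algebraMap, MvPolynomial.pderiv_X, Pi.single_apply]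
  split_ifs <;> simp

theorem ratPderiv_mon (a : Fin (d + 1)) (m : Fin (d + 1) → ℤ) :
    ratPderiv K a (mon K m) = (m a : K) • mon K (m - Pi.single a 1) := by
  rw [derivation_mon, Finset.sum_eq_single a]
  · rw [ratPderiv_ratX, if_pos rfl, mul_one]
    have : mon K m = ratX K a * mon K (m - Pi.single a 1) := by
      rw [mon_add_single, sub_add_cancel]
    rw [this, Algebra.smul_def, map_intCast]
    field_simp [ratX_ne_zero (K := K) a]
  · intro b _ h
    rw [ratPderiv_ratX, if_neg h, mul_zero, mul_zero]
  · simp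

theorem derivation_sum_apply {ι : Type*} (s : Finset ι) (D : ι → Derivation K (Rat K d) (Rat K d))
    (q : Rat K d) : (∑ b ∈ s, D b) q = ∑ b ∈ s, D b q := by
  classical
  induction s using Finset.induction_on with
  | empty => simp
  | insert a s ha ih => rw [Finset.sum_insert ha, Finset.sum_insert ha, Derivation.add_apply, ih]

/-- A derivation of `K(X_0, …, X_d)` in terms of partial derivatives. -/
theorem derivation_apply_eq (D : Derivation K (Rat K d) (Rat K d)) (q : Rat K d) :
    D q = ∑ b, D (ratX K b) * ratPderiv K b q := by
  have : D = ∑ b, D (ratX K b) • ratPderiv K b := by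
    apply ratDerivation_ext
    intro c
    change D (ratX K c) = (∑ b, D (ratX K b) • ratPderiv K b) (ratX K c)
    rw [derivation_sum_apply, Finset.sum_eq_single c]
    · simp [ratPderiv_ratX]
    · intro b _ h
      simp [ratPderiv_ratX, Ne.symm h]
    · simp
  conv_lhs => rw [this, derivation_sum_apply]
  rfl

theorem algebraMap_lin (v : Fin (d + 1) → K) :
    algebraMap (Coord K d) (Rat K d) (lin v) = ∑ a, v a • ratX K a := by
  rw [lin, map_sum]
  refine Finset.sum_congr rfl fun a _ => ?_
  rw [← MvPolynomial.smul_eq_C_mul, ← IsScalarTower.coe_toAlgHom' K, map_smul]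
  rfl

theorem twistedLie_apply (s : ℤ) (x : Gl K d) (q : Rat K d) :
    twistedLie s x q = ∑ b, (∑ a, x a b • ratX K a) * ratPderiv K b q +
      ((s : K) * x.trace) • q := by
  change vectorField x q + _ = _
  rw [derivation_apply_eq]
  congr 1
  refine Finset.sum_congr rfl fun b _ => ?_
  rw [ratX, vectorField_X, algebraMap_lin]

/-- Here `E_{ab}` is the operator `X_a ∂/∂X_b`, plus `s` on the diagonal. The factor `m b` governs
everything later: which monomials are killed, and which can be reached. -/
theorem twistedLie_single_mon (s : ℤ) (a b : Fin (d + 1)) (m : Fin (d + 1) → ℤ) :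
    twistedLie s (Matrix.single a b (1 : K) : Gl K d) (mon K m) =
      (m b : K) • mon K (m + Pi.single a 1 - Pi.single b 1) +
        (if a = b then (s : K) else 0) • mon K m := by
  rw [twistedLie_apply]
  congr 1
  · rw [Finset.sum_eq_single b, Finset.sum_eq_single a]
    · rw [Matrix.single_apply_same, one_smul, ratPderiv_mon, mul_smul_comm, mon_add_single]
      congr 2
      abel
    · intro c _ h
      simp [Ne.symm h]
    · simp
    · intro c _ h
      rw [Finset.sum_eq_zero, zero_mul]
      intro e _
      simp [Ne.symm h]
    · simp
  · split_ifs with h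
    · subst h; simp
    · rw [Matrix.trace_single_eq_of_ne a b 1 h, mul_zero]

end Laurent

/-! ### The Čech complex -/

section Cech

variable {K : Type*} [Field K] {d : ℕ}

theorem cons_comp_succAbove_succ {α : Type*} {p : ℕ} (x : α) (t : Fin (p + 1) → α)
    (j : Fin (p + 1)) :
    (Fin.cons x t : Fin (p + 2) → α) ∘ j.succ.succAbove = Fin.cons x (t ∘ j.succAbove) :=
  Fin.cons_comp_succ_succAbove x t j

theorem cons_comp_succAbove_zero {α : Type*} {p : ℕ} (x : α) (t : Fin p → α) :
    (Fin.cons x t : Fin (p + 1) → α) ∘ (0 : Fin (p + 1)).succAbove = t := by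
  funext j
  simp

theorem differential_apply (p : ℕ) (c : Family K d p) (t : Fin (p + 2) → LinForm K d) :
    differential K d p c t = ∑ j : Fin (p + 2), (-1 : ℤ) ^ (j : ℕ) • c (t ∘ j.succAbove) := rfl

theorem sum_cons_succAbove {A : Type*} [AddCommGroup A] {α : Type*} {p : ℕ}
    (c : (Fin (p + 1) → α) → A) (x : α) (t : Fin (p + 1) → α) :
    ∑ j : Fin (p + 2), (-1 : ℤ) ^ (j : ℕ) • c ((Fin.cons x t : Fin (p + 2) → α) ∘ j.succAbove) =
      c t - ∑ j : Fin (p + 1), (-1 : ℤ) ^ (j : ℕ) • c (Fin.cons x (t ∘ j.succAbove)) := by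
  rw [Fin.sum_univ_succ, cons_comp_succAbove_zero]
  simp only [cons_comp_succAbove_succ, Fin.val_zero, pow_zero, one_smul, Fin.val_succ, pow_succ,
    mul_neg, mul_one, neg_smul, Finset.sum_neg_distrib]
  rw [sub_eq_add_neg]

theorem differential_cons (p : ℕ) (c : Family K d (p + 1)) (x : LinForm K d)
    (t : Fin (p + 2) → LinForm K d) :
    differential K d (p + 1) c (Fin.cons x t) =
      c t - differential K d p (fun s => c (Fin.cons x s)) t :=
  sum_cons_succAbove c x t

theorem tuple_zero_ext {α : Type*} {t t' : Fin (0 + 1) → α} (h : t 0 = t' 0) : t = t' := by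
  funext j
  have : j = 0 := Subsingleton.elim (α := Fin 1) j 0
  rw [this, h]

/-- Prepending a form gives the recursion `(∂c)(x, t) = c(t) - (∂ c(x, ·))(t)` of
`differential_cons`, so the identity in one degree follows from the one below. Degree `0` is
computed directly. -/
theorem differential_differential (p : ℕ) (c : Family K d p) :
    differential K d (p + 1) (differential K d p c) = 0 := by
  have split : ∀ {m : ℕ} (t : Fin (m + 1) → LinForm K d), ∃ x t', t = Fin.cons x t' :=
    fun t => ⟨t 0, Fin.tail t, (Fin.cons_self_tail t).symm⟩
  induction p with
  | zero =>
    funext t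
    obtain ⟨x, t, rfl⟩ := split t
    rw [differential_cons]
    have : (fun s : Fin 1 → LinForm K d => differential K d 0 c (Fin.cons x s)) =
        fun s => c s - c (fun _ => x) := by
      funext s
      rw [differential_apply, sum_cons_succAbove]
      have e : (Fin.cons x (s ∘ Fin.succ) : Fin (0 + 1) → LinForm K d) = fun _ => x :=
        tuple_zero_ext rfl
      simp [e]
    rw [this, differential_apply, differential_apply]
    simp [Fin.sum_univ_succ]
  | succ p ih =>
    funext t
    obtain ⟨x, t, rfl⟩ := split t
    rw [differential_cons]
    have : (fun s => differential K d (p + 1) c (Fin.cons x s)) =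
        c - differential K d p (fun s => c (Fin.cons x s)) := by
      funext s
      rw [differential_cons]
      rfl
    rw [this, map_sub, ih, sub_zero, sub_self]
    rfl

theorem sections_face {n : ℤ} {p : ℕ} (t : Fin (p + 2) → LinForm K d) (j : Fin (p + 2))
    {q : Rat K d} (hq : q ∈ sections n (t ∘ j.succAbove)) : q ∈ sections n t := by
  obtain ⟨N, m, h, hh, hm, hq⟩ := hq
  refine ⟨N, m + N, h * lin (t j).1 ^ N, ?_, by push_cast; rw [hm]; ring, ?_⟩
  · have := hh.mul ((lin_isHomogeneous (t j).1).pow N)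
    rwa [one_mul] at this
  · rw [Fin.prod_univ_succAbove _ j, map_mul, mul_pow, map_mul, ← hq, map_pow, mul_left_comm,
      mul_comm]
    rfl

theorem differential_mem {n : ℤ} {W : Set (LinForm K d)} {p : ℕ} {c : Family K d p}
    (hc : c ∈ cochains n W p) : differential K d p c ∈ cochains n W (p + 1) := by
  refine ⟨fun t => ?_, fun t ht => ?_⟩
  · rw [differential_apply]
    refine Submodule.sum_mem _ fun j _ => ?_
    exact Submodule.smul_of_tower_mem _ _ (sections_face t j (hc.1 _))
  · rw [differential_apply]
    refine Finset.sum_eq_zero fun j _ => ?_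
    rw [hc.2 (t ∘ j.succAbove) fun l => ht _]
    exact zsmul_zero _

/-! ### Reduction of `H̃` to cocycles on the complement of the support -/

variable (K d) in
/-- The `p`-cochains on `ℙ^d` which restrict to cocycles on `ℙ^d ∖ V(X_0, …, X_p)`. -/
def openCocycles (n : ℤ) (p : ℕ) : Submodule K (Family K d p) :=
  cochains n ∅ p ⊓ (cochains n (firstForms K d (p + 1)) (p + 1)).comap (differential K d p)

theorem mem_openCocycles {n : ℤ} {p : ℕ} {b : Family K d p} :
    b ∈ openCocycles K d n p ↔ (∀ t, b t ∈ sections n t) ∧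
      ∀ t, (∀ j, t j ∈ firstForms K d (p + 1)) → differential K d p b t = 0 := by
  constructor
  · rintro ⟨h1, h2⟩
    exact ⟨h1.1, h2.2⟩
  · rintro ⟨h1, h2⟩
    have hb : b ∈ cochains n ∅ p := ⟨h1, fun t ht => (ht 0).elim⟩
    exact ⟨hb, (differential_mem hb).1, h2⟩

/-- The class in `H̃` of the coboundary of a cocycle on the complement of the support. -/
def theta (n : ℤ) (p : ℕ) : openCocycles K d n p →ₗ[K] HTilde K d n (p + 1) :=
  LinearMap.codRestrict _ (Submodule.mkQ _ ∘ₗ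
    LinearMap.codRestrict (cocycles n (firstForms K d (p + 1)) (p + 1))
      (differential K d p ∘ₗ (openCocycles K d n p).subtype)
      fun b => ⟨b.2.2, differential_differential p b.1⟩) fun b => by
    change forgetSupport n _ (p + 1) (Submodule.Quotient.mk _) = 0
    exact (Submodule.Quotient.mk_eq_zero _).mpr ⟨b.1, b.2.1, rfl⟩

/-- A class that dies in the cohomology of `ℙ^d` is the coboundary of a cochain on all of `ℙ^d`.
This cochain is a cocycle off the support because its coboundary vanishes there. -/
theorem theta_surjective (n : ℤ) (p : ℕ) : Function.Surjective (theta (K := K) (d := d) n p) := by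
  rintro ⟨z, hz⟩
  obtain ⟨c, rfl⟩ := Submodule.Quotient.mk_surjective _ z
  change forgetSupport n _ (p + 1) _ = 0 at hz
  obtain ⟨b, hb, hbc⟩ := (Submodule.Quotient.mk_eq_zero _).mp hz
  change differential K d p b = c.1 at hbc
  refine ⟨⟨b, hb, ?_⟩, ?_⟩
  · change differential K d p b ∈ cochains n (firstForms K d (p + 1)) (p + 1)
    rw [hbc]
    exact c.2.1
  · apply Subtype.ext
    change Submodule.Quotient.mk _ = Submodule.Quotient.mk _
    congr 1
    exact Subtype.ext hbc

theorem theta_eq_zero {n : ℤ} {p : ℕ} (b : openCocycles K d n p) :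
    theta n p b = 0 ↔
      ∃ c ∈ cochains n (firstForms K d (p + 1)) p, differential K d p c = differential K d p b := by
  rw [← Subtype.coe_inj]
  change Submodule.Quotient.mk _ = _ ↔ _
  rw [ZeroMemClass.coe_zero, Submodule.Quotient.mk_eq_zero]
  rfl

/-- Admissible operators preserving the support act on `openCocycles`. -/
theorem familyMap_mem_openCocycles {n : ℤ} {p : ℕ} {A : Module.End K (Rat K d)}
    {σ : LinForm K d → LinForm K d} (h : Admissible n (firstForms K d (p + 1)) A σ)
    {b : Family K d p} (hb : b ∈ openCocycles K d n p) :
    familyMap A σ p b ∈ openCocycles K d n p := by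
  refine ⟨h.empty.cochains_mem hb.1, ?_⟩
  change differential K d p _ ∈ cochains n (firstForms K d (p + 1)) (p + 1)
  rw [differential_familyMap]
  exact h.cochains_mem hb.2

theorem tildeMap_theta {n : ℤ} {p : ℕ} {A : Module.End K (Rat K d)}
    {σ : LinForm K d → LinForm K d} (h : Admissible n (firstForms K d (p + 1)) A σ)
    (b : openCocycles K d n p) :
    h.tildeMap (theta n p b) = theta n p ⟨familyMap A σ p b, familyMap_mem_openCocycles h b.2⟩ := by
  apply Subtype.ext
  change Submodule.Quotient.mk _ = Submodule.Quotient.mk _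
  congr 1
  exact Subtype.ext (differential_familyMap A σ p b.1).symm

/-! ### The kernel of `theta` -/

variable (K) in
/-- The tuple of coordinates `X_{J 0}, …, X_{J m}`. -/
def coordTuple {m p : ℕ} (hp : p ≤ d) (J : Fin m → Fin (p + 1)) : Fin m → LinForm K d :=
  fun j => coordForm K (Fin.castLE (by omega) (J j))

variable (K) in
/-- The tuple `X_0, …, X_p`. -/
def stdTuple {p : ℕ} (hp : p ≤ d) : Fin (p + 1) → LinForm K d := coordTuple K hp id

variable (d) in
/-- The exponents which are nonnegative at one of the indices `0, …, p`. -/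
def regularSet (p : ℕ) : Set (Fin (d + 1) → ℤ) := {m | ∃ a : Fin (d + 1), (a : ℕ) ≤ p ∧ 0 ≤ m a}

theorem mem_sections_coordTuple {n : ℤ} {m p : ℕ} (hp : p ≤ d) (J : Fin (m + 1) → Fin (p + 1))
    {q : Rat K d} : q ∈ sections n (coordTuple K hp J) ↔
      q ∈ monSpan K (poleSet d n (Set.range fun j =>
        Fin.castLE (by omega : p + 1 ≤ d + 1) (J j))) :=
  mem_sections_coord _

theorem coordTuple_mem_firstForms {m p : ℕ} (hp : p ≤ d) (J : Fin m → Fin (p + 1)) (j : Fin m) :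
    coordTuple K hp J j ∈ firstForms K d (p + 1) := by
  intro a ha
  change (Pi.single (Fin.castLE _ (J j)) 1 : Fin (d + 1) → K) a = 0
  rw [Pi.single_eq_of_ne]
  rintro rfl
  simp at ha
  omega

theorem sections_le_regular {n : ℤ} {m p : ℕ} (hp : p ≤ d) (J : Fin (m + 1) → Fin (p + 1))
    (l : Fin (p + 1)) (hl : ∀ j, J j ≠ l) {q : Rat K d}
    (hq : q ∈ sections n (coordTuple K hp J)) : q ∈ monSpan K (regularSet d p) := by
  rw [mem_sections_coordTuple] at hq
  refine monSpan_mono ?_ hq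
  rintro m ⟨-, hm⟩
  refine ⟨Fin.castLE (by omega) l, by simp; omega, hm _ ?_⟩
  rintro ⟨j, hj⟩
  exact hl j (Fin.castLE_injective _ hj)

/-- Evaluate the cocycle condition at `(X_0, …, X_{p+1})`, which is where `p + 1 ≤ d` enters. The
last face is `(X_0, …, X_p)`; each other face omits one of `X_0, …, X_p`, so its value has no pole
along that coordinate. -/
theorem cocycle_std_mem {n : ℤ} {p : ℕ} (hp : p + 1 ≤ d) {b : Family K d p}
    (hb : b ∈ cochains n ∅ p) (hd : differential K d p b = 0) :
    b (stdTuple K (by omega : p ≤ d)) ∈ monSpan K (regularSet d p) := by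
  have h := congrFun hd (stdTuple K hp)
  rw [differential_apply, Fin.sum_univ_castSucc, Pi.zero_apply, add_comm] at h
  have e : stdTuple K hp ∘ (Fin.last (p + 1)).succAbove = stdTuple K (by omega : p ≤ d) := by
    funext j
    simp only [Function.comp_apply, Fin.succAbove_last]
    rfl
  rw [e, add_eq_zero_iff_eq_neg] at h
  have h2 : ((-1 : ℤ) ^ ((Fin.last (p + 1) : Fin (p + 2)) : ℕ)) • b (stdTuple K (by omega)) ∈
      monSpan K (regularSet d p) := by
    rw [h]
    refine Submodule.neg_mem _ (Submodule.sum_mem _ fun j _ => ?_)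
    have h3 := hb.1 (stdTuple K hp ∘ j.castSucc.succAbove)
    have h4 : b (stdTuple K hp ∘ j.castSucc.succAbove) ∈ monSpan K (regularSet d p) := by
      have h5 := (mem_sections_coordTuple (K := K) hp (fun l => j.castSucc.succAbove l)).mp h3
      refine monSpan_mono ?_ h5
      rintro m ⟨-, hm⟩
      refine ⟨Fin.castLE (by omega) j, by simp; omega, hm _ ?_⟩
      rintro ⟨l, hl⟩
      refine Fin.succAbove_ne j.castSucc l ?_
      apply Fin.ext
      have := congrArg Fin.val hl
      simpa using this
    exact Submodule.smul_of_tower_mem _ _ h4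
  rcases neg_one_pow_eq_or ℤ ((Fin.last (p + 1) : Fin (p + 2)) : ℕ) with h6 | h6
  · rwa [h6, one_smul] at h2
  · rw [h6, neg_smul, one_smul] at h2
    exact (Submodule.neg_mem_iff _).mp h2

theorem sections_of_poleSet_empty {n : ℤ} {p : ℕ} (t : Fin (p + 1) → LinForm K d) {q : Rat K d}
    (hq : q ∈ monSpan K (poleSet d n ∅)) : q ∈ sections n t := by
  refine Submodule.span_le.mpr ?_ hq
  rintro _ ⟨m, ⟨hm, hJ⟩, rfl⟩
  have nn : ∀ a, 0 ≤ m a := fun a => hJ a (Set.notMem_empty a)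
  refine ⟨0, ∑ a, (m a).toNat, MvPolynomial.monomial
      (Finsupp.equivFunOnFinite.symm fun a => (m a).toNat) 1, ?_, ?_, ?_⟩
  · apply MvPolynomial.isHomogeneous_monomial
    rw [Finsupp.degree_eq_sum]
    simp
  · push_cast
    rw [Finset.sum_congr rfl fun a _ => Int.toNat_of_nonneg (nn a), hm]
    simp
  · rw [pow_zero, mul_one, algebraMap_monomial, one_smul]
    congr 1
    funext a
    simp only [Finsupp.equivFunOnFinite_symm_apply_apply]
    exact (Int.toNat_of_nonneg (nn a)).symm

/-- The kernel of `theta` for a hyperplane. -/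
theorem exists_cochain_zero {n : ℤ} {b : Family K d 0} (hb : b ∈ openCocycles K d n 0)
    (hstd : b (stdTuple K (Nat.zero_le d)) ∈ monSpan K (regularSet d 0)) :
    ∃ c ∈ cochains n (firstForms K d 1) 0, differential K d 0 c = differential K d 0 b := by
  rw [mem_openCocycles] at hb
  set q := b (stdTuple K (Nat.zero_le d)) with hq
  -- The only possible pole is along `X_0`, and regularity excludes it, so `q` is a polynomial and
  -- hence a global section.
  have hq0 : q ∈ monSpan K (poleSet d n ∅) := by
    have h1 := (mem_sections_coordTuple (K := K) (Nat.zero_le d) id).mp (hb.1 (stdTuple K _))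
    refine monSpan_mono ?_ (mem_monSpan_inter h1 hstd)
    rintro m ⟨⟨h2, h3⟩, a, ha, ha'⟩
    refine ⟨h2, fun a' _ => ?_⟩
    by_cases h : (a' : ℕ) = 0
    · have : a' = a := Fin.ext (by omega)
      rwa [this]
    · refine h3 _ ?_
      rintro ⟨j, rfl⟩
      apply h
      simp
  -- There are no cochains in degree `-1`, so the correction is by the global section `q`. The
  -- cocycle condition at `(X_0, ℓ)` shows `b(ℓ) = q` off the support.
  refine ⟨fun t => b t - q,
    ⟨fun t => Submodule.sub_mem _ (hb.1 t) (sections_of_poleSet_empty t hq0),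
    fun t ht => ?_⟩, ?_⟩
  · have h := hb.2 (Fin.cons (coordForm K 0) t) (by
      intro j
      refine Fin.cases ?_ (fun j => ?_) j
      · exact coordTuple_mem_firstForms (Nat.zero_le d) id 0
      · exact ht j)
    rw [differential_apply, sum_cons_succAbove] at h
    have e : (Fin.cons (coordForm K 0) (t ∘ Fin.succ) : Fin (0 + 1) → LinForm K d) =
        stdTuple K (Nat.zero_le d) := tuple_zero_ext rfl
    simpa [e, ← hq] using h
  · funext t
    rw [differential_apply, differential_apply]
    simp only [Fin.sum_univ_succ]
    simp
    abel

end Cech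

/-! ### Cochains on coordinate tuples -/

section CoordTuples

/-- An unordered cocycle vanishing on tuples with repetitions and on the identity is zero. -/
theorem eq_zero_of_cocycle {A : Type*} [AddCommGroup A] {m : ℕ}
    (β : (Fin (m + 1) → Fin (m + 1)) → A)
    (hd : ∀ J : Fin (m + 2) → Fin (m + 1),
      ∑ l : Fin (m + 2), (-1 : ℤ) ^ (l : ℕ) • β (J ∘ l.succAbove) = 0)
    (hr : ∀ J, ¬ Function.Injective J → β J = 0) (h1 : β id = 0) : β = 0 := by
  have swap : ∀ (J : Fin (m + 1) → Fin (m + 1)) (k : Fin m), β J = 0 →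
      β (J ∘ Equiv.swap k.castSucc k.succ) = 0 := by
    intro J k hJ
    let Jn : ℕ → Fin (m + 1) := fun x => if h : x < m + 1 then J ⟨x, h⟩ else 0
    have hJn : ∀ a : Fin (m + 1), J a = Jn a := fun a => by
      simp only [Jn]
      rw [dif_pos a.isLt]
    -- The tuple `(J_0, …, J_k, J_{k+1}, J_k, J_{k+2}, …)`: omitting position `k + 2` gives `J`, and
    -- omitting position `k` gives `J` with entries `k` and `k + 1` exchanged.
    let s : Fin (m + 2) → Fin (m + 1) := fun a =>
      Jn (if (a : ℕ) = k + 2 then k else if (a : ℕ) ≤ k + 1 then a else a - 1)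
    have val : ∀ (l : Fin (m + 2)) (a : Fin (m + 1)),
        (l.succAbove a : ℕ) = if (a : ℕ) < l then (a : ℕ) else a + 1 := by
      intro l a
      simp only [Fin.succAbove, Fin.lt_def, Fin.val_castSucc]
      split_ifs <;> simp
    have e1 : s ∘ k.succ.succ.succAbove = J := by
      funext a
      rw [hJn]
      simp only [s, Function.comp_apply, val, Fin.val_succ]
      congr 1
      split_ifs <;> omega
    have e2 : s ∘ k.castSucc.castSucc.succAbove = J ∘ Equiv.swap k.castSucc k.succ := by
      funext a
      have hs : (Equiv.swap k.castSucc k.succ a : ℕ) =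
          if (a : ℕ) = k then (k : ℕ) + 1 else if (a : ℕ) = k + 1 then (k : ℕ) else a := by
        rw [Equiv.swap_apply_def]
        simp only [Fin.ext_iff, Fin.val_castSucc, Fin.val_succ]
        split_ifs <;> simp
      rw [Function.comp_apply, Function.comp_apply, hJn, hs]
      simp only [s, val, Fin.val_castSucc]
      congr 1
      split_ifs <;> omega
    have h := hd s
    have hne : k.castSucc.castSucc ≠ k.succ.succ := by
      intro h
      have := congrArg Fin.val h
      simp only [Fin.val_castSucc, Fin.val_succ] at this
      omega
    rw [Fintype.sum_eq_add k.castSucc.castSucc k.succ.succ hne, e1, e2, hJ, zsmul_zero,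
      add_zero] at h
    · rcases neg_one_pow_eq_or ℤ ((k.castSucc.castSucc : Fin (m + 2)) : ℕ) with h6 | h6
      · rwa [h6, one_smul] at h
      · rw [h6, neg_smul, one_smul] at h
        exact neg_eq_zero.mp h
    -- Every other face keeps both copies of `J_k`, so it has a repetition.
    · rintro l ⟨hl1, hl2⟩
      rw [hr, zsmul_zero]
      intro hinj
      obtain ⟨u, hu⟩ := Fin.exists_succAbove_eq (Ne.symm hl1)
      obtain ⟨v, hv⟩ := Fin.exists_succAbove_eq (Ne.symm hl2)
      have huv : u = v := by
        apply hinj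
        simp [Function.comp_apply, hu, hv, s]
      rw [← hu, ← hv, huv] at hne
      exact hne rfl
  have perm : ∀ π : Equiv.Perm (Fin (m + 1)), β π = 0 := by
    intro π
    have hπ : π ∈ Submonoid.closure
        (Set.range fun i : Fin m => Equiv.swap i.castSucc i.succ) := by
      rw [Equiv.Perm.mclosure_swap_castSucc_succ]
      trivial
    induction hπ using Submonoid.closure_induction_right with
    | one => exact h1
    | mul_right x _ y hy ih =>
      obtain ⟨k, rfl⟩ := hy
      exact swap x k ih
  funext J
  by_cases hJ : Function.Injective J
  · exact perm (Equiv.ofBijective J (Finite.injective_iff_bijective.mp hJ))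
  · exact hr J hJ

variable {K : Type*} [Field K] {d : ℕ}

theorem coordTuple_comp {m m' p : ℕ} (hp : p ≤ d) (J : Fin m → Fin (p + 1)) (f : Fin m' → Fin m) :
    coordTuple K hp J ∘ f = coordTuple K hp (J ∘ f) := rfl

theorem coordTuple_cons {m p : ℕ} (hp : p ≤ d) (l : Fin (p + 1)) (J : Fin m → Fin (p + 1)) :
    coordTuple K hp (Fin.cons l J : Fin (m + 1) → Fin (p + 1)) =
      Fin.cons (coordForm K (Fin.castLE (by omega) l)) (coordTuple K hp J) := by
  funext j
  refine Fin.cases ?_ (fun j => ?_) j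
  · rfl
  · rfl

theorem cocycle_sub_differential {n : ℤ} {p : ℕ} {b : Family K d (p + 1)}
    (hb : b ∈ openCocycles K d n (p + 1)) {a : Family K d p} (ha : a ∈ cochains n ∅ p) :
    b - differential K d p a ∈ openCocycles K d n (p + 1) := by
  rw [mem_openCocycles] at hb ⊢
  refine ⟨fun t => Submodule.sub_mem _ (hb.1 t) ((differential_mem ha).1 t), fun t ht => ?_⟩
  rw [map_sub, differential_differential, sub_zero]
  exact hb.2 t ht

/-- A contracting homotopy removes the monomials with nonnegative exponent, one coordinate at a
time: such a part of `β(X_k, s)` has no pole along `X_k`, so it is a section for the shorter tuple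
`s`. -/
theorem exists_negative_representative {n : ℤ} {p : ℕ} (hp : p + 1 ≤ d) {b : Family K d (p + 1)}
    (hb : b ∈ openCocycles K d n (p + 1)) (k : ℕ) (hk : k ≤ p + 2) :
    ∃ a ∈ cochains n ∅ p, ∀ J : Fin (p + 2) → Fin (p + 2),
      (b - differential K d p a) (coordTuple K hp J) ∈
        monSpan K {m | ∀ a : Fin (d + 1), (a : ℕ) < k → m a < 0} := by
  classical
  induction k with
  | zero =>
    refine ⟨0, Submodule.zero_mem _, fun J => ?_⟩
    rw [map_zero, sub_zero]
    exact monSpan_mono (by simp) ((mem_sections_coordTuple hp J).mp ((mem_openCocycles.mp hb).1 _))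
  | succ k ih =>
    obtain ⟨a, ha, h⟩ := ih (by omega)
    set β := b - differential K d p a with hβ
    have hβ' : β ∈ openCocycles K d n (p + 1) := cocycle_sub_differential hb ha
    rw [mem_openCocycles] at hβ'
    set l : Fin (p + 2) := ⟨k, by omega⟩ with hl
    set x : Fin (d + 1) := Fin.castLE (by omega) l with hx
    let T := proj K {m : Fin (d + 1) → ℤ | 0 ≤ m x}
    let a' : Family K d p := fun s =>
      if ∃ J, s = coordTuple K hp J then T (β (Fin.cons (coordForm K x) s)) else 0
    have ha'J : ∀ J, a' (coordTuple K hp J) =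
        T (β (Fin.cons (coordForm K x) (coordTuple K hp J))) :=
      fun J => if_pos ⟨J, rfl⟩
    have ha' : a' ∈ cochains n ∅ p := by
      refine ⟨fun t => ?_, fun t ht => (ht 0).elim⟩
      by_cases ht : ∃ J, t = coordTuple K hp J
      · obtain ⟨J, rfl⟩ := ht
        rw [ha'J, mem_sections_coordTuple, ← coordTuple_cons hp l J]
        refine proj_mem ?_ ((mem_sections_coordTuple hp _).mp (hβ'.1 _))
        rintro m ⟨⟨h1, h2⟩, h3⟩
        refine ⟨h1, fun c hc => ?_⟩
        by_cases hcx : c = x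
        · rw [hcx]; exact h3
        · refine h2 c ?_
          rintro ⟨j, rfl⟩
          refine Fin.cases (fun hc hcx => hcx rfl) (fun j hc hcx => hc ⟨j, rfl⟩) j hc hcx
      · change (if _ then _ else _) ∈ _
        rw [if_neg ht]
        exact Submodule.zero_mem _
    refine ⟨a + a', Submodule.add_mem _ ha ha', fun J => ?_⟩
    -- The cocycle condition at `(X_k, J)` writes `β(J)` as the alternating sum of the `β(X_k, face
    -- of J)`; apply `T` termwise.
    have key : differential K d p a' (coordTuple K hp J) = T (β (coordTuple K hp J)) := by
      have h1 := hβ'.2 (coordTuple K hp (Fin.cons l J)) (coordTuple_mem_firstForms hp _)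
      rw [coordTuple_cons, differential_cons, sub_eq_zero] at h1
      rw [h1, differential_apply, differential_apply, map_sum]
      refine Finset.sum_congr rfl fun j _ => ?_
      rw [map_zsmul, coordTuple_comp, ha'J]
    rw [map_add, ← sub_sub, ← hβ, Pi.sub_apply, key]
    refine sub_proj_mem ?_ (h J)
    rintro m ⟨h1, h2⟩ c hc
    rcases Nat.lt_succ_iff_lt_or_eq.mp hc with h3 | h3
    · exact h1 c h3
    · have : c = x := Fin.ext h3
      rw [this]
      exact not_le.mp h2

/-- A cocycle whose value at `X_0, …, X_p` is regular along some coordinate is a coboundary on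
coordinate tuples. -/
theorem exists_vanishing_coordTuple {n : ℤ} {p : ℕ} (hp : p + 1 ≤ d) {b : Family K d (p + 1)}
    (hb : b ∈ openCocycles K d n (p + 1))
    (hstd : b (stdTuple K hp) ∈ monSpan K (regularSet d (p + 1))) :
    ∃ a ∈ cochains n ∅ p, ∀ J : Fin (p + 2) → Fin (p + 2),
      (b - differential K d p a) (coordTuple K hp J) = 0 := by
  obtain ⟨a, ha, h⟩ := exists_negative_representative hp hb (p + 2) le_rfl
  refine ⟨a, ha, ?_⟩
  have hβ' := mem_openCocycles.mp (cocycle_sub_differential hb ha)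
  have disj : ∀ m ∈ {m : Fin (d + 1) → ℤ | ∀ a : Fin (d + 1), (a : ℕ) < p + 2 → m a < 0},
      m ∉ regularSet d (p + 1) := by
    rintro m hm ⟨c, hc, hc'⟩
    have := hm c (by omega)
    omega
  -- All values now have negative exponents at `0, …, p + 1`. A tuple with a repetition omits some
  -- coordinate, so its value is also regular, hence zero; on the identity tuple the hypothesis and
  -- the shape of a coboundary give the same.
  have := eq_zero_of_cocycle (fun J => (b - differential K d p a) (coordTuple K hp J)) ?_ ?_ ?_
  · exact fun J => congrFun this J
  · exact fun J => hβ'.2 (coordTuple K hp J) (coordTuple_mem_firstForms hp _)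
  · intro J hJ
    rw [Finite.injective_iff_surjective, Function.Surjective, not_forall] at hJ
    obtain ⟨l, hl⟩ := hJ
    exact eq_zero_of_mem_monSpan disj (h J)
      (sections_le_regular hp J l (fun j hj => hl ⟨j, hj⟩) (hβ'.1 _))
  · refine eq_zero_of_mem_monSpan disj (h id) (Submodule.sub_mem _ hstd ?_)
    rw [differential_apply]
    refine Submodule.sum_mem _ fun j _ => Submodule.smul_of_tower_mem _ _ ?_
    exact sections_le_regular hp _ j (fun l => Fin.succAbove_ne j l)
      (ha.1 (coordTuple K hp (id ∘ j.succAbove)))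

end CoordTuples

/-! ### Partitions of unity -/

section Partition

variable {K : Type*} [Field K] {d : ℕ}

theorem lin_ne_zero (v : LinForm K d) : (lin v.1 : Coord K d) ≠ 0 := by
  intro h
  apply v.2
  funext a
  have h1 := congrArg (MvPolynomial.aeval (Pi.single a (1 : K) : Fin (d + 1) → K)) h
  rw [lin, map_sum, Finset.sum_eq_single a] at h1
  · simpa using h1
  · intro b _ hb
    simp [Pi.single_eq_of_ne hb]
  · simp

theorem lin_eq_sum_castLE {p : ℕ} (hp : p ≤ d) {v : LinForm K d}
    (hv : v ∈ firstForms K d (p + 1)) :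
    (lin v.1 : Coord K d) = ∑ l : Fin (p + 1), MvPolynomial.C (v.1 (Fin.castLE (by omega) l)) *
      MvPolynomial.X (Fin.castLE (by omega) l) := by
  rw [lin]
  symm
  apply Finset.sum_of_injOn (Fin.castLE (by omega : p + 1 ≤ d + 1))
    (Fin.castLE_injective _).injOn
  · exact fun _ _ => Finset.mem_coe.mpr (Finset.mem_univ _)
  · intro a _ ha
    rw [hv a, map_zero, zero_mul]
    by_contra h
    exact ha ⟨⟨a, by omega⟩, by simp, rfl⟩
  · exact fun _ _ => rfl

/-- The `N`-th powers of `X_0, …, X_p` generate a power of every linear form in these variables,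
with homogeneous coefficients. -/
theorem exists_partition {p : ℕ} (hp : p ≤ d) {v : LinForm K d}
    (hv : v ∈ firstForms K d (p + 1)) (N : ℕ) :
    ∃ (e : ℕ) (h : Fin (p + 1) → Coord K d), (∀ l, (h l).IsHomogeneous e) ∧
      (lin v.1 : Coord K d) ^ (e + N) =
        ∑ l, h l * MvPolynomial.X (Fin.castLE (by omega) l) ^ N := by
  classical
  -- Pigeonhole: a monomial of degree `(p + 1) N` in `p + 1` variables contains one of them to the
  -- power at least `N`.
  refine ⟨p * N, ?_⟩
  rw [lin_eq_sum_castLE hp hv, Finset.sum_pow_eq_sum_piAntidiag]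
  refine Finset.sum_induction _ (fun f => ∃ h : Fin (p + 1) → Coord K d,
    (∀ l, (h l).IsHomogeneous (p * N)) ∧
      f = ∑ l, h l * MvPolynomial.X (Fin.castLE (by omega) l) ^ N) ?_ ?_ ?_
  · rintro _ _ ⟨h, hh, rfl⟩ ⟨h', hh', rfl⟩
    exact ⟨h + h', fun l => (hh l).add (hh' l), by simp [add_mul, Finset.sum_add_distrib]⟩
  · exact ⟨0, fun l => MvPolynomial.isHomogeneous_zero _ _ _, by simp⟩
  · intro k hk
    rw [Finset.mem_piAntidiag] at hk
    obtain ⟨l, hl⟩ : ∃ l, N ≤ k l := by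
      by_contra hcon
      push Not at hcon
      have := Finset.sum_lt_sum_of_nonempty (s := (Finset.univ : Finset (Fin (p + 1))))
        Finset.univ_nonempty fun l _ => hcon l
      rw [hk.1] at this
      simp at this
      lia
    set k' : Fin (p + 1) → ℕ := fun l' => k l' - if l' = l then N else 0 with hk'
    have hkk : ∀ l', k l' = k' l' + if l' = l then N else 0 := by
      intro l'
      simp only [hk']
      split_ifs with h
      · subst h; omega
      · omega
    let c : K := ∏ l', v.1 (Fin.castLE (by omega) l') ^ k l'
    let g : Coord K d := MvPolynomial.C ((Nat.multinomial Finset.univ k : K) * c) *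
      ∏ l', MvPolynomial.X (Fin.castLE (by omega : p + 1 ≤ d + 1) l') ^ k' l'
    refine ⟨Pi.single l g, fun l' => ?_, ?_⟩
    · by_cases h : l' = l
      · subst h
        rw [Pi.single_eq_same]
        have h1 := MvPolynomial.IsHomogeneous.prod (Finset.univ : Finset (Fin (p + 1)))
          (fun l' =>
            (MvPolynomial.X (Fin.castLE (by omega : p + 1 ≤ d + 1) l') : Coord K d) ^ k' l')
          (fun l' => 1 * k' l') fun l' _ => (MvPolynomial.isHomogeneous_X K _).pow _
        have h2 := (MvPolynomial.isHomogeneous_C (Fin (d + 1))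
          ((Nat.multinomial Finset.univ k : K) * c)).mul h1
        have h3 : 0 + ∑ l', 1 * k' l' = p * N := by
          have := hk.1
          simp only [hkk, Finset.sum_add_distrib, Finset.sum_ite_eq', Finset.mem_univ,
            if_true] at this
          simp only [one_mul, zero_add]
          omega
        rwa [h3] at h2
      · rw [Pi.single_eq_of_ne h]
        exact MvPolynomial.isHomogeneous_zero _ _ _
    · rw [Finset.sum_eq_single l]
      · rw [Pi.single_eq_same]
        have h1 : ∀ x : Fin (p + 1) → Coord K d, ∏ l', x l' ^ k l' =
            (∏ l', x l' ^ k' l') * x l ^ N := by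
          intro x
          simp only [hkk, pow_add, Finset.prod_mul_distrib]
          congr 1
          simp
        simp only [mul_pow, Finset.prod_mul_distrib, g, c, map_mul, map_prod, map_pow, map_natCast]
        rw [h1 fun l' => MvPolynomial.X (Fin.castLE (by omega) l')]
        ring
      · intro l' _ h
        rw [Pi.single_eq_of_ne h, zero_mul]
      · simp

/-- Enlarging the exponent of the denominator is harmless, which allows one common exponent for
finitely many sections. -/
theorem sections_exponent {n : ℤ} {p : ℕ} {t : Fin (p + 1) → LinForm K d} {q : Rat K d}
    (hq : q ∈ sections n t) : ∃ N₀ : ℕ, ∀ N, N₀ ≤ N → ∃ (m : ℕ) (g : Coord K d),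
      g.IsHomogeneous m ∧ (m : ℤ) = n + N * (p + 1) ∧
      q * algebraMap (Coord K d) (Rat K d) (∏ j, lin (t j).1) ^ N = algebraMap _ _ g := by
  obtain ⟨N₀, m, g, hg, hm, hq⟩ := hq
  refine ⟨N₀, fun N hN => ⟨m + (p + 1) * (N - N₀), g * (∏ j, lin (t j).1) ^ (N - N₀),
    hg.mul ((prod_lin_isHomogeneous t).pow _), ?_, ?_⟩⟩
  · push_cast [Nat.cast_sub hN]
    rw [hm]
    ring
  · rw [map_mul, ← hq, map_pow, mul_assoc, ← pow_add, Nat.add_sub_cancel' hN]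

/-- The factor `x^N` cancels the pole of `q` along `x`, at the price of a larger pole along the last
form of `s`, which is allowed there. -/
theorem partition_mul_mem {n : ℤ} {p : ℕ} (s : Fin (p + 1) → LinForm K d) (x : LinForm K d)
    {N m e : ℕ} {g h : Coord K d} (hg : g.IsHomogeneous m) (hm : (m : ℤ) = n + N * (p + 2))
    {q : Rat K d} (hq : q * algebraMap (Coord K d) (Rat K d)
      (∏ j, lin ((Fin.cons x s : Fin (p + 2) → LinForm K d) j).1) ^ N = algebraMap _ _ g)
    (hh : h.IsHomogeneous e) :
    algebraMap (Coord K d) (Rat K d) (h * lin x.1 ^ N) /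
      algebraMap (Coord K d) (Rat K d) (lin (s (Fin.last p)).1) ^ (e + N) * q ∈ sections n s := by
  set A : Coord K d := ∏ j : Fin p, lin (s j.castSucc).1 with hA
  have hAh : A.IsHomogeneous p := by
    have := MvPolynomial.IsHomogeneous.prod (Finset.univ : Finset (Fin p))
      (fun j => (lin (s j.castSucc).1 : Coord K d)) (fun _ => 1) (fun j _ => lin_isHomogeneous _)
    simpa using this
  refine ⟨N + (e + N), e + m + p * (e + N), h * g * A ^ (e + N),
    (hh.mul hg).mul (hAh.pow _), ?_, ?_⟩
  · push_cast
    rw [hm]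
    ring
  · have hL : algebraMap (Coord K d) (Rat K d) (lin (s (Fin.last p)).1) ≠ 0 := by
      rw [Ne, map_eq_zero_iff _ algebraMap_coord_injective]
      exact lin_ne_zero _
    rw [Fin.prod_univ_succ] at hq
    simp only [Fin.cons_zero, Fin.cons_succ] at hq
    rw [Fin.prod_univ_castSucc (fun j => (lin (s j).1 : Coord K d)), ← hA] at hq ⊢
    simp only [map_mul, map_pow] at hq ⊢
    rw [← hq]
    field_simp
    ring

end Partition

/-! ### Vanishing on tuples beginning with coordinates -/

section Vanishing

variable {K : Type*} [Field K] {d : ℕ}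

/-- The family vanishes on tuples of forms in `X_0, …, X_p` the first `k` of which are
coordinates. -/
def VanishesAt {m p : ℕ} (hp : p ≤ d) (k : ℕ) (β : (Fin m → LinForm K d) → Rat K d) : Prop :=
  ∀ t : Fin m → LinForm K d, (∀ j, t j ∈ firstForms K d (p + 1)) →
    (∀ j : Fin m, (j : ℕ) < k → ∃ l : Fin (p + 1), t j = coordForm K (Fin.castLE (by omega) l)) →
    β t = 0

theorem coordForm_mem_firstForms {p : ℕ} (hp : p ≤ d) (l : Fin (p + 1)) :
    coordForm K (Fin.castLE (by omega) l) ∈ firstForms K d (p + 1) :=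
  coordTuple_mem_firstForms (m := 1) hp (fun _ => l) 0

theorem eq_sum_cons {n : ℤ} {p : ℕ} (hp : p + 1 ≤ d) {β : Family K d (p + 1)}
    (hβ : β ∈ openCocycles K d n (p + 1)) {t : Fin (p + 2) → LinForm K d}
    (ht : ∀ j, t j ∈ firstForms K d (p + 2)) (l : Fin (p + 2)) :
    β t = ∑ j : Fin (p + 2), (-1 : ℤ) ^ (j : ℕ) •
      β (Fin.cons (coordForm K (Fin.castLE (by omega) l)) (t ∘ j.succAbove)) := by
  have h := (mem_openCocycles.mp hβ).2 (Fin.cons (coordForm K (Fin.castLE (by omega) l)) t) (by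
    intro j
    refine Fin.cases ?_ (fun j => ?_) j
    · exact coordForm_mem_firstForms hp l
    · exact ht j)
  rwa [differential_cons, sub_eq_zero] at h

/-- A partition of unity on `D(v)`, with `v` the last form of the tuple, averages the homotopies `s
↦ β(X_l, s)` over `l`. Restricting the primitive to tuples starting with coordinates trades one
coordinate entry of the vanishing condition for an arbitrary form. -/
theorem exists_vanishesAt {n : ℤ} {p : ℕ} (hp : p + 1 ≤ d) {β : Family K d (p + 1)}
    (hβ : β ∈ openCocycles K d n (p + 1)) {k : ℕ} (hk : k ≤ p + 1)
    (hv : VanishesAt hp (k + 1) β) :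
    ∃ a ∈ cochains n ∅ p, VanishesAt hp k (β - differential K d p a) := by
  classical
  have consX : ∀ (l : Fin (p + 2)) (s : Fin (p + 1) → LinForm K d) (k : ℕ),
      (∀ j, s j ∈ firstForms K d (p + 2)) →
      (∀ j : Fin (p + 1), (j : ℕ) < k → ∃ l : Fin (p + 2),
        s j = coordForm K (Fin.castLE (by omega) l)) → VanishesAt hp (k + 1) β →
      β (Fin.cons (coordForm K (Fin.castLE (by omega) l)) s) = 0 := by
    intro l s k hs hsk hv
    refine hv _ (fun j => ?_) (fun j => ?_)
    · refine Fin.cases ?_ (fun j => ?_) j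
      · exact coordForm_mem_firstForms hp l
      · exact hs j
    · refine Fin.cases (fun _ => ⟨l, rfl⟩) (fun j hj => ?_) j
      exact hsk j (by simpa using hj)
  rcases k with - | k
  -- With no coordinates left to keep, no correction is needed: the cocycle condition at `(X_0, t)`
  -- expresses `β(t)` by tuples that start with a coordinate.
  · refine ⟨0, Submodule.zero_mem _, fun t ht _ => ?_⟩
    rw [map_zero, sub_zero, eq_sum_cons hp hβ ht 0]
    refine Finset.sum_eq_zero fun j _ => ?_
    rw [consX 0 (t ∘ j.succAbove) 0 (fun l => ht _) (fun l hl => absurd hl (Nat.not_lt_zero _)) hv]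
    exact zsmul_zero _
  let X : Fin (p + 2) → LinForm K d := fun l => coordForm K (Fin.castLE (by omega) l)
  let R : (Fin (p + 1) → LinForm K d) → (Fin (p + 1) → Fin (p + 2)) → Fin (p + 1) → LinForm K d :=
    fun s J j => if (j : ℕ) < k then X (J j) else s j
  choose E hE using fun t => sections_exponent ((mem_openCocycles.mp hβ).1 t)
  -- The exponent must clear the poles along every `X_l` and yet be the same for all faces used
  -- below. Taking the maximum over all replacements of the first `k` entries by coordinates makes
  -- it depend only on the entries from position `k` on.
  let Nf : (Fin (p + 1) → LinForm K d) → ℕ := fun s =>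
    Finset.univ.sup fun x : Fin (p + 2) × (Fin (p + 1) → Fin (p + 2)) =>
      E (Fin.cons (X x.1) (R s x.2))
  have part : ∀ (v : LinForm K d) (N : ℕ), ∃ (e : ℕ) (h : Fin (p + 2) → Coord K d),
      (∀ l, (h l).IsHomogeneous e) ∧ (v ∈ firstForms K d (p + 2) →
        (lin v.1 : Coord K d) ^ (e + N) = ∑ l, h l * lin (X l).1 ^ N) := by
    intro v N
    by_cases hv : v ∈ firstForms K d (p + 2)
    · obtain ⟨e, h, hh, he⟩ := exists_partition hp hv N
      refine ⟨e, h, hh, fun _ => ?_⟩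
      rw [he]
      refine Finset.sum_congr rfl fun l _ => ?_
      rw [lin_coordForm]
    -- Forms outside the span of `X_0, …, X_{p+1}` get default data, so that the choice is a
    -- function on all forms.
    · exact ⟨0, 0, fun l => MvPolynomial.isHomogeneous_zero _ _ _, fun h => absurd h hv⟩
  choose e h hh he using part
  let u : LinForm K d → ℕ → Fin (p + 2) → Rat K d := fun v N l =>
    algebraMap (Coord K d) (Rat K d) (h v N l * lin (X l).1 ^ N) /
      algebraMap (Coord K d) (Rat K d) (lin v.1) ^ (e v N + N)
  have hu : ∀ v N, v ∈ firstForms K d (p + 2) → ∑ l, u v N l = 1 := by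
    intro v N hv
    rw [← Finset.sum_div, ← map_sum, ← he v N hv, map_pow, div_self]
    refine pow_ne_zero _ ?_
    rw [Ne, map_eq_zero_iff _ algebraMap_coord_injective]
    exact lin_ne_zero v
  let a : Family K d p := fun s =>
    if ∀ j : Fin (p + 1), (j : ℕ) < k → ∃ l, s j = X l then
      ∑ l, u (s (Fin.last p)) (Nf s) l * β (Fin.cons (X l) s) else 0
  have ha : a ∈ cochains n ∅ p := by
    refine ⟨fun s => ?_, fun t ht => (ht 0).elim⟩
    change (if _ then _ else _) ∈ _
    split_ifs with hs
    · refine Submodule.sum_mem _ fun l _ => ?_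
      obtain ⟨J, hJ⟩ : ∃ J : Fin (p + 1) → Fin (p + 2), R s J = s := by
        refine ⟨fun j => if hj : (j : ℕ) < k then (hs j hj).choose else 0, funext fun j => ?_⟩
        by_cases hj : (j : ℕ) < k
        · simp only [R, if_pos hj, dif_pos hj]
          exact (hs j hj).choose_spec.symm
        · simp only [R, if_neg hj]
      have hN : E (Fin.cons (X l) s) ≤ Nf s := by
        have := Finset.le_sup (f := fun x : Fin (p + 2) × (Fin (p + 1) → Fin (p + 2)) =>
          E (Fin.cons (X x.1) (R s x.2))) (Finset.mem_univ (l, J))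
        simpa only [hJ] using this
      obtain ⟨m, g, hg, hm, hq⟩ := hE _ _ hN
      exact partition_mul_mem s (X l) hg (by rw [hm]; push_cast; ring) hq (hh _ _ l)
    · exact Submodule.zero_mem _
  refine ⟨a, ha, fun t ht htk => ?_⟩
  set v := t (Fin.last (p + 1)) with hvdef
  set N := Nf (fun j => t j.succ) with hNdef
  -- Faces omitting one of the first `k + 1` entries share the last form and the tail, hence the
  -- same partition of unity. For the other faces both sides vanish, since prepending `X_l` gives `k
  -- + 2` coordinates in front.
  have key : ∀ j : Fin (p + 2), a (t ∘ j.succAbove) =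
      ∑ l, u v N l * β (Fin.cons (X l) (t ∘ j.succAbove)) := by
    intro j
    by_cases hj : (j : ℕ) ≤ k
    · have e1 : ∀ c : Fin (p + 1), k ≤ (c : ℕ) → j.succAbove c = c.succ := by
        intro c hc
        rw [Fin.succAbove_of_le_castSucc]
        rw [Fin.le_def, Fin.val_castSucc]
        omega
      have e2 : (t ∘ j.succAbove) (Fin.last p) = v := by
        rw [Function.comp_apply, e1 _ (by simp; omega)]
        rfl
      have e3 : Nf (t ∘ j.succAbove) = N := by
        have : R (t ∘ j.succAbove) = R fun j => t j.succ := by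
          funext J c
          simp only [R]
          split_ifs with hc
          · rfl
          · rw [Function.comp_apply, e1 c (by omega)]
        simp only [hNdef, Nf, this]
      change (if _ then _ else _) = _
      rw [if_pos, e2, e3]
      intro c hc
      refine htk _ ?_
      simp only [Fin.succAbove]
      split_ifs
      · simp; omega
      · simp; omega
    · have e1 : ∀ l, β (Fin.cons (X l) (t ∘ j.succAbove)) = 0 := by
        intro l
        refine consX l _ (k + 1) (fun c => ht _) (fun c hc => ?_) hv
        refine htk _ ?_
        rw [Fin.succAbove_of_castSucc_lt]
        · exact hc
        · rw [Fin.lt_def, Fin.val_castSucc]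
          omega
      change (if _ then _ else _) = _
      simp only [e1, mul_zero, Finset.sum_const_zero, ite_self]
  rw [Pi.sub_apply, sub_eq_zero, differential_apply]
  calc β t = ∑ l, u v N l * β t := by rw [← Finset.sum_mul, hu v N (ht _), one_mul]
    _ = ∑ l, ∑ j : Fin (p + 2), (-1 : ℤ) ^ (j : ℕ) •
        (u v N l * β (Fin.cons (X l) (t ∘ j.succAbove))) := by
      refine Finset.sum_congr rfl fun l _ => ?_
      conv_lhs => rw [eq_sum_cons hp hβ ht l]
      rw [Finset.mul_sum]
      refine Finset.sum_congr rfl fun j _ => ?_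
      exact (map_zsmul (AddMonoidHom.mulLeft (u v N l)) _ _)
    _ = _ := by
      rw [Finset.sum_comm]
      refine Finset.sum_congr rfl fun j _ => ?_
      rw [key]
      exact (map_sum (zsmulAddGroupHom (α := Rat K d) ((-1 : ℤ) ^ (j : ℕ))) _ _).symm

/-- The kernel of `theta` in higher codimension. -/
theorem exists_cochain_succ {n : ℤ} {p : ℕ} (hp : p + 1 ≤ d) {b : Family K d (p + 1)}
    (hb : b ∈ openCocycles K d n (p + 1))
    (hstd : b (stdTuple K hp) ∈ monSpan K (regularSet d (p + 1))) :
    ∃ c ∈ cochains n (firstForms K d (p + 2)) (p + 1),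
      differential K d (p + 1) c = differential K d (p + 1) b := by
  obtain ⟨a₀, ha₀, h₀⟩ := exists_vanishing_coordTuple hp hb hstd
  -- Starting from vanishing on tuples of `p + 2` coordinates, each correction frees one entry,
  -- until no entry need be a coordinate.
  have step : ∀ k ≤ p + 2, ∃ a ∈ cochains n ∅ p,
      VanishesAt hp (p + 2 - k) (b - differential K d p a) := by
    intro k hk
    induction k with
    | zero =>
      refine ⟨a₀, ha₀, fun t _ ht => ?_⟩
      choose J hJ using fun j : Fin (p + 2) => ht j (by omega)
      have : t = coordTuple K hp J := funext hJ
      rw [this]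
      exact h₀ J
    | succ k ih =>
      obtain ⟨a, ha, h⟩ := ih (by omega)
      have e : p + 2 - k = p + 2 - (k + 1) + 1 := by omega
      rw [e] at h
      obtain ⟨a', ha', h'⟩ := exists_vanishesAt hp (cocycle_sub_differential hb ha) (by omega) h
      refine ⟨a + a', Submodule.add_mem _ ha ha', ?_⟩
      rwa [map_add, ← sub_sub]
  obtain ⟨a, ha, h⟩ := step (p + 2) le_rfl
  have hc := cocycle_sub_differential hb ha
  refine ⟨b - differential K d p a, ⟨(mem_openCocycles.mp hc).1, fun t ht =>
    h t ht fun j hj => absurd hj (by omega)⟩, ?_⟩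
  rw [map_sub, differential_differential, sub_zero]

/-- The kernel of `theta`: the value at `X_0, …, X_p` is a sum of Laurent polynomials regular
along one of these coordinates. -/
theorem theta_eq_zero_iff {n : ℤ} {p : ℕ} (hp : p + 1 ≤ d) (b : openCocycles K d n p) :
    theta n p b = 0 ↔ b.1 (stdTuple K (by omega : p ≤ d)) ∈ monSpan K (regularSet d p) := by
  rw [theta_eq_zero]
  constructor
  · rintro ⟨c, hc, hcb⟩
    -- The difference is a cocycle on all of `ℙ^d`, and `c` vanishes at `(X_0, …, X_p)`, so this
    -- tuple sees a global cocycle.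
    have h1 : b.1 - c ∈ cochains n ∅ p := Submodule.sub_mem _ b.2.1 (cochains_le _ _ _ hc)
    have h2 := cocycle_std_mem hp h1 (by rw [map_sub, hcb, sub_self])
    rwa [Pi.sub_apply, hc.2 (stdTuple K _) (coordTuple_mem_firstForms _ _), sub_zero] at h2
  · intro h
    cases p with
    | zero => exact exists_cochain_zero b.2 h
    | succ p => exact exists_cochain_succ (by omega) b.2 h

end Vanishing

/-! ### Operators on cocycles -/

section Operators

variable {K : Type*} [Field K] {d : ℕ}

theorem ratX_mul_mem {n : ℤ} {p : ℕ} {t : Fin (p + 1) → LinForm K d} (a : Fin (d + 1)) {q : Rat K d}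
    (hq : q ∈ sections n t) : ratX K a * q ∈ sections (n + 1) t := by
  obtain ⟨N, m, h, hh, hm, hq⟩ := hq
  refine ⟨N, m + 1, MvPolynomial.X a * h, ?_, by push_cast; rw [hm]; ring, ?_⟩
  · rw [add_comm m]
    exact (MvPolynomial.isHomogeneous_X K a).mul hh
  · rw [mul_assoc, hq, map_mul]
    rfl

theorem ratPderiv_mem {n : ℤ} {p : ℕ} {t : Fin (p + 1) → LinForm K d} (a : Fin (d + 1))
    {q : Rat K d} (hq : q ∈ sections n t) : ratPderiv K a q ∈ sections (n - 1) t := by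
  obtain ⟨N, m, h, hh, hm, hq⟩ := hq
  set f : Coord K d := ∏ j, lin (t j).1 with hf
  have hfh : f.IsHomogeneous (p + 1) := prod_lin_isHomogeneous t
  have h1 := congrArg (ratPderiv K a) hq
  rw [Derivation.leibniz, Derivation.leibniz_pow, ratPderiv_algebraMap,
    ratPderiv_algebraMap] at h1
  -- The quotient rule for `h / f^N`.
  refine ⟨N + 1, m + p, f * MvPolynomial.pderiv a h - N * (h * MvPolynomial.pderiv a f),
    ?_, ?_, ?_⟩
  · refine MvPolynomial.IsHomogeneous.sub ?_ ?_
    · cases m with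
      | zero =>
        rw [← MvPolynomial.totalDegree_zero_iff_isHomogeneous,
          MvPolynomial.totalDegree_eq_zero_iff_eq_C] at hh
        rw [hh, MvPolynomial.pderiv_C, mul_zero]
        exact MvPolynomial.isHomogeneous_zero _ _ _
      | succ m =>
        have := hfh.mul (hh.pderiv (i := a))
        rwa [Nat.add_sub_cancel, show p + 1 + m = m + 1 + p by omega] at this
    · have := (MvPolynomial.isHomogeneous_C (Fin (d + 1)) (N : K)).mul
        (hh.mul (hfh.pderiv (i := a)))
      simpa using this
  · push_cast
    rw [hm]
    ring
  · rw [← hf]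
    simp only [map_sub, map_mul, map_natCast, ← h1, ← hq]
    cases N with
    | zero => simp; ring
    | succ N => simp; ring

/-- Operators on rational functions changing the degree act on cocycles. -/
theorem familyMap_id_mem {n n' : ℤ} {p : ℕ} (A : Module.End K (Rat K d))
    (hA : ∀ (t : Fin (p + 1) → LinForm K d), ∀ q ∈ sections n t, A q ∈ sections n' t)
    {b : Family K d p} (hb : b ∈ openCocycles K d n p) :
    familyMap A id p b ∈ openCocycles K d n' p := by
  rw [mem_openCocycles] at hb ⊢
  refine ⟨fun t => hA t _ (hb.1 t), fun t ht => ?_⟩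
  rw [differential_familyMap]
  change A (differential K d p b t) = 0
  rw [hb.2 t ht, map_zero]

variable (K) in
/-- Multiplication by `X_a`. -/
def mulX (a : Fin (d + 1)) : Module.End K (Rat K d) := LinearMap.mulLeft K (ratX K a)

variable (K) in
/-- The operator `∂/∂X_a`. -/
def partialX (a : Fin (d + 1)) : Module.End K (Rat K d) := (ratPderiv K a : Rat K d →ₗ[K] Rat K d)

theorem mulX_mem {n : ℤ} {p : ℕ} (a : Fin (d + 1)) {b : Family K d p}
    (hb : b ∈ openCocycles K d n p) : familyMap (mulX K a) id p b ∈ openCocycles K d (n + 1) p :=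
  familyMap_id_mem _ (fun _ _ hq => ratX_mul_mem a hq) hb

theorem partialX_mem {n : ℤ} {p : ℕ} (a : Fin (d + 1)) {b : Family K d p}
    (hb : b ∈ openCocycles K d n p) :
    familyMap (partialX K a) id p b ∈ openCocycles K d (n - 1) p :=
  familyMap_id_mem _ (fun _ _ hq => ratPderiv_mem a hq) hb

theorem mulX_regular {p : ℕ} (a : Fin (d + 1)) {q : Rat K d}
    (hq : q ∈ monSpan K (regularSet d p)) : ratX K a * q ∈ monSpan K (regularSet d p) := by
  refine map_mem_of_mon (mulX K a) _ (fun m hm => ?_) hq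
  obtain ⟨c, hc, hc'⟩ := hm
  change ratX K a * mon K m ∈ _
  rw [mon_add_single]
  refine mon_mem ⟨c, hc, ?_⟩
  rw [Pi.add_apply, Pi.single_apply]
  split_ifs <;> omega

/-- Differentiation lowers an exponent only with that exponent as coefficient, so it never turns `0`
into `-1`. -/
theorem partialX_regular {p : ℕ} (a : Fin (d + 1)) {q : Rat K d}
    (hq : q ∈ monSpan K (regularSet d p)) : ratPderiv K a q ∈ monSpan K (regularSet d p) := by
  refine map_mem_of_mon (partialX K a) _ (fun m hm => ?_) hq
  obtain ⟨c, hc, hc'⟩ := hm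
  change ratPderiv K a (mon K m) ∈ _
  rw [ratPderiv_mon]
  by_cases h : m a = 0
  · rw [h, Int.cast_zero, zero_smul]
    exact Submodule.zero_mem _
  · refine Submodule.smul_mem _ _ (mon_mem ⟨c, hc, ?_⟩)
    rw [Pi.sub_apply, Pi.single_apply]
    split_ifs with h1
    · subst h1; omega
    · omega

/-! ### The group and differential operators -/

/-- The conjugate of a derivation by an automorphism. -/
def conjDerivation (e : Rat K d ≃ₐ[K] Rat K d) (D : Derivation K (Rat K d) (Rat K d)) :
    Derivation K (Rat K d) (Rat K d) :=
  Derivation.mk' (e.toLinearMap ∘ₗ (D : Rat K d →ₗ[K] Rat K d) ∘ₗ e.symm.toLinearMap) fun a b => by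
    simp

theorem ratAction_lin (g : GL (Fin (d + 1)) K) (v : Fin (d + 1) → K) :
    ratAction g (algebraMap _ (Rat K d) (lin v)) = algebraMap _ _ (lin (g.1.mulVec v)) := by
  rw [ratAction_algebraMap, substHom_lin]

theorem ratX_eq_lin (a : Fin (d + 1)) :
    ratX K a = algebraMap _ (Rat K d) (lin (Pi.single a (1 : K))) := by
  rw [ratX, ← lin_coordForm]
  rfl

theorem ratAction_ratX (g : GL (Fin (d + 1)) K) (b : Fin (d + 1)) :
    ratAction g (ratX K b) = ∑ a, g.1 a b • ratX K a := by
  rw [ratX_eq_lin, ratAction_lin, algebraMap_lin]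
  simp

theorem ratAction_symm (g : GL (Fin (d + 1)) K) (q : Rat K d) :
    (ratAction g).symm q = ratAction g⁻¹ q := by
  rw [map_inv]
  rfl

/-- The conjugate of `∂/∂X_a` by `g` is a derivation, so it is determined by its values on the
coordinates, which are entries of `g⁻¹`. -/
theorem ratAction_ratPderiv (g : GL (Fin (d + 1)) K) (a : Fin (d + 1)) (q : Rat K d) :
    ratAction g (ratPderiv K a q) = ∑ c, g⁻¹.1 a c • ratPderiv K c (ratAction g q) := by
  have h := derivation_apply_eq (conjDerivation (ratAction g) (ratPderiv K a)) (ratAction g q)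
  have e : ∀ q, conjDerivation (ratAction g) (ratPderiv K a) q =
      ratAction g (ratPderiv K a ((ratAction g).symm q)) := fun _ => rfl
  rw [e, AlgEquiv.symm_apply_apply] at h
  rw [h]
  refine Finset.sum_congr rfl fun c _ => ?_
  rw [e, ratAction_symm, ratAction_ratX, map_sum, Finset.sum_eq_single a]
  · rw [Derivation.map_smul, ratPderiv_ratX, if_pos rfl, map_smul, map_one, smul_mul_assoc, one_mul]
  · intro b _ hb
    rw [Derivation.map_smul, ratPderiv_ratX, if_neg hb, smul_zero]
  · simp

theorem twistedAction_eq (s : ℤ) (g : GL (Fin (d + 1)) K) (q : Rat K d) : twistedAction s g q =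
    ((Matrix.GeneralLinearGroup.det g ^ s : Kˣ) : K) • ratAction g q := rfl

theorem twistedLie_eq (s : ℤ) (x : Gl K d) (q : Rat K d) : twistedLie s x q =
    vectorField x q + ((s : K) * x.trace) • q := rfl

/-- The conjugated vector field and the vector field of `g x g⁻¹` agree on coordinates, and the
trace is invariant under conjugation. -/
theorem twistedAction_twistedLie (s : ℤ) (g : GL (Fin (d + 1)) K) (x : Gl K d) (q : Rat K d) :
    twistedAction s g (twistedLie s x q) =
      twistedLie s (g.1 * x * g⁻¹.1 : Gl K d) (twistedAction s g q) := by
  have h : conjDerivation (ratAction g) (vectorField x) =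
      vectorField (g.1 * x * g⁻¹.1 : Gl K d) := by
    apply ratDerivation_ext
    intro b
    change ratAction g (vectorField x ((ratAction g).symm (ratX K b))) =
      vectorField _ (ratX K b)
    rw [ratAction_symm, ratX_eq_lin, ratAction_lin, vectorField_lin, vectorField_lin,
      ratAction_lin, Matrix.mulVec_mulVec, Matrix.mulVec_mulVec]
  have h1 := DFunLike.congr_fun h (ratAction g q)
  change ratAction g (vectorField x ((ratAction g).symm (ratAction g q))) = _ at h1
  rw [AlgEquiv.symm_apply_apply] at h1
  have ht : (g.1 * x * g⁻¹.1 : Gl K d).trace = x.trace := by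
    rw [Matrix.trace_mul_comm, ← Matrix.mul_assoc, Units.inv_mul, Matrix.one_mul]
  rw [twistedAction_eq, twistedAction_eq, twistedLie_eq, twistedLie_eq, map_add, map_smul, h1,
    ht, Derivation.map_smul, smul_add, smul_comm]

theorem twistedAction_mul (s : ℤ) (g : GL (Fin (d + 1)) K) (q q' : Rat K d) :
    twistedAction s g (q * q') = ratAction g q * twistedAction s g q' := by
  rw [twistedAction_eq, twistedAction_eq, map_mul, mul_smul_comm]

theorem twistedAction_ratPderiv (s : ℤ) (g : GL (Fin (d + 1)) K) (a : Fin (d + 1)) (q : Rat K d) :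
    twistedAction s g (ratPderiv K a q) =
      ∑ c, g⁻¹.1 a c • ratPderiv K c (twistedAction s g q) := by
  rw [twistedAction_eq, twistedAction_eq, ratAction_ratPderiv, Finset.smul_sum]
  refine Finset.sum_congr rfl fun c _ => ?_
  rw [Derivation.map_smul, smul_comm]

theorem twistedLie_mul (s : ℤ) (x : Gl K d) (a : Fin (d + 1)) (q : Rat K d) :
    twistedLie s x (ratX K a * q) =
      (∑ c, x c a • ratX K c) * q + ratX K a * twistedLie s x q := by
  rw [twistedLie_eq, twistedLie_eq, Derivation.leibniz, ratX, vectorField_X, algebraMap_lin,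
    mul_add, mul_smul_comm]
  simp only [smul_eq_mul]
  ring

theorem twistedLie_ratPderiv (s : ℤ) (x : Gl K d) (a : Fin (d + 1)) (q : Rat K d) :
    twistedLie s x (ratPderiv K a q) =
      ratPderiv K a (twistedLie s x q) - ∑ c, x a c • ratPderiv K c q := by
  have h := derivation_apply_eq ⁅ratPderiv K a, vectorField x⁆ q
  rw [Derivation.commutator_apply] at h
  have e : ∀ c, ⁅ratPderiv K a, vectorField x⁆ (ratX K c) = algebraMap K _ (x a c) := by
    intro c
    rw [Derivation.commutator_apply, ratPderiv_ratX, ratX, vectorField_X, algebraMap_lin,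
      map_sum, Finset.sum_eq_single a]
    · rw [Derivation.map_smul, ratPderiv_ratX, if_pos rfl, Algebra.algebraMap_eq_smul_one]
      split_ifs <;> simp
    · intro b _ hb
      rw [Derivation.map_smul, ratPderiv_ratX, if_neg hb, smul_zero]
    · simp
  simp only [e, ← Algebra.smul_def] at h
  rw [twistedLie_eq, twistedLie_eq, map_add, Derivation.map_smul, ← h]
  abel

/-! ### The fundamental cocycle -/

/-- The coefficients of a tuple of forms in `X_0, …, X_p`. -/
def coeffMatrix {p : ℕ} (hp : p ≤ d) (t : Fin (p + 1) → LinForm K d) :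
    Matrix (Fin (p + 1)) (Fin (p + 1)) K :=
  Matrix.of fun j a => (t j).1 (Fin.castLE (by omega) a)

variable (K) in
/-- The cocycle `det(ℓ_0, …, ℓ_p) / (ℓ_0 ⋯ ℓ_p)`. -/
def eta {p : ℕ} (hp : p ≤ d) : Family K d p := fun t =>
  (coeffMatrix hp t).det • (algebraMap (Coord K d) (Rat K d) (∏ j, lin (t j).1))⁻¹

theorem algebraMap_prod_lin_ne_zero {m : ℕ} (t : Fin m → LinForm K d) :
    algebraMap (Coord K d) (Rat K d) (∏ j, lin (t j).1) ≠ 0 := by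
  rw [Ne, map_eq_zero_iff _ algebraMap_coord_injective]
  exact Finset.prod_ne_zero_iff.mpr fun j _ => lin_ne_zero _

/-- Expand along its first column the determinant with rows `(ℓ_j, coefficients of ℓ_j)`. It is zero
because `ℓ_j` is a combination of its own coefficients; divided by the product of the forms, this is
the cocycle condition for `eta`. -/
theorem sum_det_mul_lin {p : ℕ} (hp : p ≤ d) {t : Fin (p + 2) → LinForm K d}
    (ht : ∀ j, t j ∈ firstForms K d (p + 1)) :
    ∑ j : Fin (p + 2), (-1) ^ (j : ℕ) * lin (t j).1 *
      MvPolynomial.C (coeffMatrix hp (t ∘ j.succAbove)).det = (0 : Coord K d) := by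
  let A : Matrix (Fin (p + 2)) (Fin (p + 2)) (Coord K d) := Matrix.of fun j =>
    Fin.cons (lin (t j).1) fun l : Fin (p + 1) =>
      MvPolynomial.C ((t j).1 (Fin.castLE (by omega) l))
  have hA : A.det = 0 := by
    rw [← Matrix.exists_mulVec_eq_zero_iff]
    -- The kernel vector `(1, -X_0, …, -X_p)`.
    refine ⟨Fin.cons 1 fun l : Fin (p + 1) => -MvPolynomial.X (Fin.castLE (by omega) l), ?_, ?_⟩
    · intro h
      exact one_ne_zero (congrFun h 0)
    · funext j
      simp only [Matrix.mulVec, dotProduct, A, Matrix.of_apply, Fin.sum_univ_succ (n := p + 1),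
        Fin.cons_zero, Fin.cons_succ, Pi.zero_apply]
      rw [lin_eq_sum_castLE hp (ht j)]
      simp
  rw [Matrix.det_succ_column_zero] at hA
  rw [← hA]
  refine Finset.sum_congr rfl fun j _ => ?_
  congr 1
  rw [RingHom.map_det]
  rfl

theorem eta_mem {p : ℕ} (hp : p ≤ d) : eta K hp ∈ openCocycles K d (-(p + 1 : ℤ)) p := by
  rw [mem_openCocycles]
  refine ⟨fun t => ⟨1, 0, MvPolynomial.C (coeffMatrix hp t).det, MvPolynomial.isHomogeneous_C _ _,
    by push_cast; ring, ?_⟩, fun t ht => ?_⟩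
  · rw [eta, pow_one, smul_mul_assoc, inv_mul_cancel₀ (algebraMap_prod_lin_ne_zero t),
      ← Algebra.algebraMap_eq_smul_one]
    exact IsScalarTower.algebraMap_apply _ _ _ _
  · have h := congrArg (algebraMap (Coord K d) (Rat K d)) (sum_det_mul_lin hp ht)
    rw [map_sum, map_zero] at h
    have hne := algebraMap_prod_lin_ne_zero t
    rw [← mul_right_inj' hne, mul_zero, ← h, differential_apply, Finset.mul_sum]
    refine Finset.sum_congr rfl fun j _ => ?_
    have hj : algebraMap (Coord K d) (Rat K d) (∏ j, lin (t j).1) =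
        algebraMap _ _ (lin (t j).1) * algebraMap _ _ (∏ l, lin ((t ∘ j.succAbove) l).1) := by
      rw [Fin.prod_univ_succAbove _ j, map_mul]
      rfl
    have hj' := algebraMap_prod_lin_ne_zero (t ∘ j.succAbove)
    rw [zsmul_eq_mul, eta, hj, Algebra.smul_def, map_mul, map_mul, map_pow, map_neg, map_one]
    have e : algebraMap (Coord K d) (Rat K d)
        (MvPolynomial.C (coeffMatrix hp (t ∘ j.succAbove)).det) =
        algebraMap K (Rat K d) (coeffMatrix hp (t ∘ j.succAbove)).det :=
      (IsScalarTower.algebraMap_apply _ _ _ _).symm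
    rw [e, Int.cast_pow, Int.cast_neg, Int.cast_one]
    generalize algebraMap (Coord K d) (Rat K d) (∏ l, lin ((t ∘ j.succAbove) l).1) = P at hj' ⊢
    field_simp

theorem eta_std {p : ℕ} (hp : p ≤ d) :
    eta K hp (stdTuple K hp) = mon K (fun a => if (a : ℕ) ≤ p then -1 else 0) := by
  have h1 : coeffMatrix hp (stdTuple K hp) = 1 := by
    ext j a
    change (Pi.single (Fin.castLE _ j) 1 : Fin (d + 1) → K) (Fin.castLE _ a) = _
    rw [Pi.single_apply, Matrix.one_apply]
    simp only [Fin.castLE_inj, eq_comm]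
  have h2 := algebraMap_prod_coordForm (K := K) (fun j : Fin (p + 1) => Fin.castLE
    (by omega : p + 1 ≤ d + 1) j) 1
  rw [pow_one] at h2
  rw [eta, h1, Matrix.det_one, one_smul]
  change (algebraMap (Coord K d) (Rat K d) (∏ j, lin (coordForm K (Fin.castLE _ j)).1))⁻¹ = _
  rw [h2]
  refine inv_eq_of_mul_eq_one_left ?_
  rw [← mon_add, ← mon_zero]
  congr 1
  funext a
  simp only [Pi.add_apply, Finset.sum_apply, Nat.cast_one, one_smul, Pi.zero_apply]
  by_cases ha : (a : ℕ) ≤ p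
  · rw [if_pos ha, Finset.sum_eq_single ⟨a, by omega⟩]
    · have : Fin.castLE (by omega : p + 1 ≤ d + 1) ⟨a, by omega⟩ = a := rfl
      rw [this, Pi.single_eq_same]
      rfl
    · intro j _ hj
      rw [Pi.single_eq_of_ne]
      rintro rfl
      exact hj rfl
    · simp
  · rw [if_neg ha, Finset.sum_eq_zero, zero_add]
    intro j _
    rw [Pi.single_eq_of_ne]
    rintro rfl
    apply ha
    simp
    omega

theorem coeffMatrix_formAction {p : ℕ} (hp : p ≤ d) (g : GL (Fin (d + 1)) K)
    {t : Fin (p + 1) → LinForm K d} (ht : ∀ j, t j ∈ firstForms K d (p + 1)) :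
    coeffMatrix hp (formAction g ∘ t) = coeffMatrix hp t *
      (g.1.submatrix (Fin.castLE (by omega : p + 1 ≤ d + 1))
        (Fin.castLE (by omega))).transpose := by
  ext j a
  change (g.1.mulVec (t j).1) (Fin.castLE _ a) = _
  rw [Matrix.mul_apply]
  simp only [Matrix.mulVec, dotProduct]
  symm
  apply Finset.sum_of_injOn (Fin.castLE (by omega : p + 1 ≤ d + 1))
    (Fin.castLE_injective _).injOn
  · exact fun _ _ => Finset.mem_coe.mpr (Finset.mem_univ _)
  · intro c _ hc
    rw [ht j c, mul_zero]
    by_contra h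
    exact hc ⟨⟨c, by omega⟩, by simp, rfl⟩
  · exact fun _ _ => mul_comm _ _

/-- The substitution by `g` undoes `g⁻¹` in each linear form of the denominator. Only the numerator
changes, by the upper left minor of `g⁻¹`, as the forms involve only `X_0, …, X_p`. -/
theorem eta_equivariant (s : ℤ) {p : ℕ} (hp : p ≤ d) (g : GL (Fin (d + 1)) K)
    {t : Fin (p + 1) → LinForm K d} (ht : ∀ j, t j ∈ firstForms K d (p + 1)) :
    twistedAction s g (eta K hp (formAction g⁻¹ ∘ t)) =
      (((Matrix.GeneralLinearGroup.det g ^ s : Kˣ) : K) *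
        (g⁻¹.1.submatrix (Fin.castLE (by omega : p + 1 ≤ d + 1)) (Fin.castLE (by omega))).det) •
        eta K hp t := by
  rw [twistedAction_eq]
  have e : ∀ j, ratAction g (algebraMap (Coord K d) (Rat K d)
      (lin ((formAction g⁻¹ ∘ t) j).1)) = algebraMap _ _ (lin (t j).1) := by
    intro j
    rw [ratAction_lin]
    congr 2
    simp [formAction, Matrix.mulVec_mulVec]
  rw [eta, eta, map_smul, map_inv₀, map_prod, map_prod, map_prod]
  simp only [e]
  rw [coeffMatrix_formAction hp _ ht, Matrix.det_mul, Matrix.det_transpose, smul_smul, smul_smul]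
  congr 1
  ring

end Operators

/-! ### Regular functions -/

section RegularFunctions

variable {K : Type*} [Field K] {d : ℕ}

theorem value_mul (F G : RegularFunction K d) (g : GL (Fin (d + 1)) K) :
    (F * G).value g = F.value g * G.value g := map_mul _ _ _

theorem value_pow (F : RegularFunction K d) (k : ℕ) (g : GL (Fin (d + 1)) K) :
    (F ^ k).value g = F.value g ^ k := map_pow _ _ _

theorem value_entry (a b : Fin (d + 1)) (g : GL (Fin (d + 1)) K) :
    RegularFunction.value (MvPolynomial.X (Sum.inl (a, b))) g = g.1 a b := by
  simp [RegularFunction.value]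

theorem value_inverse_entry (a b : Fin (d + 1)) (g : GL (Fin (d + 1)) K) :
    RegularFunction.value (MvPolynomial.X (Sum.inr (a, b))) g = g⁻¹.1 a b := by
  simp [RegularFunction.value]

/-- The value at `1 + ε x`. -/
def dualValue (x : Gl K d) : RegularFunction K d →ₐ[K] DualNumber K :=
  MvPolynomial.aeval (Sum.elim
    (fun e => TrivSqZeroExt.inl ((1 : Gl K d) e.1 e.2) + TrivSqZeroExt.inr (x e.1 e.2))
    (fun e => TrivSqZeroExt.inl ((1 : Gl K d) e.1 e.2) - TrivSqZeroExt.inr (x e.1 e.2)))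

theorem dualValue_snd (F : RegularFunction K d) (x : Gl K d) :
    (dualValue x F).snd = F.derivAtOne x := rfl

theorem dualValue_fst (F : RegularFunction K d) (x : Gl K d) :
    (dualValue x F).fst = F.value 1 := by
  have : (TrivSqZeroExt.fstHom K K K).comp (dualValue x) = MvPolynomial.aeval
      (Sum.elim (fun e => (1 : GL (Fin (d + 1)) K).1 e.1 e.2)
        (fun e => (1 : GL (Fin (d + 1)) K)⁻¹.1 e.1 e.2)) := by
    apply MvPolynomial.algHom_ext
    rintro (e | e)
    · simp [dualValue]
    · simp [dualValue]
  exact DFunLike.congr_fun this F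

/-- Evaluation at `1 + ε x` is a ring homomorphism to the dual numbers; compare coefficients of `ε`.
-/
theorem derivAtOne_mul (F G : RegularFunction K d) (x : Gl K d) :
    (F * G).derivAtOne x = F.value 1 * G.derivAtOne x + F.derivAtOne x * G.value 1 := by
  rw [← dualValue_snd, map_mul, TrivSqZeroExt.snd_mul, dualValue_fst, dualValue_fst,
    dualValue_snd, dualValue_snd]
  simp [mul_comm]

theorem derivAtOne_pow (F : RegularFunction K d) (k : ℕ) (x : Gl K d) (h : F.value 1 = 1) :
    (F ^ k).derivAtOne x = k * F.derivAtOne x := by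
  induction k with
  | zero =>
    rw [pow_zero, ← dualValue_snd, map_one, TrivSqZeroExt.snd_one, Nat.cast_zero, zero_mul]
  | succ k ih =>
    rw [pow_succ, derivAtOne_mul, ih, h, value_pow, h]
    push_cast
    ring

theorem derivAtOne_entry (a b : Fin (d + 1)) (x : Gl K d) :
    RegularFunction.derivAtOne (MvPolynomial.X (Sum.inl (a, b))) x = x a b := by
  simp [RegularFunction.derivAtOne]

theorem derivAtOne_inverse_entry (a b : Fin (d + 1)) (x : Gl K d) :
    RegularFunction.derivAtOne (MvPolynomial.X (Sum.inr (a, b))) x = -x a b := by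
  simp [RegularFunction.derivAtOne]

theorem det_one_add_inr {m : ℕ} (y : Matrix (Fin m) (Fin m) K) :
    (Matrix.of fun a b => (TrivSqZeroExt.inl ((1 : Matrix (Fin m) (Fin m) K) a b) +
      TrivSqZeroExt.inr (y a b) : DualNumber K)).det =
      TrivSqZeroExt.inl 1 + TrivSqZeroExt.inr y.trace := by
  have h := Matrix.det_one_add_smul (DualNumber.eps : DualNumber K)
    (y.map (TrivSqZeroExt.inl : K → DualNumber K))
  rw [pow_two, DualNumber.eps_mul_eps, mul_zero, add_zero] at h
  have e : (Matrix.of fun a b => (TrivSqZeroExt.inl ((1 : Matrix (Fin m) (Fin m) K) a b) +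
      TrivSqZeroExt.inr (y a b) : DualNumber K)) =
      1 + (DualNumber.eps : DualNumber K) • y.map (TrivSqZeroExt.inl : K → DualNumber K) := by
    ext a b
    · simp [Matrix.one_apply]
      split_ifs <;> simp
    · simp [Matrix.one_apply]
      split_ifs <;> simp
  rw [e, h]
  ext
  · simp [Matrix.trace]
  · simp [Matrix.trace, TrivSqZeroExt.fst_sum]

/-! ### Determinants as regular functions and their derivatives at the identity -/

variable (K d) in
/-- The determinant of the upper left block of the inverse. -/
def blockDet {p : ℕ} (hp : p ≤ d) : RegularFunction K d :=
  (Matrix.of fun a b : Fin (p + 1) => (MvPolynomial.X (Sum.inr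
    (Fin.castLE (by omega : p + 1 ≤ d + 1) a, Fin.castLE (by omega : p + 1 ≤ d + 1) b)) :
      RegularFunction K d)).det

theorem value_blockDet {p : ℕ} (hp : p ≤ d) (g : GL (Fin (d + 1)) K) :
    (blockDet K d hp).value g = (g⁻¹.1.submatrix (Fin.castLE (by omega : p + 1 ≤ d + 1))
      (Fin.castLE (by omega))).det := by
  rw [blockDet, RegularFunction.value, RingHom.map_det]
  congr 1
  ext a b
  simp

/-- The block is taken from the inverse `1 - ε x`, whence the sign. -/
theorem derivAtOne_blockDet {p : ℕ} (hp : p ≤ d) (x : Gl K d) :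
    (blockDet K d hp).derivAtOne x =
      -∑ a : Fin (p + 1), x (Fin.castLE (by omega) a) (Fin.castLE (by omega) a) := by
  rw [blockDet, ← dualValue_snd, AlgHom.map_det]
  have h := det_one_add_inr (-(x.submatrix (Fin.castLE (by omega : p + 1 ≤ d + 1))
    (Fin.castLE (by omega : p + 1 ≤ d + 1))))
  have e : (dualValue x).mapMatrix (Matrix.of fun a b : Fin (p + 1) => (MvPolynomial.X (Sum.inr
      (Fin.castLE (by omega : p + 1 ≤ d + 1) a, Fin.castLE (by omega : p + 1 ≤ d + 1) b)) :
      RegularFunction K d)) = Matrix.of fun a b =>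
      (TrivSqZeroExt.inl ((1 : Matrix (Fin (p + 1)) (Fin (p + 1)) K) a b) +
      TrivSqZeroExt.inr ((-(x.submatrix (Fin.castLE (by omega : p + 1 ≤ d + 1))
        (Fin.castLE (by omega : p + 1 ≤ d + 1)))) a b) : DualNumber K) := by
    refine Matrix.ext fun a b => ?_
    simp [dualValue, Matrix.one_apply, sub_eq_add_neg]
  rw [e, h]
  simp [Matrix.trace]

variable (K d) in
/-- The regular function `det^s`. -/
def detPow (s : ℤ) : RegularFunction K d :=
  if 0 ≤ s then (Matrix.of fun a b => (MvPolynomial.X (Sum.inl (a, b)) : RegularFunction K d)).det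
    ^ s.toNat
  -- Negative powers of the determinant are polynomial in the entries of the inverse matrix.
  else (Matrix.of fun a b => (MvPolynomial.X (Sum.inr (a, b)) : RegularFunction K d)).det
    ^ (-s).toNat

theorem value_detPow (s : ℤ) (g : GL (Fin (d + 1)) K) :
    (detPow K d s).value g = ((Matrix.GeneralLinearGroup.det g ^ s : Kˣ) : K) := by
  have h1 : ∀ g : GL (Fin (d + 1)) K, RegularFunction.value (Matrix.of fun a b =>
      (MvPolynomial.X (Sum.inl (a, b)) : RegularFunction K d)).det g =
        (Matrix.GeneralLinearGroup.det g : K) := by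
    intro g
    rw [RegularFunction.value, RingHom.map_det]
    congr 1
    ext a b
    simp
  have h2 : RegularFunction.value (Matrix.of fun a b =>
      (MvPolynomial.X (Sum.inr (a, b)) : RegularFunction K d)).det g =
        (Matrix.GeneralLinearGroup.det g⁻¹ : K) := by
    rw [RegularFunction.value, RingHom.map_det]
    congr 1
    ext a b
    simp
  rw [detPow]
  split_ifs with h
  · rw [value_pow, h1, ← Units.val_pow_eq_pow_val]
    congr 1
    conv_rhs => rw [← Int.toNat_of_nonneg h, zpow_natCast]
  · rw [value_pow, h2, ← Units.val_pow_eq_pow_val]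
    congr 1
    have : s = -((-s).toNat : ℤ) := by omega
    conv_rhs => rw [this, zpow_neg, zpow_natCast]
    rw [map_inv, inv_pow]

theorem derivAtOne_detPow (s : ℤ) (x : Gl K d) :
    (detPow K d s).derivAtOne x = (s : K) * x.trace := by
  have h1 : RegularFunction.derivAtOne (Matrix.of fun a b =>
      (MvPolynomial.X (Sum.inl (a, b)) : RegularFunction K d)).det x = x.trace := by
    rw [← dualValue_snd, AlgHom.map_det]
    have h := det_one_add_inr x
    have e : (dualValue x).mapMatrix (Matrix.of fun a b =>
        (MvPolynomial.X (Sum.inl (a, b)) : RegularFunction K d)) = Matrix.of fun a b =>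
        (TrivSqZeroExt.inl ((1 : Matrix (Fin (d + 1)) (Fin (d + 1)) K) a b) +
        TrivSqZeroExt.inr (x a b) : DualNumber K) := by
      refine Matrix.ext fun a b => ?_
      simp [dualValue]
    rw [e, h]
    simp
  have h2 : RegularFunction.derivAtOne (Matrix.of fun a b =>
      (MvPolynomial.X (Sum.inr (a, b)) : RegularFunction K d)).det x = -x.trace := by
    rw [← dualValue_snd, AlgHom.map_det]
    have h := det_one_add_inr (-x)
    have e : (dualValue x).mapMatrix (Matrix.of fun a b =>
        (MvPolynomial.X (Sum.inr (a, b)) : RegularFunction K d)) = Matrix.of fun a b =>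
        (TrivSqZeroExt.inl ((1 : Matrix (Fin (d + 1)) (Fin (d + 1)) K) a b) +
        TrivSqZeroExt.inr ((-x) a b) : DualNumber K) := by
      refine Matrix.ext fun a b => ?_
      simp [dualValue, sub_eq_add_neg]
    rw [e, h]
    simp
  have v1 : RegularFunction.value (Matrix.of fun a b =>
      (MvPolynomial.X (Sum.inl (a, b)) : RegularFunction K d)).det 1 = 1 := by
    have := value_detPow (K := K) (d := d) 1 1
    simpa [detPow] using this
  have v2 : RegularFunction.value (Matrix.of fun a b =>
      (MvPolynomial.X (Sum.inr (a, b)) : RegularFunction K d)).det 1 = 1 := by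
    have := value_detPow (K := K) (d := d) (-1) 1
    simpa [detPow] using this
  rw [detPow]
  split_ifs with h
  · rw [derivAtOne_pow _ _ _ v1, h1]
    congr 1
    exact_mod_cast congrArg (Int.cast : ℤ → K) (Int.toNat_of_nonneg h)
  · rw [derivAtOne_pow _ _ _ v2, h2]
    have : (s : K) = -(((-s).toNat : ℤ) : K) := by
      rw [Int.toNat_of_nonneg (by omega)]
      push_cast
      ring
    rw [this]
    push_cast
    ring

end RegularFunctions

/-! ### Algebraic cocycles -/

section Algebraic

variable {K : Type*} [Field K] {d : ℕ}

/-- Cocycles on which the parabolic subgroup acts algebraically, with the expected derivative. -/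
structure IsAlgebraic (s n : ℤ) {p : ℕ} (hp : p ≤ d) (b : Family K d p) : Prop where
  mem : b ∈ openCocycles K d n p
  algebraic : ∃ (ι : Type) (_ : Fintype ι) (w : ι → Family K d p) (F : ι → RegularFunction K d),
    (∀ j, w j ∈ openCocycles K d n p) ∧
    (∀ (g : parabolic K d (p + 1)) (t : Fin (p + 1) → LinForm K d),
      (∀ j, t j ∈ firstForms K d (p + 1)) →
      twistedAction s g.1 (b (formAction g.1⁻¹ ∘ t)) = ∑ j, (F j).value g.1 • w j t) ∧
    -- The derivative is compared only at `(X_0, …, X_p)` and modulo regular terms, which is all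
    -- that the class in `H̃` sees.
    ∀ x ∈ parabolicLie K d (p + 1), twistedLie s x (b (stdTuple K hp)) -
      ∑ j, (F j).derivAtOne x • w j (stdTuple K hp) ∈ monSpan K (regularSet d p)

variable {s n : ℤ} {p : ℕ} {hp : p ≤ d} {b b' : Family K d p}

theorem stdTuple_mem (hp : p ≤ d) (j : Fin (p + 1)) :
    stdTuple K hp j ∈ firstForms K d (p + 1) := coordTuple_mem_firstForms hp id j

/-- Needed for the product rule: when a new factor is differentiated at the identity, the old sum
collapses to `b` itself. -/
theorem sum_value_one {ι : Type} [Fintype ι] {w : ι → Family K d p} {F : ι → RegularFunction K d}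
    (h : ∀ (g : parabolic K d (p + 1)) (t : Fin (p + 1) → LinForm K d),
      (∀ j, t j ∈ firstForms K d (p + 1)) →
      twistedAction s g.1 (b (formAction g.1⁻¹ ∘ t)) = ∑ j, (F j).value g.1 • w j t)
    {t : Fin (p + 1) → LinForm K d} (ht : ∀ j, t j ∈ firstForms K d (p + 1)) :
    ∑ j, (F j).value 1 • w j t = b t := by
  have := h 1 t ht
  rw [OneMemClass.coe_one, inv_one, formAction_one, map_one] at this
  exact this.symm

theorem IsAlgebraic.zero : IsAlgebraic s n hp (0 : Family K d p) where
  mem := Submodule.zero_mem _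
  algebraic := ⟨Empty, inferInstance, fun _ => 0, fun _ => 0, fun _ => Submodule.zero_mem _,
    fun g t _ => by simp, fun x _ => by simp⟩

theorem IsAlgebraic.add (hb : IsAlgebraic s n hp b) (hb' : IsAlgebraic s n hp b') :
    IsAlgebraic s n hp (b + b') where
  mem := Submodule.add_mem _ hb.mem hb'.mem
  algebraic := by
    obtain ⟨ι, _, w, F, hw, hg, hx⟩ := hb.algebraic
    obtain ⟨ι', _, w', F', hw', hg', hx'⟩ := hb'.algebraic
    refine ⟨ι ⊕ ι', inferInstance, Sum.elim w w', Sum.elim F F', ?_, fun g t ht => ?_,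
      fun x hxx => ?_⟩
    · rintro (j | j)
      · exact hw j
      · exact hw' j
    · rw [Fintype.sum_sum_type]
      simp only [Sum.elim_inl, Sum.elim_inr]
      rw [← hg g t ht, ← hg' g t ht, ← map_add]
      rfl
    · rw [Fintype.sum_sum_type]
      simp only [Sum.elim_inl, Sum.elim_inr]
      rw [Pi.add_apply, map_add, add_sub_add_comm]
      exact Submodule.add_mem _ (hx x hxx) (hx' x hxx)

theorem IsAlgebraic.smul (c : K) (hb : IsAlgebraic s n hp b) : IsAlgebraic s n hp (c • b) where
  mem := Submodule.smul_mem _ _ hb.mem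
  algebraic := by
    obtain ⟨ι, _, w, F, hw, hg, hx⟩ := hb.algebraic
    refine ⟨ι, inferInstance, fun j => c • w j, F, fun j => Submodule.smul_mem _ _ (hw j),
      fun g t ht => ?_, fun x hxx => ?_⟩
    · rw [Pi.smul_apply, map_smul, hg g t ht, Finset.smul_sum]
      exact Finset.sum_congr rfl fun j _ => smul_comm _ _ _
    · have e : ∑ j, (F j).derivAtOne x • (c • w j) (stdTuple K hp) =
          c • ∑ j, (F j).derivAtOne x • w j (stdTuple K hp) := by
        rw [Finset.smul_sum]
        refine Finset.sum_congr rfl fun j _ => ?_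
        rw [Pi.smul_apply, smul_comm]
      rw [e, Pi.smul_apply, map_smul, ← smul_sub]
      exact Submodule.smul_mem _ _ (hx x hxx)

/-- Since `g X_a = ∑ g_{ca} X_c`, the new coefficients are products of entries of `g` with the old
ones, and their derivatives match the Leibniz rule for the vector field. -/
theorem IsAlgebraic.mulX (a : Fin (d + 1)) (hb : IsAlgebraic s n hp b) :
    IsAlgebraic s (n + 1) hp (familyMap (mulX K a) id p b) where
  mem := mulX_mem a hb.mem
  algebraic := by
    classical
    obtain ⟨ι, _, w, F, hw, hg, hx⟩ := hb.algebraic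
    refine ⟨ι × Fin (d + 1), inferInstance, fun j => familyMap (ProjLine.mulX K j.2) id p (w j.1),
      fun j => MvPolynomial.X (Sum.inl (j.2, a)) * F j.1, fun j => mulX_mem _ (hw _),
      fun g t ht => ?_, fun x hxx => ?_⟩
    · change twistedAction s g.1 (ratX K a * b (formAction g.1⁻¹ ∘ t)) =
        ∑ j : ι × Fin (d + 1), RegularFunction.value _ _ • (ratX K j.2 * w j.1 t)
      rw [twistedAction_mul, hg g t ht, ratAction_ratX, Fintype.sum_prod_type, Finset.mul_sum]
      refine Finset.sum_congr rfl fun j _ => ?_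
      rw [Finset.sum_mul]
      refine Finset.sum_congr rfl fun c _ => ?_
      rw [value_mul, value_entry, smul_mul_smul_comm]
    · change twistedLie s x (ratX K a * b (stdTuple K hp)) - ∑ j : ι × Fin (d + 1),
        RegularFunction.derivAtOne _ _ • (ratX K j.2 * w j.1 (stdTuple K hp)) ∈ _
      have e : ∑ j : ι × Fin (d + 1), RegularFunction.derivAtOne
          (MvPolynomial.X (Sum.inl (j.2, a)) * F j.1) x • (ratX K j.2 * w j.1 (stdTuple K hp)) =
          (∑ c, x c a • ratX K c) * b (stdTuple K hp) +
            ratX K a * ∑ j, (F j).derivAtOne x • w j (stdTuple K hp) := by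
        rw [← sum_value_one hg (stdTuple_mem hp), Fintype.sum_prod_type, Finset.mul_sum,
          Finset.mul_sum, ← Finset.sum_add_distrib]
        refine Finset.sum_congr rfl fun j _ => ?_
        have h1 : ratX K a * ((F j).derivAtOne x • w j (stdTuple K hp)) = ∑ c,
            (if c = a then (F j).derivAtOne x else 0) • (ratX K c * w j (stdTuple K hp)) := by
          simp
        rw [h1, Finset.sum_mul, ← Finset.sum_add_distrib]
        refine Finset.sum_congr rfl fun c _ => ?_
        rw [derivAtOne_mul, value_entry, derivAtOne_entry, smul_mul_smul_comm, ← add_smul,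
          Units.val_one, Matrix.one_apply]
        congr 1
        dsimp only
        split_ifs <;> ring
      rw [e, twistedLie_mul, add_sub_add_left_eq_sub, ← mul_sub]
      exact mulX_regular a (hx x hxx)

/-- As for `X_a`, with entries of `g⁻¹` in place of those of `g`; the commutator of the vector field
with `∂/∂X_a` supplies the minus sign. -/
theorem IsAlgebraic.partialX (a : Fin (d + 1)) (hb : IsAlgebraic s n hp b) :
    IsAlgebraic s (n - 1) hp (familyMap (partialX K a) id p b) where
  mem := partialX_mem a hb.mem
  algebraic := by
    classical
    obtain ⟨ι, _, w, F, hw, hg, hx⟩ := hb.algebraic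
    refine ⟨ι × Fin (d + 1), inferInstance,
      fun j => familyMap (ProjLine.partialX K j.2) id p (w j.1),
      fun j => MvPolynomial.X (Sum.inr (a, j.2)) * F j.1, fun j => partialX_mem _ (hw _),
      fun g t ht => ?_, fun x hxx => ?_⟩
    · change twistedAction s g.1 (ratPderiv K a (b (formAction g.1⁻¹ ∘ t))) =
        ∑ j : ι × Fin (d + 1), RegularFunction.value _ _ • (ratPderiv K j.2 (w j.1 t))
      rw [twistedAction_ratPderiv, hg g t ht, Fintype.sum_prod_type_right]
      refine Finset.sum_congr rfl fun c _ => ?_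
      rw [map_sum, Finset.smul_sum]
      refine Finset.sum_congr rfl fun j _ => ?_
      rw [value_mul, value_inverse_entry, Derivation.map_smul, smul_smul]
    · change twistedLie s x (ratPderiv K a (b (stdTuple K hp))) - ∑ j : ι × Fin (d + 1),
        RegularFunction.derivAtOne _ _ • (ratPderiv K j.2 (w j.1 (stdTuple K hp))) ∈ _
      have e : ∑ j : ι × Fin (d + 1), RegularFunction.derivAtOne
          (MvPolynomial.X (Sum.inr (a, j.2)) * F j.1) x •
            (ratPderiv K j.2 (w j.1 (stdTuple K hp))) =
          ratPderiv K a (∑ j, (F j).derivAtOne x • w j (stdTuple K hp)) -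
            ∑ c, x a c • ratPderiv K c (b (stdTuple K hp)) := by
        rw [← sum_value_one hg (stdTuple_mem hp), Fintype.sum_prod_type_right]
        have h1 : ratPderiv K a (∑ j, (F j).derivAtOne x • w j (stdTuple K hp)) = ∑ c, ∑ j,
            (if c = a then (F j).derivAtOne x else 0) • ratPderiv K c (w j (stdTuple K hp)) := by
          rw [Finset.sum_comm, map_sum]
          refine Finset.sum_congr rfl fun j _ => ?_
          rw [Derivation.map_smul]
          simp
        rw [h1, ← Finset.sum_sub_distrib]
        refine Finset.sum_congr rfl fun c _ => ?_
        rw [map_sum, Finset.smul_sum, ← Finset.sum_sub_distrib]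
        refine Finset.sum_congr rfl fun j _ => ?_
        rw [derivAtOne_mul, value_inverse_entry, derivAtOne_inverse_entry, Derivation.map_smul,
          smul_smul, ← sub_smul, inv_one, Units.val_one, Matrix.one_apply]
        congr 1
        simp only [eq_comm (a := a)]
        split_ifs <;> simp [sub_eq_add_neg]
      rw [e, twistedLie_ratPderiv, sub_sub_sub_cancel_right, ← map_sub]
      exact partialX_regular a (hx x hxx)

theorem IsAlgebraic.eta (s : ℤ) (hp : p ≤ d) :
    IsAlgebraic s (-(p + 1 : ℤ)) hp (eta K hp) where
  mem := eta_mem hp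
  algebraic := by
    refine ⟨Unit, inferInstance, fun _ => ProjLine.eta K hp,
      fun _ => detPow K d s * blockDet K d hp,
      fun _ => eta_mem hp, fun g t ht => ?_, fun x hx => ?_⟩
    · rw [eta_equivariant s hp g.1 ht, Finset.univ_unique, Finset.sum_singleton, value_mul,
        value_detPow, value_blockDet]
    · have hv : (blockDet K d hp).value 1 = 1 := by
        rw [value_blockDet, inv_one, Units.val_one, Matrix.submatrix_one _
          (Fin.castLE_injective _), Matrix.det_one]
      rw [Finset.univ_unique, Finset.sum_singleton, derivAtOne_mul, hv, value_detPow,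
        derivAtOne_detPow, derivAtOne_blockDet]
      dsimp only
      rw [eta_std]
      set m₀ : Fin (d + 1) → ℤ := fun a => if (a : ℕ) ≤ p then -1 else 0 with hm₀
      have e1 : -∑ a : Fin (p + 1), x (Fin.castLE (by omega) a) (Fin.castLE (by omega) a) =
          ∑ b, x b b * (m₀ b : K) := by
        rw [← Finset.sum_neg_distrib]
        apply Finset.sum_of_injOn (Fin.castLE (by omega : p + 1 ≤ d + 1))
          (Fin.castLE_injective _).injOn
        · exact fun _ _ => Finset.mem_coe.mpr (Finset.mem_univ _)
        · intro c _ hc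
          have : ¬ (c : ℕ) ≤ p := fun h => hc ⟨⟨c, by omega⟩, by simp, rfl⟩
          simp [hm₀, this]
        · intro a _
          have : (a : ℕ) ≤ p := by omega
          simp [hm₀, this]
      rw [e1, twistedLie_apply, map_one, one_zpow, Units.val_one, one_mul, mul_one, add_smul,
        add_sub_add_right_eq_sub, Finset.sum_smul, ← Finset.sum_sub_distrib]
      refine Submodule.sum_mem _ fun c _ => ?_
      have e2 : (x c c * (m₀ c : K)) • mon K m₀ =
          ∑ a, (if a = c then x c c * (m₀ c : K) else 0) • mon K m₀ := by simp
      rw [e2, Finset.sum_mul, ← Finset.sum_sub_distrib]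
      refine Submodule.sum_mem _ fun a _ => ?_
      rw [ratPderiv_mon, smul_mul_smul_comm, mon_add_single]
      -- Diagonal terms cancel against the derivative of the character. An off-diagonal `X_a ∂/∂X_c`
      -- gives a regular monomial if `a, c ≤ p`, has coefficient `x_{ac} = 0` if `c ≤ p < a`, and
      -- kills the monomial if `c > p`.
      by_cases hac : a = c
      · subst hac
        rw [if_pos rfl, sub_add_cancel, sub_self]
        exact Submodule.zero_mem _
      · rw [if_neg hac, zero_smul, sub_zero]
        by_cases hc : (c : ℕ) ≤ p
        · by_cases ha : (a : ℕ) ≤ p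
          · refine Submodule.smul_mem _ _ (mon_mem ⟨a, ha, ?_⟩)
            simp [hm₀, ha, Pi.single_eq_of_ne hac]
          · rw [hx a c (by omega) (by omega), zero_mul, zero_smul]
            exact Submodule.zero_mem _
        · have : m₀ c = 0 := if_neg hc
          rw [this, Int.cast_zero, mul_zero, zero_smul]
          exact Submodule.zero_mem _

/-- Every monomial which is negative exactly at `X_0, …, X_p` is represented by an algebraic
cocycle. -/
theorem exists_isAlgebraic_mon [CharZero K] (s : ℤ) (hp : p ≤ d) (k : ℕ) : ∀ (n : ℤ)
    (m : Fin (d + 1) → ℤ), ∑ a, m a = n → (∀ a : Fin (d + 1), m a < 0 ↔ (a : ℕ) ≤ p) →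
    ∑ a : Fin (d + 1), (if (a : ℕ) ≤ p then -m a - 1 else m a) = k →
    ∃ b : Family K d p, IsAlgebraic s n hp b ∧ b (stdTuple K hp) = mon K m := by
  have nn : ∀ m : Fin (d + 1) → ℤ, (∀ a : Fin (d + 1), m a < 0 ↔ (a : ℕ) ≤ p) →
      ∀ a ∈ (Finset.univ : Finset (Fin (d + 1))),
      0 ≤ (if (a : ℕ) ≤ p then -m a - 1 else m a : ℤ) := by
    intro m hm a _
    have := hm a
    split_ifs with h <;> omega
  induction k with
  | zero =>
    intro n m hn hm hk
    rw [Nat.cast_zero, Finset.sum_eq_zero_iff_of_nonneg (nn m hm)] at hk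
    have e : m = fun a : Fin (d + 1) => if (a : ℕ) ≤ p then -1 else 0 := by
      funext a
      have := hk a (Finset.mem_univ a)
      split_ifs at this ⊢ <;> omega
    refine ⟨eta K hp, ?_, by rw [eta_std, e]⟩
    have hn' : n = -(p + 1 : ℤ) := by
      rw [← hn, e]
      have : ∑ a : Fin (d + 1), (if (a : ℕ) ≤ p then -1 else 0 : ℤ) =
          ∑ a : Fin (p + 1), (-1 : ℤ) := by
        symm
        apply Finset.sum_of_injOn (Fin.castLE (by omega : p + 1 ≤ d + 1))
          (Fin.castLE_injective _).injOn
        · exact fun _ _ => Finset.mem_coe.mpr (Finset.mem_univ _)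
        · intro c _ hc
          rw [if_neg]
          exact fun h => hc ⟨⟨c, by omega⟩, by simp, rfl⟩
        · intro a _
          rw [if_pos]
          simp
          omega
      rw [this]
      simp
    rw [hn']
    exact IsAlgebraic.eta s hp
  | succ k ih =>
    intro n m hn hm hk
    obtain ⟨c, -, hc⟩ : ∃ c ∈ (Finset.univ : Finset (Fin (d + 1))),
        0 < (if (c : ℕ) ≤ p then -m c - 1 else m c : ℤ) := by
      by_contra hcon
      push Not at hcon
      have := Finset.sum_nonpos hcon
      omega
    by_cases hcp : (c : ℕ) ≤ p
    -- A pole of order above one is obtained by `∂/∂X_c` from the monomial with exponent `m c + 1`,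
    -- which is still negative, so one may divide by it.
    · rw [if_pos hcp] at hc
      obtain ⟨m', hm'⟩ : ∃ m' : Fin (d + 1) → ℤ, m' = m + Pi.single c 1 := ⟨_, rfl⟩
      have hval : ∀ a : Fin (d + 1), m' a = m a + if a = c then 1 else 0 := by
        intro a; rw [hm', Pi.add_apply, Pi.single_apply]
      obtain ⟨b, hb, hb'⟩ := ih (n + 1) m'
        (by simp only [hval, Finset.sum_add_distrib]; simp [hn])
        (by
          intro a
          have := hm a
          rw [hval]
          split_ifs with h
          · subst h; omega
          · simpa using this)
        (by
          have e : ∀ a : Fin (d + 1), (if (a : ℕ) ≤ p then -m' a - 1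
              else m' a : ℤ) =
              (if (a : ℕ) ≤ p then -m a - 1 else m a) - if a = c then 1 else 0 := by
            intro a
            rw [hval]
            split_ifs with h1 h2 h2
            · ring
            · ring
            · subst h2; exact absurd hcp h1
            · ring
          rw [Finset.sum_congr rfl fun a _ => e a, Finset.sum_sub_distrib, hk]
          simp)
      have hne : ((m' c : ℤ) : K) ≠ 0 := by
        rw [Int.cast_ne_zero, hval, if_pos rfl]
        omega
      refine ⟨((m' c : ℤ) : K)⁻¹ • familyMap (partialX K c) id p b, ?_, ?_⟩
      · have := (hb.partialX c).smul ((m' c : ℤ) : K)⁻¹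
        rwa [add_sub_cancel_right] at this
      · change ((m' c : ℤ) : K)⁻¹ • ratPderiv K c (b (stdTuple K hp)) = _
        rw [hb', ratPderiv_mon, smul_smul, inv_mul_cancel₀ hne, one_smul, hm',
          add_sub_cancel_right]
    -- A positive exponent outside `0, …, p` is obtained by multiplying with `X_c`.
    · rw [if_neg hcp] at hc
      obtain ⟨m', hm'⟩ : ∃ m' : Fin (d + 1) → ℤ, m' = m - Pi.single c 1 := ⟨_, rfl⟩
      have hval : ∀ a : Fin (d + 1), m' a = m a - if a = c then 1 else 0 := by
        intro a; rw [hm', Pi.sub_apply, Pi.single_apply]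
      obtain ⟨b, hb, hb'⟩ := ih (n - 1) m'
        (by simp only [hval, Finset.sum_sub_distrib]; simp [hn])
        (by
          intro a
          have := hm a
          rw [hval]
          split_ifs with h
          · subst h; omega
          · simpa using this)
        (by
          have e : ∀ a : Fin (d + 1), (if (a : ℕ) ≤ p then -m' a - 1
              else m' a : ℤ) =
              (if (a : ℕ) ≤ p then -m a - 1 else m a) - if a = c then 1 else 0 := by
            intro a
            rw [hval]
            split_ifs with h1 h2 h2
            · subst h2; exact absurd h1 hcp
            · ring
            · ring
            · ring
          rw [Finset.sum_congr rfl fun a _ => e a, Finset.sum_sub_distrib, hk]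
          simp)
      refine ⟨familyMap (mulX K c) id p b, ?_, ?_⟩
      · have := hb.mulX c
        rwa [sub_add_cancel] at this
      · change ratX K c * b (stdTuple K hp) = _
        rw [hb', mon_add_single, hm', sub_add_cancel]

end Algebraic

/-! ### The actions in terms of cocycles -/

section Classes

variable {K : Type*} [Field K] {d : ℕ} {n s : ℤ} {p : ℕ}

theorem theta_eq_iff (hp : p + 1 ≤ d) (b b' : openCocycles K d n p) :
    theta n p b = theta n p b' ↔ b.1 (stdTuple K (by omega : p ≤ d)) -
      b'.1 (stdTuple K (by omega : p ≤ d)) ∈ monSpan K (regularSet d p) := by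
  rw [← sub_eq_zero, ← map_sub, theta_eq_zero_iff hp]
  rfl

theorem std_mem_poleSet (hp : p ≤ d) {b : Family K d p} (hb : b ∈ openCocycles K d n p) :
    b (stdTuple K hp) ∈ monSpan K (poleSet d n
      (Set.range (Fin.castLE (by omega : p + 1 ≤ d + 1)))) :=
  (mem_sections_coordTuple hp id).mp ((mem_openCocycles.mp hb).1 _)

variable (d) in
/-- The exponents of total degree `n` which are negative exactly at `0, …, p`. -/
def cone (n : ℤ) (p : ℕ) : Set (Fin (d + 1) → ℤ) :=
  {m | ∑ a, m a = n ∧ ∀ a : Fin (d + 1), m a < 0 ↔ (a : ℕ) ≤ p}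

theorem mem_cone_of_poleSet (hp : p ≤ d) {m : Fin (d + 1) → ℤ}
    (hm : m ∈ poleSet d n (Set.range (Fin.castLE (by omega : p + 1 ≤ d + 1))))
    (hr : m ∉ regularSet d p) : m ∈ cone d n p := by
  refine ⟨hm.1, fun a => ⟨fun ha => ?_, fun ha => ?_⟩⟩
  · by_contra hap
    refine absurd (hm.2 a ?_) (not_le.mpr ha)
    rintro ⟨c, rfl⟩
    exact hap (by simp; omega)
  · by_contra h
    exact hr ⟨a, ha, not_lt.mp h⟩

theorem notMem_regularSet_of_cone {m : Fin (d + 1) → ℤ} (hm : m ∈ cone d n p) :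
    m ∉ regularSet d p := by
  rintro ⟨a, ha, h⟩
  exact absurd ((hm.2 a).mpr ha) (not_lt.mpr h)

theorem exists_isAlgebraic_of_cone [CharZero K] (s : ℤ) (hp : p ≤ d) {m : Fin (d + 1) → ℤ}
    (hm : m ∈ cone d n p) :
    ∃ b : Family K d p, IsAlgebraic s n hp b ∧ b (stdTuple K hp) = mon K m := by
  refine exists_isAlgebraic_mon s hp
    (∑ a : Fin (d + 1), (if (a : ℕ) ≤ p then -m a - 1 else m a)).toNat n m hm.1 hm.2 ?_
  rw [Int.toNat_of_nonneg]
  refine Finset.sum_nonneg fun a _ => ?_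
  have := hm.2 a
  split_ifs with h <;> omega

/-- Split the value at `(X_0, …, X_p)` into monomials: regular ones contribute nothing to the class,
and those in the cone come from `eta`. -/
theorem exists_isAlgebraic [CharZero K] (s : ℤ) (hp : p + 1 ≤ d) (z : HTilde K d n (p + 1)) :
    ∃ (b : Family K d p) (hb : IsAlgebraic s n (by omega : p ≤ d) b),
      theta n p ⟨b, hb.mem⟩ = z := by
  have hp' : p ≤ d := by omega
  have key : ∀ q ∈ monSpan K (poleSet d n (Set.range (Fin.castLE (by omega : p + 1 ≤ d + 1)))),
      ∃ b : Family K d p, IsAlgebraic s n hp' b ∧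
        b (stdTuple K hp') - q ∈ monSpan K (regularSet d p) := by
    intro q hq
    induction hq using Submodule.span_induction with
    | mem q hq =>
      obtain ⟨m, hm, rfl⟩ := hq
      by_cases hr : m ∈ regularSet d p
      · exact ⟨0, IsAlgebraic.zero, by
          simpa using Submodule.neg_mem _ (mon_mem (K := K) hr)⟩
      · obtain ⟨b, hb, e⟩ := exists_isAlgebraic_of_cone (K := K) s hp'
          (mem_cone_of_poleSet hp' hm hr)
        exact ⟨b, hb, by rw [e, sub_self]; exact Submodule.zero_mem _⟩
    | zero => exact ⟨0, IsAlgebraic.zero, by simp⟩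
    | add q q' _ _ h h' =>
      obtain ⟨b, hb, e⟩ := h
      obtain ⟨b', hb', e'⟩ := h'
      refine ⟨b + b', hb.add hb', ?_⟩
      rw [Pi.add_apply, add_sub_add_comm]
      exact Submodule.add_mem _ e e'
    | smul c q _ h =>
      obtain ⟨b, hb, e⟩ := h
      refine ⟨c • b, hb.smul c, ?_⟩
      rw [Pi.smul_apply, ← smul_sub]
      exact Submodule.smul_mem _ c e
  obtain ⟨b₀, rfl⟩ := theta_surjective n p z
  obtain ⟨b, hb, e⟩ := key _ (std_mem_poleSet hp' b₀.2)
  exact ⟨b, hb, (theta_eq_iff hp _ _).mpr e⟩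

theorem groupAction_theta (g : parabolic K d (p + 1)) (b : openCocycles K d n p) :
    groupAction n s (p + 1) g (theta n p b) =
      theta n p ⟨familyMap (twistedAction s g.1) (formAction g.1⁻¹) p b.1,
        familyMap_mem_openCocycles (group_admissible n s (p + 1) g) b.2⟩ :=
  tildeMap_theta _ b

theorem lieAction_theta (x : Gl K d) (b : openCocycles K d n p) :
    lieAction n s (p + 1) x (theta n p b) =
      theta n p ⟨familyMap (twistedLie s x) id p b.1,
        familyMap_mem_openCocycles (lie_admissible n s (firstForms K d (p + 1)) x) b.2⟩ :=
  tildeMap_theta _ b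

/-- The action of the parabolic subgroup on `H̃` is algebraic, with differential the action of its
Lie algebra. -/
theorem exists_regularFunction [CharZero K] (n s : ℤ) (hp : p + 1 ≤ d)
    (z : HTilde K d n (p + 1)) :
    ∃ (k : ℕ) (w : Fin k → HTilde K d n (p + 1)) (F : Fin k → RegularFunction K d),
      (∀ g : parabolic K d (p + 1), groupAction n s (p + 1) g z = ∑ j, (F j).value g.1 • w j) ∧
      ∀ x ∈ parabolicLie K d (p + 1),
        lieAction n s (p + 1) x z = ∑ j, (F j).derivAtOne x • w j := by
  obtain ⟨b, hb, rfl⟩ := exists_isAlgebraic s hp z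
  obtain ⟨ι, _, w, F, hw, hg, hx⟩ := hb.algebraic
  let e := Fintype.equivFin ι
  have comb : ∀ c : ι → K, ∑ j, c (e.symm j) • theta n p ⟨w (e.symm j), hw _⟩ =
      theta n p (∑ j, c j • ⟨w j, hw j⟩) := by
    intro c
    rw [map_sum, ← e.symm.sum_comp]
    simp only [map_smul]
  have std : ∀ c : ι → K,
      (∑ j, c j • (⟨w j, hw j⟩ : openCocycles K d n p)).1 (stdTuple K (by omega : p ≤ d)) =
        ∑ j, c j • w j (stdTuple K (by omega : p ≤ d)) := by
    intro c
    rw [Submodule.coe_sum, Finset.sum_apply]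
    rfl
  refine ⟨Fintype.card ι, fun j => theta n p ⟨w (e.symm j), hw _⟩, fun j => F (e.symm j),
    fun g => ?_, fun x hxx => ?_⟩
  · rw [comb fun j => (F j).value g.1, groupAction_theta, theta_eq_iff hp, std]
    have := hg g _ (stdTuple_mem (K := K) (by omega : p ≤ d))
    rw [← this]
    exact (sub_self (twistedAction s g.1 _)).symm ▸ Submodule.zero_mem _
  · rw [comb fun j => (F j).derivAtOne x, lieAction_theta, theta_eq_iff hp, std]
    exact hx x hxx

theorem groupAction_lieAction (n s : ℤ) (g : parabolic K d (p + 1)) (x : Gl K d)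
    (z : HTilde K d n (p + 1)) :
    groupAction n s (p + 1) g (lieAction n s (p + 1) x z) =
      lieAction n s (p + 1) (g.1.1 * x * g.1⁻¹.1) (groupAction n s (p + 1) g z) := by
  obtain ⟨b, rfl⟩ := theta_surjective n p z
  have h₁ := (congrArg (groupAction n s (p + 1) g) (lieAction_theta (s := s) x b)).trans
    (groupAction_theta (s := s) g _)
  have h₂ := (congrArg (lieAction n s (p + 1) (g.1.1 * x * g.1⁻¹.1))
    (groupAction_theta (s := s) g b)).trans (lieAction_theta (s := s) _ _)
  refine h₁.trans (Eq.trans (congrArg (theta n p) ?_) h₂.symm)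
  exact Subtype.ext (funext fun t =>
    twistedAction_twistedLie s g.1 x (b.1 (formAction g.1⁻¹ ∘ t)))

/-! ### Leading terms -/

theorem exists_injective_factor {A B C : Type*} [AddCommGroup A] [Module K A] [AddCommGroup B]
    [Module K B] [AddCommGroup C] [Module K C] (h : A →ₗ[K] B) (g : A →ₗ[K] C)
    (hs : Function.Surjective h) (hk : ∀ a, h a = 0 ↔ g a = 0) :
    ∃ f : B →ₗ[K] C, Function.Injective f ∧ ∀ a, f (h a) = g a := by
  let f : B →ₗ[K] C := (LinearMap.ker h).liftQ g (fun a ha => (hk a).mp ha) ∘ₗ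
    (h.quotKerEquivOfSurjective hs).symm.toLinearMap
  have hf : ∀ a, f (h a) = g a := by
    intro a
    have : (h.quotKerEquivOfSurjective hs).symm (h a) = Submodule.Quotient.mk a := by
      rw [LinearEquiv.symm_apply_eq]
      rfl
    rw [LinearMap.comp_apply, LinearEquiv.coe_coe, this]
    rfl
  refine ⟨f, ?_, hf⟩
  rw [injective_iff_map_eq_zero]
  intro z hz
  obtain ⟨a, rfl⟩ := hs z
  exact (hk a).mpr ((hf a).symm.trans hz)

theorem proj_cone_of_regular {q : Rat K d} (hq : q ∈ monSpan K (regularSet d p)) :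
    proj K (cone d n p) q = 0 := by
  refine eq_zero_of_mem_monSpan (S := ∅) (T := Set.univ) (fun _ h => h.elim)
    (proj_mem ?_ hq) (proj_mem (Set.subset_univ _) hq)
  rintro m ⟨h1, h2⟩
  exact (notMem_regularSet_of_cone h2 h1).elim

/-- The part with exponents in `cone d n p` of the value of a cocycle at `X_0, …, X_p`. -/
theorem exists_leading [CharZero K] (n : ℤ) (hp : p + 1 ≤ d) :
    ∃ f : HTilde K d n (p + 1) →ₗ[K] Rat K d, Function.Injective f ∧
      (∀ b, f (theta n p b) = proj K (cone d n p) (b.1 (stdTuple K (by omega : p ≤ d)))) ∧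
      (∀ z, f z ∈ monSpan K (cone d n p)) ∧
      ∀ q ∈ monSpan K (cone d n p), ∃ z, f z = q := by
  have hp' : p ≤ d := by omega
  let g : openCocycles K d n p →ₗ[K] Rat K d :=
    proj K (cone d n p) ∘ₗ LinearMap.proj (stdTuple K hp') ∘ₗ (openCocycles K d n p).subtype
  have hg : ∀ b, g b = proj K (cone d n p) (b.1 (stdTuple K hp')) := fun _ => rfl
  have hker : ∀ b, theta n p b = 0 ↔ g b = 0 := by
    intro b
    rw [theta_eq_zero_iff hp, hg]
    constructor
    · exact proj_cone_of_regular
    · intro h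
      have := sub_proj_mem (K := K) (S := cone d n p) (T := regularSet d p) ?_
        (std_mem_poleSet hp' b.2)
      · rwa [h, sub_zero] at this
      · rintro m ⟨h1, h2⟩
        by_contra h3
        exact h2 (mem_cone_of_poleSet hp' h1 h3)
  obtain ⟨f, hinj, hf⟩ := exists_injective_factor _ g (theta_surjective n p) hker
  refine ⟨f, hinj, fun b => (hf b).trans (hg b), fun z => ?_, fun q hq => ?_⟩
  · obtain ⟨b, rfl⟩ := theta_surjective n p z
    rw [hf, hg]
    exact proj_mem Set.inter_subset_right (std_mem_poleSet hp' b.2)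
  · have : monSpan K (cone d n p) ≤ LinearMap.range f := Submodule.span_le.mpr (by
      rintro _ ⟨m, hm, rfl⟩
      -- The twist `0` is arbitrary, since only the cocycle and its value are used.
      obtain ⟨b, hb, e⟩ := exists_isAlgebraic_of_cone (K := K) 0 hp' hm
      refine ⟨theta n p ⟨b, hb.mem⟩, ?_⟩
      rw [hf, hg]
      exact (congrArg _ e).trans (proj_eq_self (mon_mem hm)))
    exact this hq

end Classes

/-! ### Simple highest weight modules -/

section HighestWeight

variable {K : Type*} [Field K] {d : ℕ}

variable (K) in
/-- The matrix unit `E_{ab}` in `U(𝔤)`. -/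
def unitU (a b : Fin (d + 1)) : Ug K d :=
  UniversalEnvelopingAlgebra.ι K (Matrix.single a b (1 : K) : Gl K d)

/-- By the universal property, the map from `𝔤` into this subalgebra extends to `U(𝔤)`; composed
with the inclusion it is the identity. -/
theorem adjoin_range_ι :
    Algebra.adjoin K (Set.range (UniversalEnvelopingAlgebra.ι K : Gl K d → Ug K d)) = ⊤ := by
  set S := Algebra.adjoin K (Set.range (UniversalEnvelopingAlgebra.ι K : Gl K d → Ug K d)) with hS
  let f : Gl K d →ₗ⁅K⁆ S :=
    { toFun := fun x => ⟨UniversalEnvelopingAlgebra.ι K x, Algebra.subset_adjoin ⟨x, rfl⟩⟩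
      map_add' := fun x y => Subtype.ext (map_add _ x y)
      map_smul' := fun c x => Subtype.ext (map_smul _ c x)
      map_lie' := fun {x y} => Subtype.ext (LieHom.map_lie _ x y) }
  have h : S.val.comp (UniversalEnvelopingAlgebra.lift K f) = AlgHom.id K _ := by
    apply UniversalEnvelopingAlgebra.hom_ext
    ext x : 1
    change S.val (UniversalEnvelopingAlgebra.lift K f (UniversalEnvelopingAlgebra.ι K x)) = _
    rw [UniversalEnvelopingAlgebra.lift_ι_apply]
    rfl
  rw [eq_top_iff]
  intro u _
  have := DFunLike.congr_fun h u
  change ((UniversalEnvelopingAlgebra.lift K f u : S) : Ug K d) = u at this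
  rw [← this]
  exact (UniversalEnvelopingAlgebra.lift K f u).2

theorem ι_eq_sum (x : Gl K d) :
    UniversalEnvelopingAlgebra.ι K x = ∑ a, ∑ b, x a b • unitU K a b := by
  conv_lhs => rw [Matrix.matrix_eq_sum_single x]
  rw [map_sum]
  refine Finset.sum_congr rfl fun a _ => ?_
  rw [map_sum]
  refine Finset.sum_congr rfl fun b _ => ?_
  rw [unitU, ← map_smul, Matrix.smul_single, smul_eq_mul, mul_one]

/-- A subspace stable under the matrix units is stable under `U(𝔤)`. -/
theorem smul_mem_of_unitU {M : Type*} [AddCommGroup M] [Module K M] [Module (Ug K d) M]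
    [IsScalarTower K (Ug K d) M] (T : Submodule K M)
    (hT : ∀ a b : Fin (d + 1), ∀ z ∈ T, unitU K a b • z ∈ T) (u : Ug K d)
    {z : M} (hz : z ∈ T) : u • z ∈ T := by
  have hu : u ∈ Algebra.adjoin K
      (Set.range (UniversalEnvelopingAlgebra.ι K : Gl K d → Ug K d)) := by
    rw [adjoin_range_ι]; trivial
  induction hu using Algebra.adjoin_induction generalizing z with
  | mem x hx =>
    obtain ⟨x, rfl⟩ := hx
    rw [ι_eq_sum, Finset.sum_smul]
    refine Submodule.sum_mem _ fun a _ => ?_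
    rw [Finset.sum_smul]
    refine Submodule.sum_mem _ fun b _ => ?_
    rw [smul_assoc]
    exact T.smul_mem _ (hT a b z hz)
  | algebraMap r =>
    rw [algebraMap_smul]
    exact T.smul_mem r hz
  | add x y _ _ hx hy => rw [add_smul]; exact T.add_mem (hx hz) (hy hz)
  | mul x y _ _ hx hy => rw [mul_smul]; exact hx (hy hz)

theorem unitU_mul (a b c e : Fin (d + 1)) :
    unitU K a b * unitU K c e = unitU K c e * unitU K a b +
      ((if b = c then unitU K a e else 0) - (if e = a then unitU K c b else 0)) := by
  have h : ⁅(Matrix.single a b (1 : K) : Gl K d), (Matrix.single c e (1 : K) : Gl K d)⁆ =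
      (if b = c then Matrix.single a e (1 : K) else 0) -
        (if e = a then Matrix.single c b (1 : K) else 0) := by
    rw [Ring.lie_def]
    congr 1
    · split_ifs with h
      · subst h; simp
      · rw [Matrix.single_mul_single_of_ne _ _ _ _ h]
    · split_ifs with h
      · subst h; simp
      · rw [Matrix.single_mul_single_of_ne _ _ _ _ h]
  have h2 := congrArg (UniversalEnvelopingAlgebra.ι K) h
  rw [LieHom.map_lie, Ring.lie_def, map_sub] at h2
  rw [unitU, unitU, ← sub_eq_iff_eq_add', h2]
  congr 1
  · split_ifs
    · rfl
    · exact map_zero _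
  · split_ifs
    · rfl
    · exact map_zero _

variable {M : Type*} [AddCommGroup M] [Module K M] [Module (Ug K d) M]
  [IsScalarTower K (Ug K d) M]

/-- The vectors obtained from `v` by applying matrix units below the diagonal. -/
inductive LowerWord (v : M) : ℕ → M → Prop
  | base : LowerWord v 0 v
  | step {k : ℕ} {z : M} (a b : Fin (d + 1)) : b < a → LowerWord v k z →
      LowerWord v (k + 1) (unitU K a b • z)

/-- `v` is a highest weight vector of weight `μ`. -/
structure IsHighestWeight (μ : Fin (d + 1) → ℤ) (v : M) : Prop where
  raise : ∀ a b : Fin (d + 1), a < b → unitU K a b • v = 0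
  diag : ∀ a : Fin (d + 1), unitU K a a • v = (μ a : K) • v

/-- Commute `E_{ab}` past the leftmost lowering operator. The commutator consists of matrix units
acting on a shorter word, so induction over all `a, b` at once suffices and no ordered basis of
`U(𝔤)` is needed. -/
theorem IsHighestWeight.unitU_smul_mem {μ : Fin (d + 1) → ℤ} {v : M}
    (hv : IsHighestWeight (K := K) μ v) {k : ℕ} {z : M} (hz : LowerWord (K := K) (d := d) v k z)
    (a b : Fin (d + 1)) :
    unitU K a b • z ∈ Submodule.span K {z : M | ∃ k, LowerWord (K := K) (d := d) v k z} := by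
  have lower : ∀ a b : Fin (d + 1), b < a →
      ∀ z ∈ Submodule.span K {z : M | ∃ k, LowerWord (K := K) (d := d) v k z},
      unitU K a b • z ∈ Submodule.span K {z : M | ∃ k, LowerWord (K := K) (d := d) v k z} := by
    intro a b hab z hz
    induction hz using Submodule.span_induction with
    | mem z hz =>
      obtain ⟨k, hk⟩ := hz
      exact Submodule.subset_span ⟨k + 1, LowerWord.step a b hab hk⟩
    | zero => rw [smul_zero]; exact Submodule.zero_mem _
    | add x y _ _ hx hy => rw [smul_add]; exact Submodule.add_mem _ hx hy
    | smul c x _ hx => rw [smul_algebra_smul_comm]; exact Submodule.smul_mem _ _ hx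
  induction hz generalizing a b with
  | base =>
    rcases lt_trichotomy a b with h | rfl | h
    · rw [hv.raise a b h]; exact Submodule.zero_mem _
    · rw [hv.diag]
      exact Submodule.smul_mem _ _ (Submodule.subset_span ⟨0, LowerWord.base⟩)
    · exact Submodule.subset_span ⟨1, LowerWord.step a b h LowerWord.base⟩
  | step c e hce hz ih =>
    rw [← mul_smul, unitU_mul, add_smul, mul_smul, sub_smul]
    refine Submodule.add_mem _ (lower c e hce _ (ih a b)) (Submodule.sub_mem _ ?_ ?_)
    · split_ifs
      · exact ih _ _
      · rw [zero_smul]; exact Submodule.zero_mem _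
    · split_ifs
      · exact ih _ _
      · rw [zero_smul]; exact Submodule.zero_mem _

theorem IsHighestWeight.span_lowerWord {μ : Fin (d + 1) → ℤ} {v : M}
    (hv : IsHighestWeight (K := K) μ v) (u : Ug K d) :
    u • v ∈ Submodule.span K {z : M | ∃ k, LowerWord (K := K) (d := d) v k z} := by
  refine smul_mem_of_unitU _ (fun a b z hz => ?_) u (Submodule.subset_span ⟨0, LowerWord.base⟩)
  induction hz using Submodule.span_induction with
  | mem z hz =>
    obtain ⟨k, hk⟩ := hz
    exact hv.unitU_smul_mem hk a b
  | zero => rw [smul_zero]; exact Submodule.zero_mem _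
  | add x y _ _ hx hy => rw [smul_add]; exact Submodule.add_mem _ hx hy
  | smul c x _ hx => rw [smul_algebra_smul_comm]; exact Submodule.smul_mem _ _ hx

/-! ### The grading by height and its top component -/

variable (K d) in
/-- The element `-∑ a E_{aa}`, whose adjoint action has eigenvalue `b - a` on `E_{ab}`. -/
def gradingU : Ug K d := ∑ a : Fin (d + 1), (-((a : ℕ) : K)) • unitU K a a

theorem gradingU_mul (a b : Fin (d + 1)) :
    gradingU K d * unitU K a b = unitU K a b * gradingU K d +
      (((b : ℕ) : K) - ((a : ℕ) : K)) • unitU K a b := by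
  have h : ∀ c : Fin (d + 1), (-((c : ℕ) : K)) • unitU K c c * unitU K a b =
      unitU K a b * ((-((c : ℕ) : K)) • unitU K c c) +
        ((if c = a then (-((c : ℕ) : K)) • unitU K c b else 0) -
          (if b = c then (-((c : ℕ) : K)) • unitU K a c else 0)) := by
    intro c
    rw [smul_mul_assoc, unitU_mul, smul_add, smul_sub, smul_ite, smul_ite, smul_zero,
      mul_smul_comm]
  rw [gradingU, Finset.sum_mul, Finset.mul_sum, Finset.sum_congr rfl fun c _ => h c,
    Finset.sum_add_distrib, Finset.sum_sub_distrib, Finset.sum_ite_eq', Finset.sum_ite_eq,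
    if_pos (Finset.mem_univ _), if_pos (Finset.mem_univ _)]
  congr 1
  module

theorem IsHighestWeight.grading {μ : Fin (d + 1) → ℤ} {v : M}
    (hv : IsHighestWeight (K := K) μ v) :
    gradingU K d • v = (∑ a : Fin (d + 1), (-((a : ℕ) : K)) * (μ a : K)) • v := by
  rw [gradingU, Finset.sum_smul, Finset.sum_smul]
  refine Finset.sum_congr rfl fun a _ => ?_
  rw [smul_assoc, hv.diag, smul_smul]

/-- Each lowering operator decreases the eigenvalue by a positive integer, so only the empty word
attains the top one. -/
theorem IsHighestWeight.grading_lowerWord {μ : Fin (d + 1) → ℤ} {v : M}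
    (hv : IsHighestWeight (K := K) μ v) {k : ℕ} {z : M}
    (hz : LowerWord (K := K) (d := d) v k z) :
    ∃ m : ℕ, k ≤ m ∧ gradingU K d • z =
      ((∑ a : Fin (d + 1), (-((a : ℕ) : K)) * (μ a : K)) - (m : K)) • z := by
  induction hz with
  | base => exact ⟨0, le_rfl, by rw [hv.grading]; simp⟩
  | @step k z a b hab hz ih =>
    obtain ⟨m, hm, e⟩ := ih
    have hab' : (b : ℕ) < a := hab
    refine ⟨m + (a - b : ℕ), by omega, ?_⟩
    rw [← mul_smul, gradingU_mul, add_smul, mul_smul, e, smul_assoc, smul_algebra_smul_comm,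
      ← add_smul]
    congr 1
    push_cast [Nat.cast_sub hab'.le]
    ring

/-- Up to normalisation, the projection to the top eigenspace of `gradingU`. -/
def topProj (h : K) (N : ℕ) : Ug K d :=
  Polynomial.aeval (gradingU K d)
    (∏ m ∈ Finset.range N, (Polynomial.X - Polynomial.C (h - ((m + 1 : ℕ) : K))))

theorem aeval_smul_of_eigen {u : Ug K d} {z : M} {c : K} (h : u • z = c • z)
    (P : Polynomial K) : Polynomial.aeval u P • z = P.eval c • z := by
  induction P using Polynomial.induction_on' with
  | add p q hp hq => rw [map_add, add_smul, hp, hq, Polynomial.eval_add, add_smul]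
  | monomial n a =>
    rw [Polynomial.aeval_monomial, Polynomial.eval_monomial, mul_smul, algebraMap_smul, mul_smul]
    congr 1
    induction n with
    | zero => simp
    | succ n ih => rw [pow_succ, mul_smul, h, smul_algebra_smul_comm, ih, smul_smul, pow_succ,
        mul_comm]

theorem topProj_eq_zero {h : K} {N m : ℕ} (hm : 1 ≤ m) (hN : m ≤ N) {z : M}
    (hz : gradingU K d • z = (h - (m : K)) • z) : topProj (d := d) h N • z = 0 := by
  rw [topProj, aeval_smul_of_eigen hz, Polynomial.eval_prod,
    Finset.prod_eq_zero (i := m - 1) (by simp; omega), zero_smul]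
  simp [Nat.sub_add_cancel hm]

/-- The scalar is the product of `1, …, N`, nonzero in characteristic zero. -/
theorem topProj_top [CharZero K] {h : K} (N : ℕ) {z : M}
    (hz : gradingU K d • z = h • z) : ∃ c : K, c ≠ 0 ∧ topProj (d := d) h N • z = c • z := by
  refine ⟨_, ?_, aeval_smul_of_eigen hz _⟩
  rw [Polynomial.eval_prod]
  refine Finset.prod_ne_zero_iff.mpr fun m _ => ?_
  simp only [Polynomial.eval_sub, Polynomial.eval_X, Polynomial.eval_C, sub_sub_cancel]
  exact_mod_cast Nat.succ_ne_zero m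

/-- The vector `u • v` involves finitely many words, so for large `N` every eigenvalue strictly
below the top is annihilated. -/
theorem IsHighestWeight.exists_topProj {μ : Fin (d + 1) → ℤ} {v : M}
    (hv : IsHighestWeight (K := K) μ v) (u : Ug K d) :
    ∃ N₀, ∀ N, N₀ ≤ N → ∃ c : K,
      topProj (d := d) (∑ a : Fin (d + 1), (-((a : ℕ) : K)) * (μ a : K)) N • (u • v) = c • v := by
  have := hv.span_lowerWord u
  generalize u • v = z at this ⊢
  induction this using Submodule.span_induction with
  | mem z hz =>
    obtain ⟨k, hk⟩ := hz
    obtain ⟨m, hm, e⟩ := hv.grading_lowerWord hk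
    rcases Nat.eq_zero_or_pos m with rfl | h0
    · obtain rfl : k = 0 := by omega
      cases hk
      exact ⟨0, fun N _ => ⟨_, aeval_smul_of_eigen hv.grading _⟩⟩
    · exact ⟨m, fun N hN => ⟨0, by rw [topProj_eq_zero h0 hN e, zero_smul]⟩⟩
  | zero => exact ⟨0, fun N _ => ⟨0, by simp⟩⟩
  | add x y _ _ hx hy =>
    obtain ⟨N₁, h₁⟩ := hx
    obtain ⟨N₂, h₂⟩ := hy
    refine ⟨max N₁ N₂, fun N hN => ?_⟩
    obtain ⟨c₁, e₁⟩ := h₁ N (le_of_max_le_left hN)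
    obtain ⟨c₂, e₂⟩ := h₂ N (le_of_max_le_right hN)
    exact ⟨c₁ + c₂, by rw [smul_add, e₁, e₂, add_smul]⟩
  | smul c x _ hx =>
    obtain ⟨N₁, h₁⟩ := hx
    refine ⟨N₁, fun N hN => ?_⟩
    obtain ⟨c₁, e₁⟩ := h₁ N hN
    exact ⟨c * c₁, by rw [smul_algebra_smul_comm, e₁, smul_smul]⟩

/-! ### Maximal submodules of Verma modules -/

variable (K) in
/-- The canonical generator of the Verma module. -/
def vermaTop (μ : Fin (d + 1) → ℤ) : Verma K μ := Submodule.Quotient.mk 1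

theorem smul_vermaTop (μ : Fin (d + 1) → ℤ) (u : Ug K d) :
    u • vermaTop K μ = Submodule.Quotient.mk u := by
  rw [vermaTop, ← Submodule.Quotient.mk_smul, smul_eq_mul, mul_one]

theorem vermaTop_isHighestWeight (μ : Fin (d + 1) → ℤ) :
    IsHighestWeight (K := K) μ (vermaTop K μ) where
  raise a b hab := by
    rw [smul_vermaTop, Submodule.Quotient.mk_eq_zero]
    exact Submodule.subset_span (Or.inl ⟨a, b, hab, rfl⟩)
  diag a := by
    rw [smul_vermaTop, ← algebraMap_smul (Ug K d), smul_vermaTop, Submodule.Quotient.eq]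
    exact Submodule.subset_span (Or.inr ⟨a, rfl⟩)

/-- A proper submodule of the Verma module is contained in every maximal one. -/
theorem le_of_isCoatom [CharZero K] (μ : Fin (d + 1) → ℤ) (N N' : Submodule (Ug K d) (Verma K μ))
    (hN : IsCoatom N) (hN' : N' ≠ ⊤) : N' ≤ N := by
  have gen : ∀ S : Submodule (Ug K d) (Verma K μ), vermaTop K μ ∈ S → S = ⊤ := by
    intro S hS
    rw [eq_top_iff]
    intro z _
    obtain ⟨u, rfl⟩ := Submodule.Quotient.mk_surjective _ z
    rw [← smul_vermaTop]
    exact S.smul_mem u hS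
  by_contra hle
  -- Otherwise the generator is a sum of elements of `N` and `N'`. Its top component is nonzero, so
  -- one summand has nonzero top component, and the generator lies in `N` or in `N'`.
  have hsup : N ⊔ N' = ⊤ := hN.2 _ (lt_of_le_of_ne le_sup_left fun h => hle (by
    rw [h]; exact le_sup_right))
  obtain ⟨x, hx, y, hy, hxy⟩ := Submodule.mem_sup.mp (hsup ▸ Submodule.mem_top :
    vermaTop K μ ∈ N ⊔ N')
  obtain ⟨u, rfl⟩ := Submodule.Quotient.mk_surjective _ x
  obtain ⟨w, rfl⟩ := Submodule.Quotient.mk_surjective _ y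
  rw [← smul_vermaTop] at hx hxy
  rw [← smul_vermaTop] at hy hxy
  have hv := vermaTop_isHighestWeight (K := K) μ
  obtain ⟨N₁, h₁⟩ := hv.exists_topProj u
  obtain ⟨N₂, h₂⟩ := hv.exists_topProj w
  obtain ⟨c₁, e₁⟩ := h₁ (max N₁ N₂) (le_max_left _ _)
  obtain ⟨c₂, e₂⟩ := h₂ (max N₁ N₂) (le_max_right _ _)
  obtain ⟨c, hc, e⟩ := topProj_top (d := d) (max N₁ N₂) hv.grading
  have mem : ∀ (S : Submodule (Ug K d) (Verma K μ)) (k : K), k ≠ 0 →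
      k • vermaTop K μ ∈ S → vermaTop K μ ∈ S := by
    intro S k hk h
    have := S.smul_mem (algebraMap K (Ug K d) k⁻¹) h
    rwa [algebraMap_smul, smul_smul, inv_mul_cancel₀ hk, one_smul] at this
  have z₁ : c₁ = 0 := by
    by_contra h
    exact hN.1 (gen _ (mem _ _ h (e₁ ▸ N.smul_mem _ hx)))
  have z₂ : c₂ = 0 := by
    by_contra h
    exact hN' (gen _ (mem _ _ h (e₂ ▸ N'.smul_mem _ hy)))
  rw [← hxy, smul_add, e₁, e₂, z₁, z₂, zero_smul, zero_add, hxy] at e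
  exact hN.1 (gen _ (mem _ _ hc (e ▸ N.zero_mem)))

end HighestWeight

/-- A simple module generated by a highest weight vector of weight `μ` is isomorphic to `L(μ)`. -/
theorem exists_equiv_simpleModule {K : Type*} [Field K] [CharZero K] {d : ℕ} {M : Type*}
    [AddCommGroup M] [Module K M] (E : Ug K d →ₐ[K] Module.End K M) (μ : Fin (d + 1) → ℤ) (v : M)
    (hv : v ≠ 0) (raise : ∀ a b, a < b → E (unitU K a b) v = 0)
    (diag : ∀ a, E (unitU K a a) v = (μ a : K) • v)
    (simple : ∀ N : Submodule K M, (∀ a b, ∀ z ∈ N, E (unitU K a b) z ∈ N) → N = ⊥ ∨ N = ⊤) :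
    ∃ φ : M ≃ₗ[K] SimpleModule K μ, ∀ (u : Ug K d) (m : M), φ (E u m) = u • φ m := by
  let _ : Module (Ug K d) M := Module.compHom M E.toRingHom
  have act : ∀ (u : Ug K d) (m : M), u • m = E u m := fun _ _ => rfl
  have _ : IsScalarTower K (Ug K d) M := ⟨fun k u m => by
    rw [act, act, map_smul]; rfl⟩
  let g : Verma K μ →ₗ[Ug K d] M := Submodule.liftQ _ (LinearMap.toSpanSingleton (Ug K d) M v) (by
    refine Submodule.span_le.mpr ?_
    rintro u (⟨a, b, hab, rfl⟩ | ⟨a, rfl⟩)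
    · exact raise a b hab
    · change (_ - _ : Ug K d) • v = 0
      rw [sub_smul, algebraMap_smul, sub_eq_zero]
      exact diag a)
  have simple' : ∀ N : Submodule (Ug K d) M, N = ⊥ ∨ N = ⊤ := by
    intro N
    rcases simple (N.restrictScalars K) (fun a b z hz => N.smul_mem _ hz) with h | h
    · left
      exact (Submodule.restrictScalars_eq_bot_iff K _ _).mp h
    · right
      exact (Submodule.restrictScalars_eq_top_iff K _ _).mp h
  have gtop : g (vermaTop K μ) = v := one_smul (Ug K d) v
  have hsurj : LinearMap.range g = ⊤ := (simple' _).resolve_left fun h => hv (by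
    have : g (vermaTop K μ) ∈ LinearMap.range g := ⟨_, rfl⟩
    rw [h, gtop] at this
    exact this)
  have hco : IsCoatom (LinearMap.ker g) := by
    refine ⟨fun h => hv ?_, fun S hS => ?_⟩
    · have : vermaTop K μ ∈ LinearMap.ker g := h ▸ Submodule.mem_top
      rw [← gtop]; exact this
    · have key : S = (S.map g).comap g := by
        rw [Submodule.comap_map_eq, sup_eq_left.mpr hS.le]
      rcases simple' (S.map g) with h | h
      · rw [h, Submodule.comap_bot] at key
        exact absurd key hS.ne'
      · rw [h, Submodule.comap_top] at key
        exact key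
  -- The kernel is maximal by simplicity, so it contains every proper submodule and is itself one of
  -- them.
  have hker : vermaRadical K μ = LinearMap.ker g :=
    le_antisymm (sSup_le fun N' hN' => le_of_isCoatom μ _ N' hco hN') (le_sSup hco.1)
  let e : SimpleModule K μ ≃ₗ[Ug K d] M :=
    (Submodule.quotEquivOfEq _ _ hker).trans
      (g.quotKerEquivOfSurjective (LinearMap.range_eq_top.mp hsurj))
  refine ⟨(e.restrictScalars K).symm, fun u m => ?_⟩
  exact e.symm.map_smul u m

/-! ### Simplicity -/

section Simple

variable {K : Type*} [Field K] {d : ℕ} {n s : ℤ} {p : ℕ}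

theorem shift_apply (m : Fin (d + 1) → ℤ) (a b c : Fin (d + 1)) :
    (m + Pi.single a 1 - Pi.single b 1 : Fin (d + 1) → ℤ) c =
      m c + (if c = a then 1 else 0) - if c = b then 1 else 0 := by
  rw [Pi.sub_apply, Pi.add_apply, Pi.single_apply, Pi.single_apply]

theorem sum_shift (m : Fin (d + 1) → ℤ) (a b : Fin (d + 1)) :
    ∑ c, (m + Pi.single a 1 - Pi.single b 1 : Fin (d + 1) → ℤ) c = ∑ c, m c := by
  simp only [shift_apply, Finset.sum_sub_distrib, Finset.sum_add_distrib]
  simp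

/-- Because `X_a ∂/∂X_b` has coefficient `m b`, a zero exponent is never lowered. Hence the action
descends to leading terms. -/
theorem twistedLie_single_regular (s : ℤ) (a b : Fin (d + 1)) {q : Rat K d}
    (hq : q ∈ monSpan K (regularSet d p)) :
    twistedLie s (Matrix.single a b (1 : K) : Gl K d) q ∈ monSpan K (regularSet d p) := by
  refine map_mem_of_mon _ _ (fun m hm => ?_) hq
  rw [twistedLie_single_mon]
  refine Submodule.add_mem _ ?_ (Submodule.smul_mem _ _ (mon_mem hm))
  by_cases hb : m b = 0
  · rw [hb, Int.cast_zero, zero_smul]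
    exact Submodule.zero_mem _
  · obtain ⟨c, hc, h⟩ := hm
    refine Submodule.smul_mem _ _ (mon_mem ⟨c, hc, ?_⟩)
    rw [shift_apply]
    by_cases hcb : c = b
    · subst hcb
      split_ifs <;> omega
    · rw [if_neg hcb]
      split_ifs <;> omega

variable (K) in
/-- The action of `E_{ab}` on leading terms. -/
def coneOp (n s : ℤ) (p : ℕ) (a b : Fin (d + 1)) : Module.End K (Rat K d) :=
  proj K (cone d n p) ∘ₗ twistedLie s (Matrix.single a b (1 : K) : Gl K d)

open Classical in
theorem coneOp_mon {m : Fin (d + 1) → ℤ} (hm : m ∈ cone d n p) (a b : Fin (d + 1)) :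
    coneOp K n s p a b (mon K m) =
      (m b : K) • (if m + Pi.single a 1 - Pi.single b 1 ∈ cone d n p
        then mon K (m + Pi.single a 1 - Pi.single b 1) else 0) +
      (if a = b then (s : K) else 0) • mon K m := by
  rw [coneOp, LinearMap.comp_apply, twistedLie_single_mon, map_add, map_smul, map_smul, proj_mon,
    proj_mon, if_pos hm]

theorem coneOp_self_mon {m : Fin (d + 1) → ℤ} (hm : m ∈ cone d n p) (a : Fin (d + 1)) :
    coneOp K n s p a a (mon K m) = (m a + s : K) • mon K m := by
  rw [coneOp_mon hm, add_sub_cancel_right, if_pos hm, if_pos rfl, add_smul]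

/-- The diagonal units have eigenvalues `m a + s`, which separate exponents in characteristic zero;
a combination of several monomials can therefore be shortened inside `N`. -/
theorem exists_mon_mem [CharZero K] {N : Submodule K (Rat K d)}
    (hN : N ≤ monSpan K (cone d n p)) (hN₀ : N ≠ ⊥)
    (stable : ∀ a, ∀ q ∈ N, coneOp K n s p a a q ∈ N) : ∃ m ∈ cone d n p, mon K m ∈ N := by
  classical
  have key : ∀ (S : Finset (Fin (d + 1) → ℤ)) (c : (Fin (d + 1) → ℤ) → K),
      (∀ m ∈ S, m ∈ cone d n p ∧ c m ≠ 0) → S.Nonempty → ∑ m ∈ S, c m • mon K m ∈ N →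
      ∃ m ∈ cone d n p, mon K m ∈ N := by
    intro S
    induction S using Finset.strongInduction with
    | H S ih =>
      rintro c hc ⟨m₀, h₀⟩ hq
      by_cases h : ∃ m₁ ∈ S, m₁ ≠ m₀
      · obtain ⟨m₁, h₁, hne⟩ := h
        obtain ⟨a, ha⟩ := Function.ne_iff.mp hne
        -- Applying `E_{aa} - (m₀ a + s)` removes `m₀` but keeps `m₁`.
        refine ih (S.filter fun m => m a ≠ m₀ a)
          (Finset.filter_ssubset.mpr ⟨m₀, h₀, by simp⟩) (fun m => c m * ((m a : K) - m₀ a))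
          (fun m hm => ?_) ⟨m₁, Finset.mem_filter.mpr ⟨h₁, ha⟩⟩ ?_
        · obtain ⟨hm, hma⟩ := Finset.mem_filter.mp hm
          refine ⟨(hc m hm).1, mul_ne_zero (hc m hm).2 (sub_ne_zero.mpr ?_)⟩
          exact_mod_cast hma
        · have e : ∑ m ∈ S.filter (fun m => m a ≠ m₀ a), (c m * ((m a : K) - m₀ a)) • mon K m =
              coneOp K n s p a a (∑ m ∈ S, c m • mon K m) -
                (m₀ a + s : K) • ∑ m ∈ S, c m • mon K m := by
            rw [Finset.sum_filter_of_ne, map_sum, Finset.smul_sum, ← Finset.sum_sub_distrib]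
            · refine Finset.sum_congr rfl fun m hm => ?_
              rw [map_smul, coneOp_self_mon (hc m hm).1, smul_smul, smul_smul, ← sub_smul]
              congr 1
              ring
            · intro m _ hne hma
              exact hne (by rw [hma, sub_self, mul_zero, zero_smul])
          rw [e]
          exact Submodule.sub_mem _ (stable a _ hq) (Submodule.smul_mem _ _ hq)
      · push Not at h
        have hS : S = {m₀} := Finset.eq_singleton_iff_unique_mem.mpr ⟨h₀, h⟩
        rw [hS, Finset.sum_singleton] at hq
        exact ⟨m₀, (hc m₀ h₀).1, (Submodule.smul_mem_iff _ (hc m₀ h₀).2).mp hq⟩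
  obtain ⟨q, hq, hq₀⟩ := Submodule.exists_mem_ne_zero_of_ne_bot hN₀
  obtain ⟨l, hl, rfl⟩ := (Finsupp.mem_span_image_iff_linearCombination K).mp (hN hq)
  refine key l.support l (fun m hm => ⟨(Finsupp.mem_supported K l).mp hl hm,
    Finsupp.mem_support_iff.mp hm⟩) ?_ hq
  rw [Finsupp.support_nonempty_iff]
  rintro rfl
  exact hq₀ (map_zero _)

theorem exists_lt_of_sum_eq {m m' : Fin (d + 1) → ℤ} (h : ∑ a, m a = ∑ a, m' a) (hne : m ≠ m') :
    ∃ a, m a < m' a := by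
  by_contra hcon
  push Not at hcon
  refine hne (funext fun a => ?_)
  exact ((Finset.sum_eq_sum_iff_of_le fun a _ => hcon a).mp h.symm a (Finset.mem_univ a)).symm

/-- As the degrees agree, some exponent is too small at `a` and some too large at `b`. Then `E_{ab}`
moves strictly closer to the target without leaving the cone. -/
theorem mon_mem_of_mon_mem [CharZero K] {N : Submodule K (Rat K d)}
    (stable : ∀ a b, ∀ q ∈ N, coneOp K n s p a b q ∈ N) {m' : Fin (d + 1) → ℤ}
    (hm' : m' ∈ cone d n p) (k : ℕ) : ∀ m ∈ cone d n p, ∑ a, (m' a - m a).natAbs = k →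
    mon K m ∈ N → mon K m' ∈ N := by
  induction k using Nat.strong_induction_on with
  | _ k ih =>
    intro m hm hk hmem
    by_cases hne : m = m'
    · rwa [← hne]
    have hsum : ∑ a, m a = ∑ a, m' a := hm.1.trans hm'.1.symm
    obtain ⟨a, ha⟩ := exists_lt_of_sum_eq hsum hne
    obtain ⟨b, hb⟩ := exists_lt_of_sum_eq hsum.symm (Ne.symm hne)
    have hab : a ≠ b := by rintro rfl; omega
    have hcone : m + Pi.single a 1 - Pi.single b 1 ∈ cone d n p := by
      refine ⟨(sum_shift m a b).trans hm.1, fun c => ?_⟩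
      have h1 := hm.2 c
      have h2 := hm'.2 c
      rw [shift_apply]
      by_cases hca : c = a
      · subst hca
        rw [if_pos rfl, if_neg hab]
        omega
      · rw [if_neg hca]
        by_cases hcb : c = b
        · subst hcb
          rw [if_pos rfl]
          omega
        · rw [if_neg hcb]
          omega
    refine ih (∑ c, (m' c - (m + Pi.single a 1 - Pi.single b 1 : Fin (d + 1) → ℤ) c).natAbs) ?_ _
      hcone rfl ?_
    · rw [← hk]
      refine Finset.sum_lt_sum (fun c _ => ?_) ⟨a, Finset.mem_univ a, ?_⟩
      · rw [shift_apply]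
        by_cases hca : c = a
        · subst hca
          rw [if_pos rfl, if_neg hab]
          omega
        · rw [if_neg hca]
          split_ifs with hcb
          · subst hcb
            omega
          · omega
      · rw [shift_apply, if_pos rfl, if_neg hab]
        omega
    · have h := stable a b _ hmem
      rw [coneOp_mon hm, if_pos hcone, if_neg hab, zero_smul, add_zero] at h
      -- The coefficient `m b` is negative if `b ≤ p`, and otherwise exceeds `m' b ≥ 0`.
      refine (Submodule.smul_mem_iff _ ?_).mp h
      rw [Int.cast_ne_zero]
      have h1 := hm.2 b
      have h2 := hm'.2 b
      omega

theorem eq_bot_or_eq_cone [CharZero K] {N : Submodule K (Rat K d)}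
    (hN : N ≤ monSpan K (cone d n p)) (stable : ∀ a b, ∀ q ∈ N, coneOp K n s p a b q ∈ N) :
    N = ⊥ ∨ N = monSpan K (cone d n p) := by
  by_cases h : N = ⊥
  · exact Or.inl h
  · obtain ⟨m, hm, hmem⟩ := exists_mon_mem hN h fun a => stable a a
    refine Or.inr (le_antisymm hN (Submodule.span_le.mpr ?_))
    rintro _ ⟨m', hm', rfl⟩
    exact mon_mem_of_mon_mem stable hm' _ m hm rfl hmem

/-- Passing to leading terms discards only regular monomials, and these stay regular under `𝔤`. -/
theorem leading_lieAction (hp : p + 1 ≤ d) {f : HTilde K d n (p + 1) →ₗ[K] Rat K d}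
    (hf : ∀ b, f (theta n p b) = proj K (cone d n p) (b.1 (stdTuple K (by omega : p ≤ d))))
    (a b : Fin (d + 1)) (z : HTilde K d n (p + 1)) :
    f (lieAction n s (p + 1) (Matrix.single a b 1) z) = coneOp K n s p a b (f z) := by
  obtain ⟨c, rfl⟩ := theta_surjective n p z
  rw [lieAction_theta, hf, hf, ← sub_eq_zero, coneOp, LinearMap.comp_apply, ← map_sub]
  apply proj_cone_of_regular
  change twistedLie s _ (c.1 _) - _ ∈ _
  rw [← map_sub]
  refine twistedLie_single_regular s a b (sub_proj_mem ?_ (std_mem_poleSet (by omega) c.2))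
  rintro m ⟨h1, h2⟩
  by_contra h3
  exact h2 (mem_cone_of_poleSet (by omega) h1 h3)

theorem envelopingAction_unitU (n s : ℤ) (i : ℕ) (a b : Fin (d + 1)) :
    envelopingAction n s i (unitU K a b) = lieAction n s i (Matrix.single a b 1) :=
  UniversalEnvelopingAlgebra.lift_ι_apply _ _ _

/-- If the exponent `m` is a highest weight of the span of the leading terms, then `H̃` is
isomorphic to `L(m + s)`. -/
theorem exists_equiv_of_top [CharZero K] (s : ℤ) (hp : p + 1 ≤ d) {m : Fin (d + 1) → ℤ}
    (hm : m ∈ cone d n p)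
    (top : ∀ a b, a < b → m b = 0 ∨ m + Pi.single a 1 - Pi.single b 1 ∉ cone d n p)
    {μ : Fin (d + 1) → ℤ} (hμ : ∀ a, μ a = m a + s) :
    ∃ φ : HTilde K d n (p + 1) ≃ₗ[K] SimpleModule K μ,
      ∀ (u : Ug K d) (h : HTilde K d n (p + 1)),
        φ (envelopingAction n s (p + 1) u h) = u • φ h := by
  obtain ⟨f, hinj, hf, hmem, hsurj⟩ := exists_leading (K := K) n hp
  have act := leading_lieAction (s := s) hp hf
  obtain ⟨v, hv⟩ := hsurj _ (mon_mem hm)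
  refine exists_equiv_simpleModule (envelopingAction n s (p + 1)) μ v ?_ (fun a b hab => ?_)
    (fun a => ?_) fun N hN => ?_
  · rintro rfl
    exact mon_ne_zero (K := K) m (hv.symm.trans (map_zero f))
  · rw [envelopingAction_unitU]
    apply hinj
    rw [act, hv, coneOp_mon hm, if_neg hab.ne, zero_smul, add_zero, map_zero]
    rcases top a b hab with h | h
    · rw [h, Int.cast_zero, zero_smul]
    · rw [if_neg h, smul_zero]
  · rw [envelopingAction_unitU]
    apply hinj
    rw [act, map_smul, hv, coneOp_self_mon hm, hμ, Int.cast_add]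
  · have stable : ∀ a b, ∀ q ∈ N.map f, coneOp K n s p a b q ∈ N.map f := by
      rintro a b _ ⟨z, hz, rfl⟩
      have := hN a b z hz
      rw [envelopingAction_unitU] at this
      exact ⟨_, this, act a b z⟩
    have hle : N.map f ≤ monSpan K (cone d n p) := by
      rintro _ ⟨z, -, rfl⟩
      exact hmem z
    rcases eq_bot_or_eq_cone hle stable with h | h
    · left
      refine (Submodule.eq_bot_iff _).mpr fun z hz => hinj ?_
      rw [map_zero]
      exact (Submodule.mem_bot K).mp (h ▸ Submodule.mem_map_of_mem hz)
    · right
      rw [eq_top_iff]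
      intro z _
      obtain ⟨y, hy, hyz⟩ : f z ∈ N.map f := h ▸ hmem z
      rwa [← hinj hyz]

end Simple

/-! ### The weights `w_j · λ` -/

section Weights

variable {d : ℕ}

theorem dot_mul (w w' : Equiv.Perm (Fin (d + 1))) (χ : Fin (d + 1) → ℤ) :
    dot (w * w') χ = dot w (dot w' χ) := by
  funext a
  simp [dot]

theorem dot_weyl (r s : ℤ) {j : ℕ} (hj : j ≤ d) (a : Fin (d + 1)) :
    dot (weyl d j) (lineWeight d r s) a =
      if (a : ℕ) < j then s - 1 else if (a : ℕ) = j then r + j else s := by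
  induction j generalizing a with
  | zero =>
    have h : (a = 0) ↔ (a : ℕ) = 0 := Fin.ext_iff
    simp only [dot, weyl, lineWeight, inv_one, Equiv.Perm.one_apply, h]
    split_ifs <;> push_cast <;> omega
  | succ j ih =>
    rw [weyl, dot_mul]
    have inv : (simpleReflection d (j + 1))⁻¹ = Equiv.swap ⟨j, by omega⟩ ⟨j + 1, by omega⟩ := by
      rw [simpleReflection, dif_pos hj, Equiv.swap_inv]
      rfl
    have val : ((simpleReflection d (j + 1))⁻¹ a : ℕ) =
        if (a : ℕ) = j then j + 1 else if (a : ℕ) = j + 1 then j else a := by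
      rw [inv, Equiv.swap_apply_def]
      simp only [Fin.ext_iff]
      split_ifs <;> rfl
    rw [dot, ih (by omega), val]
    split_ifs <;> push_cast <;> omega

theorem isDominant_dot_weyl (hd : 1 ≤ d) (r s : ℤ) {j : ℕ} (hj : j ≤ d) :
    IsDominant (dot (weyl d j) (lineWeight d r s)) ↔ (j = 0 ∧ s ≤ r) ∨ (j = d ∧ r + d ≤ s - 1) := by
  constructor
  · intro h
    have h1 := h ⟨0, by omega⟩ ⟨d, by omega⟩ (by simp)
    rw [dot_weyl r s hj, dot_weyl r s hj] at h1
    simp only at h1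
    split_ifs at h1 <;> omega
  · rintro (⟨rfl, h⟩ | ⟨rfl, h⟩) a b hab <;> rw [Fin.le_def] at hab <;>
      rw [dot_weyl r s hj, dot_weyl r s hj] <;> split_ifs <;> push_cast at * <;> omega

theorem dot_weyl_eq_succ (r s : ℤ) {j : ℕ} (hj : j < d) :
    dot (weyl d j) (lineWeight d r s) = dot (weyl d (j + 1)) (lineWeight d r s) ↔
      r + j = s - 1 := by
  constructor
  · intro h
    have := congrFun h ⟨j, by omega⟩
    rw [dot_weyl r s hj.le, dot_weyl r s hj] at this
    simpa using this
  · intro h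
    funext a
    rw [dot_weyl r s hj.le, dot_weyl r s hj]
    split_ifs <;> push_cast <;> omega

/-- By cases: `i_0 = 0` if `r ≥ s`, `i_0 = d` if `r + d < s`, and `i_0 = s - 1 - r` in between. Each
of the defining sets is a singleton, so its infimum is its element. -/
theorem le_iZero (hd : 1 ≤ d) (r s : ℤ) {i : ℕ} (hi : 1 ≤ i) (hid : i ≤ d) :
    i ≤ iZero d r s ↔ r - s + i < 0 := by
  have only : ∀ (P : ℕ → Prop) (k : ℕ), (∀ j, P j ↔ j = k) → sInf {j | P j} = k := by
    intro P k h
    rw [show {j | P j} = {k} from Set.ext h, csInf_singleton]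
  rw [iZero]
  split_ifs with h
  · obtain ⟨j, hj, hdom⟩ := h
    rw [isDominant_dot_weyl hd r s hj] at hdom
    rw [only _ j]
    · omega
    · intro k
      constructor
      · rintro ⟨hk, hk'⟩
        rw [isDominant_dot_weyl hd r s hk] at hk'
        omega
      · rintro rfl
        exact ⟨hj, (isDominant_dot_weyl hd r s hj).mpr hdom⟩
  · have h0 : ¬ s ≤ r := fun hs =>
      h ⟨0, by omega, (isDominant_dot_weyl hd r s (by omega)).mpr (Or.inl ⟨rfl, hs⟩)⟩
    have h1 : ¬ r + d ≤ s - 1 := fun hs =>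
      h ⟨d, le_rfl, (isDominant_dot_weyl hd r s le_rfl).mpr (Or.inr ⟨rfl, hs⟩)⟩
    rw [only _ (s - 1 - r).toNat]
    · omega
    · intro k
      constructor
      · rintro ⟨hk, hk'⟩
        rw [dot_weyl_eq_succ r s hk] at hk'
        omega
      · intro hk
        have hkd : k < d := by omega
        exact ⟨hkd, (dot_weyl_eq_succ r s hkd).mpr (by omega)⟩

theorem muWeight_apply (r s : ℤ) {i : ℕ} (hi : 1 ≤ i) (hid : i ≤ d) (a : Fin (d + 1)) :
    muWeight d r s i a = (if 0 ≤ r - s + i then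
      if (a : ℕ) < i then -1 else if (a : ℕ) = i then r - s + i else 0
      else if (a : ℕ) < i - 1 then -1 else if (a : ℕ) = i - 1 then r - s + i - 1 else 0) + s := by
  rw [muWeight]
  have h := le_iZero (by omega) r s hi hid
  by_cases hn : 0 ≤ r - s + i
  · rw [if_neg (by omega), if_pos hn, dot_weyl r s hid]
    split_ifs <;> omega
  · rw [if_pos (by omega), if_neg hn, dot_weyl r s (by omega)]
    split_ifs <;> omega

end Weights

/-! ### The isomorphism -/

section Main

variable {K : Type*} [Field K] {d : ℕ}

theorem exists_equiv_muWeight [CharZero K] (r s : ℤ) {p : ℕ} (hp : p + 1 ≤ d) :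
    ∃ φ : HTilde K d (r - s) (p + 1) ≃ₗ[K] SimpleModule K (muWeight d r s (p + 1)),
      ∀ (u : Ug K d) (h : HTilde K d (r - s) (p + 1)),
        φ (envelopingAction (r - s) s (p + 1) u h) = u • φ h := by
  have sum : ∀ (q : Fin (d + 1)) (c : ℤ), ∑ a : Fin (d + 1),
      (if (a : ℕ) < q then -1 else if (a : ℕ) = q then c else 0 : ℤ) = c - (q : ℕ) := by
    intro q c
    have e : ∀ a : Fin (d + 1), (if (a : ℕ) < q then -1 else if (a : ℕ) = q then c else 0 : ℤ) =
        (if a = q then c else 0) - if a < q then 1 else 0 := by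
      intro a
      simp only [Fin.lt_def, Fin.ext_iff]
      split_ifs <;> omega
    rw [Finset.sum_congr rfl fun a _ => e a, Finset.sum_sub_distrib,
      Finset.sum_ite_eq' _ q, if_pos (Finset.mem_univ q), Finset.sum_boole,
      Finset.filter_gt_eq_Iio, Fin.card_Iio]
  -- Raising an exponent `-1` at an index `a ≤ p` makes it zero and so leaves the cone.
  have lt_top : ∀ {m : Fin (d + 1) → ℤ} {a b : Fin (d + 1)}, a < b → (a : ℕ) ≤ p → m a = -1 →
      m + Pi.single a 1 - Pi.single b 1 ∉ cone d (r - s) p := by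
    intro m a b hab hap hma hm
    have := (hm.2 a).mpr hap
    rw [shift_apply, if_pos rfl, if_neg hab.ne, hma] at this
    omega
  by_cases hn : 0 ≤ r - s + ((p + 1 : ℕ) : ℤ)
  · refine exists_equiv_of_top s hp
      (m := fun a => if (a : ℕ) < p + 1 then -1 else if (a : ℕ) = p + 1 then
        r - s + ((p + 1 : ℕ) : ℤ) else 0) ⟨?_, fun a => ?_⟩ (fun a b hab => ?_) fun a => ?_
    · refine (sum ⟨p + 1, by omega⟩ _).trans ?_
      push_cast
      ring
    · dsimp only
      split_ifs <;> omega
    · rw [Fin.lt_def] at hab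
      by_cases hb : (b : ℕ) ≤ p + 1
      -- If `b ≤ p + 1`, then `a ≤ p` carries the exponent `-1`; beyond `p + 1` the exponent at `b`
      -- is zero.
      · exact Or.inr (lt_top hab (by omega) (if_pos (by omega)))
      · left
        rw [if_neg (by omega), if_neg (by omega)]
    · rw [muWeight_apply r s (by omega) hp, if_pos hn]
  · refine exists_equiv_of_top s hp
      (m := fun a => if (a : ℕ) < p then -1 else if (a : ℕ) = p then
        r - s + ((p + 1 : ℕ) : ℤ) - 1 else 0) ⟨?_, fun a => ?_⟩ (fun a b hab => ?_) fun a => ?_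
    · refine (sum ⟨p, by omega⟩ _).trans ?_
      push_cast
      ring
    · dsimp only
      split_ifs <;> omega
    · rw [Fin.lt_def] at hab
      by_cases hb : (b : ℕ) ≤ p
      · exact Or.inr (lt_top hab (by omega) (if_pos (by omega)))
      · left
        rw [if_neg (by omega), if_neg (by omega)]
    · rw [muWeight_apply r s (by omega) hp, if_neg hn, Nat.add_sub_cancel]

/-- The representation of the parabolic subgroup transported along an isomorphism of
`U(𝔤)`-modules integrates the action of the Lie algebra. -/
theorem exists_isIntegration {i : ℕ} {H M : Type*} [AddCommGroup H] [Module K H]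
    [AddCommGroup M] [Module K M] [Module (Ug K d) M] (E : Gl K d →ₗ⁅K⁆ Module.End K H)
    (G : Representation K (parabolic K d i) H)
    (adjoint : ∀ g x h, G g (E x h) = E (g.1.1 * x * g.1⁻¹.1) (G g h))
    (algebraic : ∀ h, ∃ (k : ℕ) (w : Fin k → H) (F : Fin k → RegularFunction K d),
      (∀ g : parabolic K d i, G g h = ∑ j, (F j).value g.1 • w j) ∧
      ∀ x ∈ parabolicLie K d i, E x h = ∑ j, (F j).derivAtOne x • w j)
    (φ : H ≃ₗ[K] M) (hφ : ∀ u h, φ (UniversalEnvelopingAlgebra.lift K E u h) = u • φ h) :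
    ∃ ρ : Representation K (parabolic K d i) M, IsIntegration ρ ∧
      ∀ g h, φ (G g h) = ρ g (φ h) := by
  let ρ : Representation K (parabolic K d i) M :=
    ((φ.conjAlgEquiv K : Module.End K H →ₐ[K] Module.End K M) : Module.End K H →* _).comp G
  have hρ : ∀ g h, φ (G g h) = ρ g (φ h) := by
    intro g h
    change _ = φ (G g (φ.symm (φ h)))
    rw [φ.symm_apply_apply]
  have hE : ∀ x h, φ (E x h) = UniversalEnvelopingAlgebra.ι K x • φ h := by
    intro x h
    rw [← hφ, UniversalEnvelopingAlgebra.lift_ι_apply]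
  refine ⟨ρ, ⟨fun g x m => ?_, fun m => ?_⟩, hρ⟩
  · obtain ⟨h, rfl⟩ := φ.surjective m
    rw [← hE, ← hρ, ← hρ, ← hE, adjoint]
  · obtain ⟨h, rfl⟩ := φ.surjective m
    obtain ⟨k, w, F, hg, hx⟩ := algebraic h
    refine ⟨k, fun j => φ (w j), F, fun g => ?_, fun x hxx => ?_⟩
    · rw [← hρ, hg, map_sum]
      simp only [map_smul]
    · rw [← hE, hx x hxx, map_sum]
      simp only [map_smul]

set_option maxHeartbeats 400000 in
theorem exists_isIntegration_equiv [CharZero K] (r s : ℤ) {p : ℕ} (hp : p + 1 ≤ d) :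
    ∃ ρ : Representation K (parabolic K d (p + 1)) (SimpleModule K (muWeight d r s (p + 1))),
      IsIntegration ρ ∧
      ∃ φ : HTilde K d (r - s) (p + 1) ≃ₗ[K] SimpleModule K (muWeight d r s (p + 1)),
        (∀ (u : Ug K d) (h : HTilde K d (r - s) (p + 1)),
          φ (envelopingAction (r - s) s (p + 1) u h) = u • φ h) ∧
        ∀ (g : parabolic K d (p + 1)) (h : HTilde K d (r - s) (p + 1)),
          φ (groupAction (r - s) s (p + 1) g h) = ρ g (φ h) := by
  obtain ⟨φ, hφ⟩ := exists_equiv_muWeight (K := K) r s hp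
  have := exists_isIntegration (lieAction (r - s) s (p + 1)) (groupAction (r - s) s (p + 1))
    (fun g x h => groupAction_lieAction (r - s) s g x h)
    (fun h => exists_regularFunction (r - s) s hp h) φ hφ
  exact this.imp fun _ h => ⟨h.1, φ, hφ, h.2⟩

end Main

end ProjLine

end

/-- For `1 ≤ i ≤ d`, the module `H̃^i_{ℙ^{d-i}}(ℙ^d, ℒ_λ)`, where `λ = (r, s, …, s)` and
`ℒ_λ = 𝒪(r - s) ⊗ det^s`, is isomorphic to `L(μ_{i,λ})`, compatibly with the actions of `U(𝔤)` and
of the parabolic subgroup, which acts on `L(μ_{i,λ})` by integration. -/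
theorem mainTheorem6 (K : Type*) [Field K] [CharZero K] (d : ℕ) (r s : ℤ) (i : ℕ)
    (hi : 1 ≤ i) (hid : i ≤ d) :
    ∃ ρ : Representation K (ProjLine.parabolic K d i)
        (ProjLine.SimpleModule K (ProjLine.muWeight d r s i)),
      ProjLine.IsIntegration ρ ∧
      ∃ φ : ProjLine.HTilde K d (r - s) i ≃ₗ[K]
          ProjLine.SimpleModule K (ProjLine.muWeight d r s i),
        (∀ (u : ProjLine.Ug K d) (h : ProjLine.HTilde K d (r - s) i),
          φ (ProjLine.envelopingAction (r - s) s i u h) = u • φ h) ∧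
        ∀ (p : ProjLine.parabolic K d i) (h : ProjLine.HTilde K d (r - s) i),
          φ (ProjLine.groupAction (r - s) s i p h) = ρ p (φ h) := by
  cases i with
  | zero => omega
  | succ p => exact ProjLine.exists_isIntegration_equiv r s hid
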